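/- Let $g \ge 2$ be an integer. Let $\mathbb{D}$ be the Poincaré disk model of the hyperbolic plane (curvature $-1$), and let $D_g \subset \mathbb{D}$ be the regular hyperbolic $4g$-gon centered at the origin with angle sum $2\pi$, with the midpoint of one side on the positive real axis. The generalized Bolza group $\Gamma_g$ is the group generated by the orientation-preserving isometries $f_0, \dots, f_{4g-1}$ of $\mathbb{D}$ that pair opposite sides of $D_g$: number the sides $s_0, \dots, s_{4g-1}$ counterclockwise, with indices modulo $4g$; then $f_j$ maps $s_{j+2g}$ onto $s_j$, and $f_j(D_g) \cap D_g = s_j$. Let $M_g = \mathbb{D}/\Gamma_g$ be the generalized Bolza surface of genus $g$, with its quotient metric. The systole of $M_g$, that is, the length of a shortest non-contractible closed curve on $M_g$ (equivalently, the minimal length of a simple closed geodesic of $M_g$), equals $$\varsigma_g = 2\,\operatorname{arcosh}\Bigl(1 + 2\cos\bigl(\tfrac{\pi}{2g}\bigr)\Bigr).$$ In particular, both minima are attained. -/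

import Mathlib

open scoped Complex.UnitDisc ENNReal ComplexConjugate

noncomputable section

namespace Bolza

/-! ### The Poincaré disk -/

/-- The hyperbolic distance (curvature `-1`) of the Poincaré disk model. -/
def hypDist (z w : 𝔻) : ℝ :=
  2 * Real.arsinh (‖(z : ℂ) - w‖ / √((1 - ‖(z : ℂ)‖ ^ 2) * (1 - ‖(w : ℂ)‖ ^ 2)))

/-- The Cayley transform from the disk to the upper half-plane. It is only used to transfer the
triangle inequality. -/
def cayley (z : 𝔻) : UpperHalfPlane where
  coe := Complex.I * (1 + z) / (1 - z)
  coe_im_pos := by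
    have h1 : (1 - (z : ℂ)) ≠ 0 := sub_ne_zero.2 (fun h => z.coe_ne_one h.symm)
    have h2 := z.normSq_lt_one
    have h3 : 0 < Complex.normSq (1 - (z : ℂ)) := Complex.normSq_pos.2 h1
    have h4 : (Complex.I * (1 + z) / (1 - z)).im
        = (1 - Complex.normSq (z : ℂ)) / Complex.normSq (1 - (z : ℂ)) := by
      rw [Complex.div_im]
      simp only [Complex.mul_re, Complex.mul_im, Complex.I_re, Complex.I_im, Complex.add_re,
        Complex.add_im, Complex.one_re, Complex.one_im, Complex.sub_re, Complex.sub_im]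
      rw [← sub_div]
      congr 1
      simp only [Complex.normSq_apply]
      ring
    rw [h4]
    exact div_pos (by linarith) h3

theorem cayley_im (z : 𝔻) :
    (cayley z).im = (1 - ‖(z : ℂ)‖ ^ 2) / ‖1 - (z : ℂ)‖ ^ 2 := by
  change (Complex.I * (1 + z) / (1 - z)).im = _
  rw [Complex.div_im, ← Complex.normSq_eq_norm_sq, ← Complex.normSq_eq_norm_sq]
  simp only [Complex.mul_re, Complex.mul_im, Complex.I_re, Complex.I_im, Complex.add_re,
    Complex.add_im, Complex.one_re, Complex.one_im, Complex.sub_re, Complex.sub_im]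
  rw [← sub_div]
  congr 1
  simp only [Complex.normSq_apply]
  ring

theorem hypDist_eq (z w : 𝔻) : hypDist z w = dist (cayley z) (cayley w) := by
  have hz : (1 - (z : ℂ)) ≠ 0 := sub_ne_zero.2 (fun h => z.coe_ne_one h.symm)
  have hw : (1 - (w : ℂ)) ≠ 0 := sub_ne_zero.2 (fun h => w.coe_ne_one h.symm)
  have hz' : 0 < ‖1 - (z : ℂ)‖ := norm_pos_iff.2 hz
  have hw' : 0 < ‖1 - (w : ℂ)‖ := norm_pos_iff.2 hw
  rw [UpperHalfPlane.dist_eq, hypDist, cayley_im, cayley_im]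
  congr 2
  have h1 : dist (cayley z : ℂ) (cayley w : ℂ)
      = 2 * ‖(z : ℂ) - w‖ / (‖1 - (z : ℂ)‖ * ‖1 - (w : ℂ)‖) := by
    have : (cayley z : ℂ) - (cayley w : ℂ)
        = 2 * Complex.I * ((z : ℂ) - w) / ((1 - (z : ℂ)) * (1 - (w : ℂ))) := by
      change Complex.I * (1 + z) / (1 - z) - Complex.I * (1 + w) / (1 - w) = _
      field_simp
      ring
    rw [Complex.dist_eq, this]
    simp
  have h2 : (1 - ‖(z : ℂ)‖ ^ 2) / ‖1 - (z : ℂ)‖ ^ 2 * ((1 - ‖(w : ℂ)‖ ^ 2) / ‖1 - (w : ℂ)‖ ^ 2)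
      = ((1 - ‖(z : ℂ)‖ ^ 2) * (1 - ‖(w : ℂ)‖ ^ 2)) / (‖1 - (z : ℂ)‖ * ‖1 - (w : ℂ)‖) ^ 2 := by
    field_simp
  rw [h1, h2, Real.sqrt_div' _ (by positivity), Real.sqrt_sq (by positivity)]
  have hs : 0 < √((1 - ‖(z : ℂ)‖ ^ 2) * (1 - ‖(w : ℂ)‖ ^ 2)) :=
    Real.sqrt_pos.2 (mul_pos (by linarith [z.sq_norm_lt_one]) (by linarith [w.sq_norm_lt_one]))
  field_simp

theorem cayley_isInducing : Topology.IsInducing cayley := by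
  have hc : Continuous cayley := by
    rw [UpperHalfPlane.isEmbedding_coe.continuous_iff]
    change Continuous fun z : 𝔻 => Complex.I * (1 + (z : ℂ)) / (1 - (z : ℂ))
    refine Continuous.div ?_ ?_ (fun z => sub_ne_zero.2 (fun h => z.coe_ne_one h.symm))
    · exact continuous_const.mul (continuous_const.add Complex.UnitDisc.continuous_coe)
    · exact continuous_const.sub Complex.UnitDisc.continuous_coe
  have hI : ∀ w : UpperHalfPlane, (w : ℂ) + Complex.I ≠ 0 := fun w h => by
    have := congrArg Complex.im h
    have hw := w.im_pos
    simp at this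
    linarith
  have hd : Continuous fun w : UpperHalfPlane => ((w : ℂ) - Complex.I) / ((w : ℂ) + Complex.I) :=
    Continuous.div (UpperHalfPlane.continuous_coe.sub continuous_const)
      (UpperHalfPlane.continuous_coe.add continuous_const) hI
  refine Topology.IsInducing.of_comp hc hd ?_
  have : (fun w : UpperHalfPlane => ((w : ℂ) - Complex.I) / ((w : ℂ) + Complex.I)) ∘ cayley
      = ((↑) : 𝔻 → ℂ) := by
    funext z
    have hz : (1 - (z : ℂ)) ≠ 0 := sub_ne_zero.2 (fun h => z.coe_ne_one h.symm)
    have h2 := hI (cayley z)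
    simp only [Function.comp]
    rw [div_eq_iff h2]
    change Complex.I * (1 + z) / (1 - z) - Complex.I
      = z * (Complex.I * (1 + z) / (1 - z) + Complex.I)
    field_simp
    ring
  rw [this]
  exact Complex.UnitDisc.isEmbedding_coe.toIsInducing

theorem hypDist_self (z : 𝔻) : hypDist z z = 0 := by simp [hypDist]

theorem hypDist_comm (z w : 𝔻) : hypDist z w = hypDist w z := by
  rw [hypDist_eq, hypDist_eq, dist_comm]

theorem hypDist_triangle (x y z : 𝔻) : hypDist x z ≤ hypDist x y + hypDist y z := by
  simp only [hypDist_eq]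
  exact dist_triangle _ _ _

theorem hypDist_isOpen_iff (s : Set 𝔻) :
    IsOpen s ↔ ∀ x ∈ s, ∃ ε > 0, ∀ y, hypDist x y < ε → y ∈ s := by
  rw [isOpen_iff_mem_nhds]
  refine forall₂_congr fun x _ => ?_
  rw [cayley_isInducing.nhds_eq_comap, (Metric.nhds_basis_ball.comap cayley).mem_iff]
  refine exists_congr fun ε => and_congr_right fun _ => ?_
  simp only [Set.subset_def, Set.mem_preimage, Metric.mem_ball, hypDist_eq, dist_comm (cayley x)]

/-- The Poincaré disk: Mathlib's unit disc, with its topology and the hyperbolic distance. -/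
instance instMetricSpaceDisc : MetricSpace 𝔻 where
  toPseudoMetricSpace :=
    PseudoMetricSpace.ofDistTopology hypDist hypDist_self hypDist_comm hypDist_triangle
      hypDist_isOpen_iff
  eq_of_dist_eq_zero := by
    intro z w h
    change hypDist z w = 0 at h
    have hs : 0 < √((1 - ‖(z : ℂ)‖ ^ 2) * (1 - ‖(w : ℂ)‖ ^ 2)) :=
      Real.sqrt_pos.2 (mul_pos (by linarith [z.sq_norm_lt_one]) (by linarith [w.sq_norm_lt_one]))
    rw [hypDist, mul_eq_zero, Real.arsinh_eq_zero_iff, div_eq_zero_iff] at h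
    rcases h with h | h | h
    · norm_num at h
    · exact Complex.UnitDisc.coe_injective (sub_eq_zero.1 (norm_eq_zero.1 h))
    · exact absurd h hs.ne'

/-- Orientation preserving isometries of the Poincaré disk: the linear fractional transformations
`z ↦ (a z + b) / (conj b z + conj a)` with `|a|² - |b|² = 1`. -/
def OrientationPreserving (f : 𝔻 ≃ᵢ 𝔻) : Prop :=
  ∃ a b : ℂ, ‖a‖ ^ 2 - ‖b‖ ^ 2 = 1 ∧ ∀ z : 𝔻, (f z : ℂ) = (a * z + b) / (conj b * z + conj a)

/-- The Euclidean direction at `0` of the geodesic from `p` to `q`, after moving `p` to `0` by the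
orientation preserving isometry `z ↦ (z - p) / (1 - conj p z)`, whose derivative at `p` is
positive. -/
def direction (p q : 𝔻) : ℂ := ((q : ℂ) - p) / (1 - conj (p : ℂ) * q)

/-- The hyperbolic angle at `p` between the geodesic segments `[p, q]` and `[p, r]` (the model is
conformal). -/
def hypAngle (p q r : 𝔻) : ℝ := InnerProductGeometry.angle (direction p q) (direction p r)

/-! ### Quotients of the disk -/

/-- Two points are equivalent if they lie in the same `Γ`-orbit. -/
def orbitSetoid (Γ : Subgroup (𝔻 ≃ᵢ 𝔻)) : Setoid 𝔻 where
  r z w := ∃ f ∈ Γ, f z = w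
  iseqv :=
    { refl := fun z => ⟨1, Γ.one_mem, rfl⟩
      symm := by
        rintro z w ⟨f, hf, rfl⟩
        exact ⟨f⁻¹, Γ.inv_mem hf, f.symm_apply_apply z⟩
      trans := by
        rintro x y z ⟨f, hf, rfl⟩ ⟨h, hh, rfl⟩
        exact ⟨h * f, Γ.mul_mem hh hf, rfl⟩ }

/-- The quotient `𝔻 / Γ`. -/
def QuotientSurface (Γ : Subgroup (𝔻 ≃ᵢ 𝔻)) : Type := Quotient (orbitSetoid Γ)

/-- The projection `𝔻 → 𝔻 / Γ`. -/
def proj (Γ : Subgroup (𝔻 ≃ᵢ 𝔻)) (z : 𝔻) : QuotientSurface Γ := Quotient.mk (orbitSetoid Γ) z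

/-- The quotient topology. -/
instance instTopologicalSpaceQuotient (Γ : Subgroup (𝔻 ≃ᵢ 𝔻)) :
    TopologicalSpace (QuotientSurface Γ) :=
  TopologicalSpace.coinduced (proj Γ) inferInstance

/-- The distance of two points of `𝔻 / Γ`: the infimum of the distances of their lifts. -/
def quotDist (Γ : Subgroup (𝔻 ≃ᵢ 𝔻)) (p q : QuotientSurface Γ) : ℝ :=
  sInf {d : ℝ | ∃ z w : 𝔻, proj Γ z = p ∧ proj Γ w = q ∧ dist z w = d}

section quotDist

variable (Γ : Subgroup (𝔻 ≃ᵢ 𝔻))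

theorem proj_surjective : Function.Surjective (proj Γ) := Quotient.mk_surjective

theorem proj_eq_iff {z w : 𝔻} : proj Γ z = proj Γ w ↔ ∃ f ∈ Γ, f z = w := Quotient.eq

theorem quotDist_set_bddBelow (p q : QuotientSurface Γ) :
    BddBelow {d : ℝ | ∃ z w : 𝔻, proj Γ z = p ∧ proj Γ w = q ∧ dist z w = d} :=
  ⟨0, by rintro _ ⟨z, w, -, -, rfl⟩; exact dist_nonneg⟩

theorem quotDist_le (z w : 𝔻) : quotDist Γ (proj Γ z) (proj Γ w) ≤ dist z w :=
  csInf_le (quotDist_set_bddBelow Γ _ _) ⟨z, w, rfl, rfl, rfl⟩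

theorem quotDist_nonneg (p q : QuotientSurface Γ) : 0 ≤ quotDist Γ p q :=
  Real.sInf_nonneg (by rintro _ ⟨z, w, -, -, rfl⟩; exact dist_nonneg)

theorem quotDist_lt {z : 𝔻} {q : QuotientSurface Γ} {r : ℝ} (h : quotDist Γ (proj Γ z) q < r) :
    ∃ w, proj Γ w = q ∧ dist z w < r := by
  obtain ⟨w₀, hw₀⟩ := proj_surjective Γ q
  have hne : {d : ℝ | ∃ x y : 𝔻, proj Γ x = proj Γ z ∧ proj Γ y = q ∧ dist x y = d}.Nonempty :=
    ⟨_, z, w₀, rfl, hw₀, rfl⟩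
  obtain ⟨_, ⟨x, y, hx, rfl, rfl⟩, hlt⟩ := exists_lt_of_csInf_lt hne h
  obtain ⟨f, hf, rfl⟩ := (proj_eq_iff Γ).1 hx
  exact ⟨f y, ((proj_eq_iff Γ).2 ⟨f, hf, rfl⟩).symm, by rwa [f.isometry.dist_eq]⟩

theorem quotDist_self (p : QuotientSurface Γ) : quotDist Γ p p = 0 := by
  obtain ⟨z, rfl⟩ := proj_surjective Γ p
  exact le_antisymm ((quotDist_le Γ z z).trans (dist_self z).le) (quotDist_nonneg Γ _ _)

theorem quotDist_comm (p q : QuotientSurface Γ) : quotDist Γ p q = quotDist Γ q p := by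
  unfold quotDist
  congr 1
  ext d
  constructor
  · rintro ⟨z, w, hz, hw, rfl⟩
    exact ⟨w, z, hw, hz, dist_comm _ _⟩
  · rintro ⟨z, w, hz, hw, rfl⟩
    exact ⟨w, z, hw, hz, dist_comm _ _⟩

theorem quotDist_triangle (p q r : QuotientSurface Γ) :
    quotDist Γ p r ≤ quotDist Γ p q + quotDist Γ q r := by
  refine le_of_forall_pos_lt_add fun ε hε => ?_
  obtain ⟨x, rfl⟩ := proj_surjective Γ p
  obtain ⟨y, rfl, hy⟩ := quotDist_lt Γ (lt_add_of_pos_right (quotDist Γ (proj Γ x) q) (half_pos hε))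
  obtain ⟨z, rfl, hz⟩ := quotDist_lt Γ (lt_add_of_pos_right (quotDist Γ (proj Γ y) r) (half_pos hε))
  linarith [quotDist_le Γ x z, dist_triangle x y z]

theorem quotDist_isOpen_iff (s : Set (QuotientSurface Γ)) :
    IsOpen s ↔ ∀ x ∈ s, ∃ ε > 0, ∀ y, quotDist Γ x y < ε → y ∈ s := by
  rw [isOpen_coinduced, Metric.isOpen_iff]
  constructor
  · intro h x hx
    obtain ⟨z, rfl⟩ := proj_surjective Γ x
    obtain ⟨ε, hε, hs⟩ := h z hx
    refine ⟨ε, hε, fun y hy => ?_⟩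
    obtain ⟨w, rfl, hw⟩ := quotDist_lt Γ hy
    exact hs (by rwa [Metric.mem_ball, dist_comm])
  · intro h z hz
    obtain ⟨ε, hε, hs⟩ := h (proj Γ z) hz
    refine ⟨ε, hε, fun w hw => hs _ ((quotDist_le Γ z w).trans_lt ?_)⟩
    rwa [Metric.mem_ball, dist_comm] at hw

end quotDist

/-- The quotient distance, compatible with the quotient topology. (It separates points if the orbits
of `Γ` are closed, as for a Fuchsian group.) -/
instance instPseudoMetricSpaceQuotient (Γ : Subgroup (𝔻 ≃ᵢ 𝔻)) :
    PseudoMetricSpace (QuotientSurface Γ) :=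
  PseudoMetricSpace.ofDistTopology (quotDist Γ) (quotDist_self Γ) (quotDist_comm Γ)
    (quotDist_triangle Γ) (quotDist_isOpen_iff Γ)

/-! ### Lengths of curves and systoles -/

/-- The length of a curve: the supremum of the lengths of inscribed polygons. -/
def curveLength {X : Type*} [PseudoMetricSpace X] {x y : X} (γ : Path x y) : ℝ≥0∞ :=
  eVariationOn γ Set.univ

/-- The lengths of the non-contractible closed curves in `X`. -/
def noncontractibleLengths (X : Type*) [PseudoMetricSpace X] : Set ℝ≥0∞ :=
  {ℓ | ∃ (x : X) (γ : Path x x), ¬ γ.Homotopic (Path.refl x) ∧ curveLength γ = ℓ}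

/-- `s` is the systole of `X`: the length of a shortest non-contractible closed curve. -/
def IsSystole (X : Type*) [PseudoMetricSpace X] (s : ℝ) : Prop :=
  0 ≤ s ∧ IsLeast (noncontractibleLengths X) (ENNReal.ofReal s)

/-- The lengths of the simple closed geodesics of `𝔻 / Γ`, for a group `Γ` of orientation preserving
isometries. Here `c` is a hyperbolic line
parametrized by arc length, and `f ∈ Γ` translates along `c` by `ℓ > 0`; that is, `f` is a hyperbolic
translation with axis `c` and translation length `ℓ`, and the closed geodesic is the image of
the segment of `c` from `c 0` to `f (c 0) = c ℓ`. -/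
def simpleClosedGeodesicLengths (Γ : Subgroup (𝔻 ≃ᵢ 𝔻)) : Set ℝ :=
  {ℓ | 0 < ℓ ∧ ∃ f ∈ Γ, ∃ c : ℝ → 𝔻, Isometry c ∧ (∀ t, f (c t) = c (t + ℓ)) ∧
    Set.InjOn (fun t => proj Γ (c t)) (Set.Ico 0 ℓ)}

/-! ### The generalized Bolza surfaces -/

/-- `v` lists counterclockwise (with indices modulo `n`) the vertices of a regular hyperbolic `n`-gon
centered at the origin, with the midpoint of `[v 0, v 1]` on the positive real axis. -/
def IsRegularPolygon (n : ℕ) (v : ℤ → 𝔻) : Prop :=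
  ∃ r : ℝ, 0 < r ∧ ∀ j : ℤ,
    (v j : ℂ) = r * Complex.exp (2 * Real.pi * Complex.I * (j - 1 / 2) / n)

/-- The interior angle at the vertex `v j`. -/
def interiorAngle (v : ℤ → 𝔻) (j : ℤ) : ℝ := hypAngle (v j) (v (j - 1)) (v (j + 1))

/-- `v` lists the vertices of the regular `4g`-gon `D_g` with angle sum `2π`. -/
def IsBolzaPolygon (g : ℕ) (v : ℤ → 𝔻) : Prop :=
  IsRegularPolygon (4 * g) v ∧
    ∑ j ∈ Finset.range (4 * g), interiorAngle v j = 2 * Real.pi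

/-- `f` is the side pairing that maps the side `[v (j + 2g), v (j + 2g + 1)]` of `D_g` to the opposite
side `[v j, v (j + 1)]`. Being orientation preserving, it maps `D_g` to the polygon on the other
side of `[v j, v (j + 1)]` precisely if it reverses the cyclic order of the end points as
required here. -/
def IsSidePairing (g : ℕ) (v : ℤ → 𝔻) (j : ℤ) (f : 𝔻 ≃ᵢ 𝔻) : Prop :=
  OrientationPreserving f ∧
    f (v (j + 2 * g)) = v (j + 1) ∧ f (v (j + 2 * g + 1)) = v j

/-- The generalized Bolza group `Γ_g`, generated by the orientation preserving isometries that pair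
opposite sides of the regular `4g`-gon with angle sum `2π`. -/
def bolzaGroup (g : ℕ) : Subgroup (𝔻 ≃ᵢ 𝔻) :=
  Subgroup.closure {f | ∃ v, IsBolzaPolygon g v ∧ ∃ j : ℤ, IsSidePairing g v j f}

/-- The generalized Bolza surface `M_g = 𝔻 / Γ_g`. -/
abbrev BolzaSurface (g : ℕ) : Type := QuotientSurface (bolzaGroup g)

end Bolza

end

/-! Put θ = π/(2g) and K = 1 + 2 cos θ. The midpoints of the sides of D_g are the vertices of a
regular right-angled 4g-gon P, and K is the hyperbolic cosine of the side length a of P, so the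
claim is that the systole is 2a. The side pairing f_j is the half turn H about the centre followed
by the half turn about the midpoint of s_j, and the latter is the product of the reflections in the
two sides of P that meet there. With W the reflection group of P, every element of Γ_g is therefore
w Hⁿ with w ∈ W, where the numbers of reflections in even and in odd sides of P are both congruent
to n mod 2 (`exists_isRepresented`).

By covering theory (`isSystole_and_isLeast`) two facts suffice: every nontrivial element of Γ_g
moves every point by at least 2a (`le_dist_of_mem`), and some element translates along a line by
exactly 2a. The latter is f_1 f_0⁻¹, a product of half turns about the two ends of a side of P
(`exists_mem_axis`).

The lower bound is a trace bound |Re a| ≥ K for the SU(1,1) coefficients (a, b), proved in the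
hyperboloid model, where lines are unit spacelike vectors up to sign. For such x one has ⟨x, f x⟩ ≤
2 (Re a)² - 1 (`lorentz_mobius_self`), so it suffices to find a wall of the tessellation with ⟨x, f
x⟩ ≥ 2K² - 1 = cosh 2a. Two walls either bound a common chamber or satisfy |⟨x, y⟩| ≥ cosh 2a
(`exists_common_chamber_or_le_abs_lorentz`), because nonadjacent sides of P are at least a apart.

To find the wall, pass to an element of minimal word length in the conjugacy class (twisted by H if
n is odd). Each of its left descents s either commutes with it, in the twisted sense, or gives a
wall with product > -1 against its image. The parities provide a descent of the second kind. If n is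
even, the wall and its image cannot share a chamber. If n is odd and they do, the element is
conjugate to H followed by a half turn whose centre is on a side line of P but not inside the side.
It then translates by at least twice the circumradius of P, which is enough since g ≥ 2
(`le_mul_im_sq_of_rep_root_eq_neg`). -/

noncomputable section

namespace Bolza

/-! ### Quotients by groups with bounded below displacement -/

section Displacement

variable {Γ : Subgroup (𝔻 ≃ᵢ 𝔻)} {ℓ : ℝ}

theorem continuous_proj (Γ : Subgroup (𝔻 ≃ᵢ 𝔻)) : Continuous (proj Γ) := continuous_coinduced_rng

/-- The evaluation action of a group of isometries. -/
abbrev evalAction (Γ : Subgroup (𝔻 ≃ᵢ 𝔻)) : MulAction Γ 𝔻 where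
  smul f z := (f : 𝔻 ≃ᵢ 𝔻) z
  one_smul _ := rfl
  mul_smul _ _ _ := rfl

/-- A ball of radius ℓ/2 is disjoint from its nontrivial translates, since a point w and its image f
w in the same ball would be less than ℓ apart. -/
theorem isQuotientCoveringMap_proj (hℓ : 0 < ℓ)
    (h : ∀ f ∈ Γ, f ≠ 1 → ∀ z, ℓ ≤ dist z (f z)) :
    letI := evalAction Γ
    IsQuotientCoveringMap (proj Γ) Γ := by
  let := evalAction Γ
  refine { toIsQuotientMap := ⟨⟨rfl⟩, proj_surjective Γ⟩, continuous_const_smul := ?_,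
           apply_eq_iff_mem_orbit := ?_, disjoint := ?_ }
  · exact fun f => (f : 𝔻 ≃ᵢ 𝔻).continuous
  · intro z w
    rw [eq_comm, proj_eq_iff]
    constructor
    · rintro ⟨f, hf, rfl⟩
      exact ⟨⟨f, hf⟩, rfl⟩
    · rintro ⟨f, rfl⟩
      exact ⟨f, f.2, rfl⟩
  · intro z
    refine ⟨Metric.ball z (ℓ / 2), Metric.ball_mem_nhds z (half_pos hℓ), ?_⟩
    rintro f ⟨_, ⟨w, hw, rfl⟩, hfw⟩
    by_contra hne
    have h1 := h f f.2 (fun h1 => hne (Subtype.ext h1)) w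
    have h2 : dist ((f : 𝔻 ≃ᵢ 𝔻) w) z < ℓ / 2 := hfw
    have h3 : dist w z < ℓ / 2 := hw
    linarith [dist_triangle_right w ((f : 𝔻 ≃ᵢ 𝔻) w) z]

theorem isCoveringMap_proj (hℓ : 0 < ℓ) (h : ∀ f ∈ Γ, f ≠ 1 → ∀ z, ℓ ≤ dist z (f z)) :
    IsCoveringMap (proj Γ) :=
  let := evalAction Γ
  (isQuotientCoveringMap_proj hℓ h).isCoveringMap

/-- A strictly closer lift f w of the second point would, like w, be within ℓ/2 of z, so that f
would displace w by less than ℓ. -/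
theorem dist_proj_eq (h : ∀ f ∈ Γ, f ≠ 1 → ∀ z, ℓ ≤ dist z (f z)) {z w : 𝔻}
    (hzw : dist z w < ℓ / 2) : dist (proj Γ z) (proj Γ w) = dist z w := by
  refine le_antisymm (quotDist_le Γ z w) (not_lt.1 fun hlt => ?_)
  obtain ⟨w', hw', hlt⟩ := quotDist_lt Γ (z := z) (q := proj Γ w) hlt
  obtain ⟨f, hf, rfl⟩ := (proj_eq_iff Γ).1 hw'.symm
  by_cases h1 : f = 1
  · subst h1
    exact lt_irrefl _ hlt
  · linarith [h f hf h1 w, dist_triangle_left w (f w) z]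

/-! ### Lifting curves from the quotient to the disk -/

instance instSimplyConnectedSpaceDisc : SimplyConnectedSpace 𝔻 := by
  -- The hyperbolic metric was built on the existing topology of the disc, so convexity of the
  -- Euclidean ball applies.
  have : ContractibleSpace (Metric.ball (0 : ℂ) 1) :=
    (convex_ball (0 : ℂ) 1).contractibleSpace ⟨0, by simp⟩
  exact inferInstanceAs (SimplyConnectedSpace (Metric.ball (0 : ℂ) 1))

/-- On a fine enough subdivision the steps of the lift are shorter than ℓ/2, where the projection
preserves distances. The inscribed polygon of the curve is then as long as that of its lift. -/
theorem edist_le_curveLength (hℓ : 0 < ℓ) (h : ∀ f ∈ Γ, f ≠ 1 → ∀ z, ℓ ≤ dist z (f z))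
    {x y : QuotientSurface Γ} (γ : Path x y) (σ : C(unitInterval, 𝔻))
    (hσ : ∀ t, proj Γ (σ t) = γ t) : edist (σ 0) (σ 1) ≤ curveLength γ := by
  have huc : UniformContinuous σ := CompactSpace.uniformContinuous_of_continuous σ.continuous
  obtain ⟨δ, hδ, hσδ⟩ := Metric.uniformContinuous_iff.1 huc (ℓ / 2) (half_pos hℓ)
  obtain ⟨N, hN⟩ := exists_nat_gt (1 / δ)
  have hN0 : (0 : ℝ) < N := lt_trans (by positivity) hN
  -- Clamping i/N to [0, 1] makes the subdivision monotone on all of ℕ, as the variation bound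
  -- requires.
  let u : ℕ → unitInterval := fun i => Set.projIcc 0 1 zero_le_one (i / N : ℝ)
  have hu : Monotone u := fun i j hij => Set.monotone_projIcc _ (by gcongr)
  have hstep : ∀ i, edist (γ (u (i + 1))) (γ (u i)) = edist (σ (u (i + 1))) (σ (u i)) := by
    intro i
    rw [edist_dist, edist_dist, ← hσ, ← hσ]
    congr 1
    refine dist_proj_eq h (hσδ ?_)
    have h1 : dist (u (i + 1)) (u i) ≤ dist (((i + 1 : ℕ) : ℝ) / N) ((i : ℝ) / N) := by
      have := (Set.abs_projIcc_sub_projIcc (zero_le_one (α := ℝ))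
        (c := ((i + 1 : ℕ) : ℝ) / N) (d := (i : ℝ) / N))
      simpa [Subtype.dist_eq, Real.dist_eq, u] using this
    refine h1.trans_lt ?_
    have h2 : (((i + 1 : ℕ) : ℝ) / N) - ((i : ℝ) / N) = 1 / N := by
      push_cast
      ring
    rw [Real.dist_eq, h2, abs_of_pos (by positivity), div_lt_iff₀ hN0]
    rw [div_lt_iff₀ hδ] at hN
    linarith
  have hu0 : u 0 = 0 := by simp [u]
  have huN : u N = 1 := by simp [u, div_self hN0.ne']
  calc edist (σ 0) (σ 1) = edist (σ (u 0)) (σ (u N)) := by rw [hu0, huN]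
    _ ≤ ∑ i ∈ Finset.range N, edist (σ (u i)) (σ (u (i + 1))) :=
      edist_le_range_sum_edist (fun i => σ (u i)) N
    _ = ∑ i ∈ Finset.range N, edist (γ (u (i + 1))) (γ (u i)) :=
      Finset.sum_congr rfl fun i _ => by rw [hstep, edist_comm]
    _ ≤ curveLength γ := eVariationOn.sum_le hu fun _ => Set.mem_univ _

/-- The ends of a lift differ by some f ∈ Γ. If f = 1, the lift is a loop in a simply connected
space and its null-homotopy projects to one of γ; otherwise the ends are at least ℓ apart. -/
theorem le_curveLength (hℓ : 0 < ℓ) (h : ∀ f ∈ Γ, f ≠ 1 → ∀ z, ℓ ≤ dist z (f z))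
    {x : QuotientSurface Γ} (γ : Path x x) (hγ : ¬ γ.Homotopic (Path.refl x)) :
    ENNReal.ofReal ℓ ≤ curveLength γ := by
  obtain ⟨e, rfl⟩ := proj_surjective Γ x
  have cov := isCoveringMap_proj hℓ h
  let σ := cov.liftPath γ.toContinuousMap e γ.source
  have hσ : ∀ t, proj Γ (σ t) = γ t := fun t =>
    congrFun (cov.liftPath_lifts γ.toContinuousMap e γ.source) t
  have hσ0 : σ 0 = e := cov.liftPath_zero _ _ _
  have h1 : proj Γ (σ 0) = proj Γ (σ 1) := by rw [hσ, hσ, γ.source, γ.target]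
  obtain ⟨f, hf, hf1⟩ := (proj_eq_iff Γ).1 h1
  by_cases hne : f = 1
  · subst hne
    exfalso
    apply hγ
    let P : Path e e := ⟨σ, hσ0, by rw [← hσ0]; exact hf1.symm⟩
    have hP : P.Homotopic (Path.refl e) := SimplyConnectedSpace.paths_homotopic _ _
    have hγP : γ = P.map (continuous_proj Γ) := Path.ext (funext fun t => (hσ t).symm)
    rw [hγP]
    exact hP.map ⟨proj Γ, continuous_proj Γ⟩
  · refine le_trans ?_ (edist_le_curveLength hℓ h γ σ hσ)
    rw [edist_dist, ← hf1]
    exact ENNReal.ofReal_le_ofReal (h f hf hne _)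

/-- This reduces both minima to a statement about Γ: a uniform lower bound ℓ for displacements, and
one translation along a line that realizes it. -/
theorem isSystole_and_isLeast (hℓ : 0 < ℓ) (h : ∀ f ∈ Γ, f ≠ 1 → ∀ z, ℓ ≤ dist z (f z))
    {f : 𝔻 ≃ᵢ 𝔻} (hf : f ∈ Γ) {c : ℝ → 𝔻} (hc : Isometry c) (hfc : ∀ t, f (c t) = c (t + ℓ)) :
    IsSystole (QuotientSurface Γ) ℓ ∧ IsLeast (simpleClosedGeodesicLengths Γ) ℓ := by
  have cov := isCoveringMap_proj hℓ h
  have hc0 : c ℓ ≠ c 0 := fun h0 => hℓ.ne' (hc.injective h0)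
  refine ⟨⟨hℓ.le, ⟨?_, ?_⟩⟩, ⟨⟨hℓ, f, hf, c, hc, hfc, ?_⟩, ?_⟩⟩
  · have htarget : proj Γ (c ℓ) = proj Γ (c 0) :=
      ((proj_eq_iff Γ).2 ⟨f, hf, by rw [hfc, zero_add]⟩).symm
    let σ : C(unitInterval, 𝔻) := ⟨fun t => c (ℓ * t),
      hc.continuous.comp (continuous_const.mul continuous_subtype_val)⟩
    let γ : Path (proj Γ (c 0)) (proj Γ (c 0)) :=
      ⟨⟨fun t => proj Γ (σ t), (continuous_proj Γ).comp σ.continuous⟩, by simp [σ],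
        by simp [σ, htarget]⟩
    have hγ : ¬ γ.Homotopic (Path.refl _) := by
      intro hhom
      -- Homotopic paths have lifts with the same end, which would force c ℓ = c 0.
      have h1 := cov.liftPath_apply_one_eq_of_homotopicRel hhom (c 0) γ.source rfl
      have h2 : σ = cov.liftPath γ.toContinuousMap (c 0) γ.source :=
        (cov.eq_liftPath_iff' _).2 ⟨rfl, by simp [σ]⟩
      have h3 : ContinuousMap.const unitInterval (c 0)
          = cov.liftPath (Path.refl (proj Γ (c 0))).toContinuousMap (c 0) rfl :=
        (cov.eq_liftPath_iff' _).2 ⟨rfl, rfl⟩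
      rw [← h2, ← h3] at h1
      exact hc0 (by simpa [σ] using h1)
    refine ⟨_, γ, hγ, le_antisymm ?_ (le_curveLength hℓ h γ hγ)⟩
    -- The closed geodesic is a 1-Lipschitz image of t ↦ ℓ t, whose variation is ℓ.
    have hlip : LipschitzOnWith 1 (fun t => proj Γ (c t)) Set.univ :=
      (LipschitzWith.of_dist_le_mul fun s t => by
        rw [NNReal.coe_one, one_mul, ← hc.dist_eq s t]
        exact quotDist_le Γ (c s) (c t)).lipschitzOnWith
    have h1 := hlip.comp_eVariationOn_le (f := fun t => proj Γ (c t))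
      (g := fun t : unitInterval => ℓ * (t : ℝ)) (s := Set.univ) (Set.mapsTo_univ _ _)
    have hmono : MonotoneOn (fun t : unitInterval => ℓ * (t : ℝ)) Set.univ :=
      fun s _ t _ hst => mul_le_mul_of_nonneg_left hst hℓ.le
    have h2 := hmono.eVariationOn_eq (Set.mem_univ (0 : unitInterval))
      (Set.mem_univ (1 : unitInterval))
    have h3 : Set.univ ∩ Set.Icc (0 : unitInterval) 1 = Set.univ := by
      rw [Set.univ_inter]
      exact Set.eq_univ_of_forall fun t => ⟨t.2.1, t.2.2⟩
    rw [h3] at h2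
    refine (h1.trans ?_)
    simpa using h2.le
  · rintro _ ⟨x, γ, hγ, rfl⟩
    exact le_curveLength hℓ h γ hγ
  · have key : ∀ s ∈ Set.Ico 0 ℓ, ∀ t ∈ Set.Ico 0 ℓ, proj Γ (c s) = proj Γ (c t) → s = t := by
      intro s hs t ht hst
      obtain ⟨k, hk, hkst⟩ := (proj_eq_iff Γ).1 hst
      by_cases h1 : k = 1
      · subst h1
        exact hc.injective hkst
      · have h2 := h k hk h1 (c s)
        rw [hkst, hc.dist_eq, Real.dist_eq] at h2
        have h3 : |s - t| < ℓ := abs_sub_lt_iff.2 ⟨by linarith [hs.2, ht.1], by linarith [hs.1, ht.2]⟩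
        linarith
    exact key
  · rintro l ⟨hl, k, hk, d, hd, hkd, -⟩
    have hk1 : k ≠ 1 := by
      rintro rfl
      have h1 : d 0 = d (0 + l) := hkd 0
      exact hl.ne (by simpa using hd.injective h1)
    have h1 := h k hk hk1 (d 0)
    rw [hkd, hd.dist_eq, Real.dist_eq] at h1
    simpa [abs_of_pos hl] using h1

end Displacement

/-! ### Lorentz geometry of `ℝ × ℂ` -/

/-- The Lorentz form of signature `(2, 1)` on `ℝ × ℂ`. -/
def lorentz : ℝ × ℂ →ₗ[ℝ] ℝ × ℂ →ₗ[ℝ] ℝ :=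
  LinearMap.mk₂ ℝ (fun x y => x.2.re * y.2.re + x.2.im * y.2.im - x.1 * y.1)
    (fun x y z => by simp; ring) (fun a x y => by simp; ring)
    (fun x y z => by simp; ring) (fun a x y => by simp; ring)

theorem lorentz_apply (x y : ℝ × ℂ) :
    lorentz x y = x.2.re * y.2.re + x.2.im * y.2.im - x.1 * y.1 := rfl

theorem lorentz_comm (x y : ℝ × ℂ) : lorentz x y = lorentz y x := by
  simp only [lorentz_apply]
  ring

/-- Future directed timelike vectors. -/
def IsFuture (x : ℝ × ℂ) : Prop := 0 < x.1 ∧ lorentz x x < 0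

theorem cauchy_schwarz_sq (u v : ℂ) :
    (u.re * v.re + u.im * v.im) ^ 2 ≤ (u.re ^ 2 + u.im ^ 2) * (v.re ^ 2 + v.im ^ 2) := by
  nlinarith [sq_nonneg (u.re * v.im - u.im * v.re)]

/-- The spacelike part of the Lorentz product is dominated by the timelike part. -/
theorem abs_inner_le_of_causal {x v : ℝ × ℂ} (hx : lorentz x x ≤ 0) (hv : lorentz v v ≤ 0) :
    |x.2.re * v.2.re + x.2.im * v.2.im| ≤ |x.1| * |v.1| := by
  rw [← abs_mul]
  refine sq_le_sq.1 ((cauchy_schwarz_sq _ _).trans ?_)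
  rw [lorentz_apply] at hx hv
  calc (x.2.re ^ 2 + x.2.im ^ 2) * (v.2.re ^ 2 + v.2.im ^ 2) ≤ x.1 ^ 2 * v.1 ^ 2 := by
        gcongr <;> nlinarith
    _ = _ := by ring

/-- In this signature a future timelike vector has nonpositive product with every causal vector
whose time coordinate is nonnegative. -/
theorem IsFuture.fst_neg_of_lorentz_pos {x v : ℝ × ℂ} (hx : IsFuture x) (hv : lorentz v v ≤ 0)
    (h : 0 < lorentz x v) : v.1 < 0 := by
  by_contra! h0
  have h1 := abs_inner_le_of_causal hx.2.le hv
  rw [abs_of_pos hx.1, abs_of_nonneg h0] at h1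
  rw [lorentz_apply] at h
  linarith [le_abs_self (x.2.re * v.2.re + x.2.im * v.2.im)]

theorem IsFuture.lorentz_nonneg_of_pos {x y v : ℝ × ℂ} (hx : IsFuture x) (hy : IsFuture y)
    (hv : lorentz v v ≤ 0) (h : 0 < lorentz x v) : 0 ≤ lorentz y v := by
  have h0 := hx.fst_neg_of_lorentz_pos hv h
  have h1 := abs_inner_le_of_causal hy.2.le hv
  rw [abs_of_pos hy.1, abs_of_neg h0] at h1
  rw [lorentz_apply]
  linarith [neg_abs_le (y.2.re * v.2.re + y.2.im * v.2.im)]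

theorem lorentz_nonpos_of_neg {v w : ℝ × ℂ} (hv : lorentz v v ≤ 0) (hw : lorentz w w ≤ 0)
    (hv0 : v.1 < 0) (hw0 : w.1 < 0) : lorentz v w ≤ 0 := by
  have h1 := abs_inner_le_of_causal hv hw
  rw [abs_of_neg hv0, abs_of_neg hw0] at h1
  rw [lorentz_apply]
  linarith [le_abs_self (v.2.re * w.2.re + v.2.im * w.2.im)]

/-- The reversed Cauchy-Schwarz inequality. -/
theorem mul_le_sq_lorentz {v w : ℝ × ℂ} (hv : lorentz v v ≤ 0) :
    lorentz v v * lorentz w w ≤ lorentz v w ^ 2 := by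
  by_cases h0 : v.1 = 0
  · have h1 : v.2.re = 0 := by
      rw [lorentz_apply, h0] at hv
      nlinarith [sq_nonneg v.2.re, sq_nonneg v.2.im]
    have h2 : v.2.im = 0 := by
      rw [lorentz_apply, h0] at hv
      nlinarith [sq_nonneg v.2.re, sq_nonneg v.2.im]
    simp [lorentz_apply, h0, h1, h2]
  · -- the vector `w₁ v - v₁ w` is spacelike
    have h1 : v.1 ^ 2 * (lorentz v w ^ 2 - lorentz v v * lorentz w w)
        = (v.1 * lorentz v w - w.1 * lorentz v v) ^ 2
          + -lorentz v v * ((w.1 * v.2.re - v.1 * w.2.re) ^ 2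
            + (w.1 * v.2.im - v.1 * w.2.im) ^ 2) := by
      simp only [lorentz_apply]
      ring
    have h2 : 0 < v.1 ^ 2 := by positivity
    have h3 : 0 ≤ -lorentz v v * ((w.1 * v.2.re - v.1 * w.2.re) ^ 2
            + (w.1 * v.2.im - v.1 * w.2.im) ^ 2) :=
      mul_nonneg (by linarith) (by positivity)
    have h4 : 0 ≤ v.1 ^ 2 * (lorentz v w ^ 2 - lorentz v v * lorentz w w) := by
      rw [h1]
      positivity
    linarith [nonneg_of_mul_nonneg_right h4 h2]

/-- Two half-planes with disjoint boundaries are not positioned with all three of the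
intersection patterns that occur here unless they are nested. -/
theorem neg_one_lt_lorentz {a b e x : ℝ × ℂ} (ha : lorentz a a = 1) (hb : lorentz b b = 1)
    (he : IsFuture e) (hx : IsFuture x) (hea : 0 < lorentz e a) (heb : 0 < lorentz e b)
    (hxa : lorentz x a < 0) (hxb : lorentz x b < 0) : -1 < lorentz a b := by
  by_contra! h
  -- If ⟨a, b⟩ ≤ -1 then a + b is causal, so it cannot be positive on e and negative on x, both
  -- future directed.
  have h1 : lorentz (a + b) (a + b) ≤ 0 := by
    simp only [map_add, LinearMap.add_apply, lorentz_comm b a, ha, hb]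
    linarith
  have h2 := he.lorentz_nonneg_of_pos hx h1 (by rw [map_add]; linarith)
  rw [map_add] at h2
  linarith

/-- If the lines of `a` and `c` are separated by the line of `b` then their distance is at least the
sum of the distances from `b`. -/
theorem lorentz_le_of_separated {a b c e x : ℝ × ℂ} {K : ℝ} (hK : 1 ≤ K)
    (ha : lorentz a a = 1) (hb : lorentz b b = 1) (hc : lorentz c c = 1)
    (hab : lorentz a b ≤ -K) (hbc : K ≤ lorentz b c)
    (he : IsFuture e) (hx : IsFuture x) (hea : 0 < lorentz e a) (heb : 0 < lorentz e b)
    (hxb : lorentz x b < 0) (hxc : 0 < lorentz x c) : lorentz a c ≤ -(2 * K ^ 2 - 1) := by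
  set p := -lorentz a b with hp
  set q := lorentz b c with hq
  have hpK : K ≤ p := by linarith
  have hba : lorentz b a = -p := by rw [lorentz_comm, hp, neg_neg]
  have hcb : lorentz c b = q := by rw [lorentz_comm]
  have hab' : lorentz a b = -p := by rw [hp, neg_neg]
  -- The vectors a + p b and c - q b are the components of a and c orthogonal to b. They are causal
  -- because p, q ≥ 1, and past directed by their signs at e and x. The reversed Cauchy-Schwarz
  -- inequality then bounds their product by -(K² - 1), and ⟨a, c⟩ differs from that product by -p
  -- q.
  have h1 : lorentz (a + p • b) (a + p • b) = 1 - p ^ 2 := by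
    simp only [map_add, map_smul, LinearMap.add_apply, LinearMap.smul_apply, smul_eq_mul, ha, hb,
      hba, hab']
    ring
  have h2 : lorentz (c - q • b) (c - q • b) = 1 - q ^ 2 := by
    simp only [map_sub, map_smul, LinearMap.sub_apply, LinearMap.smul_apply, smul_eq_mul, hc, hb,
      hcb, ← hq]
    ring
  have h3 : lorentz (a + p • b) (c - q • b) = lorentz a c + p * q := by
    simp only [map_add, map_sub, map_smul, LinearMap.add_apply, LinearMap.smul_apply, smul_eq_mul,
      hb, hab', ← hq]
    ring
  have h1' : lorentz (a + p • b) (a + p • b) ≤ 0 := by rw [h1]; nlinarith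
  have h2' : lorentz (c - q • b) (c - q • b) ≤ 0 := by rw [h2]; nlinarith
  have h4 : (a + p • b).1 < 0 := he.fst_neg_of_lorentz_pos h1' (by
    rw [map_add, map_smul, smul_eq_mul]
    have : 0 ≤ p * lorentz e b := mul_nonneg (by linarith) heb.le
    linarith)
  have h5 : (c - q • b).1 < 0 := hx.fst_neg_of_lorentz_pos h2' (by
    rw [map_sub, map_smul, smul_eq_mul]
    have : 0 ≤ q * -lorentz x b := mul_nonneg (by linarith) (by linarith)
    linarith)
  have h6 := lorentz_nonpos_of_neg h1' h2' h4 h5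
  have h7 := mul_le_sq_lorentz (w := c - q • b) h1'
  rw [h1, h2, h3] at h7
  rw [h3] at h6
  have h8 : (K ^ 2 - 1) ^ 2 ≤ (1 - p ^ 2) * (1 - q ^ 2) := by
    have h9 : (K ^ 2 - 1) * (K ^ 2 - 1) ≤ (p ^ 2 - 1) * (q ^ 2 - 1) :=
      mul_le_mul (by nlinarith) (by nlinarith) (by nlinarith) (by nlinarith)
    linarith
  have h9 : K ^ 2 - 1 ≤ -(lorentz a c + p * q) := by
    refine abs_le_of_sq_le_sq' ?_ (by linarith) |>.2
    linarith
  have h10 : K * K ≤ p * q := mul_le_mul hpK hbc (by linarith) (by linarith)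
  linarith

/-- The distance of two lines separated by a third one, in terms of the absolute values of the
products. -/
theorem le_abs_lorentz_of_separated {a b c e x y : ℝ × ℂ} {K : ℝ} (hK : 1 ≤ K)
    (ha : lorentz a a = 1) (hb : lorentz b b = 1) (hc : lorentz c c = 1)
    (hab : lorentz a b ≤ -K) (hbc : K ≤ |lorentz b c|)
    (he : IsFuture e) (hx : IsFuture x) (hy : IsFuture y)
    (hea : 0 < lorentz e a) (heb : 0 < lorentz e b)
    (hxb : lorentz x b < 0) (hxc : 0 < lorentz x c)
    (hyb : lorentz y b < 0) (hyc : lorentz y c < 0) : 2 * K ^ 2 - 1 ≤ |lorentz a c| := by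
  -- The normal c matters only up to sign. Beyond the line of b there is a point on each side of the
  -- line of c: x serves for c and y for -c.
  rcases le_abs.1 hbc with h | h
  · have := lorentz_le_of_separated hK ha hb hc hab h he hx hea heb hxb hxc
    exact le_abs.2 (Or.inr (by linarith))
  · have := lorentz_le_of_separated (c := -c) hK ha hb (by simpa using hc) hab (by simpa using h)
      he hy hea heb hyb (by simpa using hyc)
    rw [map_neg] at this
    exact le_abs.2 (Or.inl (by linarith))

/-- The reflection in the line orthogonal to `a`. -/
def lorentzReflection (a : ℝ × ℂ) : Module.End ℝ (ℝ × ℂ) :=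
  LinearMap.id - (2 : ℝ) • (lorentz a).smulRight a

theorem lorentzReflection_apply (a x : ℝ × ℂ) :
    lorentzReflection a x = x - (2 * lorentz a x) • a := by
  simp [lorentzReflection, smul_smul]

theorem lorentzReflection_mul_self {a : ℝ × ℂ} (ha : lorentz a a = 1) :
    lorentzReflection a * lorentzReflection a = 1 := by
  refine LinearMap.ext fun x => ?_
  simp only [Module.End.mul_apply, lorentzReflection_apply, map_sub, map_smul, ha,
    Module.End.one_apply]
  module

theorem lorentz_lorentzReflection (a x y : ℝ × ℂ) :
    lorentz (lorentzReflection a x) y = lorentz x (lorentzReflection a y) := by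
  simp only [lorentzReflection_apply, map_sub, map_smul, LinearMap.sub_apply, LinearMap.smul_apply,
    smul_eq_mul, lorentz_comm x a]
  ring

theorem lorentzReflection_commute {a b : ℝ × ℂ} (h : lorentz a b = 0) :
    lorentzReflection a * lorentzReflection b = lorentzReflection b * lorentzReflection a := by
  refine LinearMap.ext fun x => ?_
  simp only [Module.End.mul_apply, lorentzReflection_apply, map_sub, map_smul, h, lorentz_comm b a,
    mul_zero]
  module

/-! ### The roots of the right-angled `4g`-gon -/

/-- Half of the angle between the directions of two consecutive vertices of the polygon `D_g` is
`polygonAngle g / 2`. -/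
def polygonAngle (g : ℕ) : ℝ := Real.pi / (2 * g)

variable {g : ℕ}

theorem polygonAngle_pos [Fact (2 ≤ g)] : 0 < polygonAngle g := by
  have : 2 ≤ g := Fact.out
  have : (0 : ℝ) < g := by exact_mod_cast (by omega : 0 < g)
  exact div_pos Real.pi_pos (by positivity)

theorem polygonAngle_le [Fact (2 ≤ g)] : polygonAngle g ≤ Real.pi / 4 := by
  have : 2 ≤ g := Fact.out
  have : (2 : ℝ) ≤ g := by exact_mod_cast this
  exact div_le_div_of_nonneg_left Real.pi_pos.le (by norm_num) (by linarith)

theorem mul_polygonAngle [Fact (2 ≤ g)] : (4 * g : ℝ) * polygonAngle g = 2 * Real.pi := by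
  have : 2 ≤ g := Fact.out
  have : (g : ℝ) ≠ 0 := by exact_mod_cast (by omega : g ≠ 0)
  rw [polygonAngle]
  field_simp
  norm_num

theorem cos_polygonAngle_lt_one [Fact (2 ≤ g)] : Real.cos (polygonAngle g) < 1 := by
  rw [← Real.cos_zero]
  exact Real.cos_lt_cos_of_nonneg_of_le_pi le_rfl
    (by linarith [polygonAngle_le (g := g), Real.pi_pos]) polygonAngle_pos

theorem sqrt_two_div_two_le_cos_polygonAngle [Fact (2 ≤ g)] :
    √2 / 2 ≤ Real.cos (polygonAngle g) := by
  rw [← Real.cos_pi_div_four]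
  exact Real.cos_le_cos_of_nonneg_of_le_pi polygonAngle_pos.le (by linarith [Real.pi_pos])
    polygonAngle_le

theorem cos_polygonAngle_pos [Fact (2 ≤ g)] : 0 < Real.cos (polygonAngle g) :=
  lt_of_lt_of_le (by positivity) sqrt_two_div_two_le_cos_polygonAngle

/-- This is θ ≤ π/4, with equality for g = 2. It supplies the final inequality for half turns in
`le_abs_re_of_rep_mul_halfTurn_eq`. -/
theorem one_le_two_mul_cos_sq [Fact (2 ≤ g)] : 1 ≤ 2 * Real.cos (polygonAngle g) ^ 2 := by
  have h := sqrt_two_div_two_le_cos_polygonAngle (g := g)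
  have h2 : (√2 / 2) ^ 2 ≤ Real.cos (polygonAngle g) ^ 2 := by gcongr
  rw [div_pow, Real.sq_sqrt (by norm_num)] at h2
  linarith

theorem cos_le_cos_of_mem_Icc {m x : ℝ} (hm : 0 ≤ m) (hx : m ≤ x) (hx' : x ≤ 2 * Real.pi - m) :
    Real.cos x ≤ Real.cos m := by
  rcases le_total x Real.pi with h | h
  · exact Real.cos_le_cos_of_nonneg_of_le_pi hm h hx
  · rw [← Real.cos_two_pi_sub x]
    exact Real.cos_le_cos_of_nonneg_of_le_pi hm (by linarith) (by linarith)

/-- The unit vector in direction `φ`. -/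
def unitVec (φ : ℝ) : ℂ := ⟨Real.cos φ, Real.sin φ⟩

/-- The root of the side of the right-angled polygon in direction `(j + 1/2) * polygonAngle g`. The
polygon is where all roots are positive. -/
def intRoot (g : ℕ) (j : ℤ) : ℝ × ℂ :=
  -(√(1 - Real.cos (polygonAngle g)))⁻¹ • (√(Real.cos (polygonAngle g)),
    unitVec ((j + 1 / 2) * polygonAngle g))

theorem lorentz_intRoot (g : ℕ) (x : ℝ × ℂ) (j : ℤ) :
    lorentz x (intRoot g j) = (√(1 - Real.cos (polygonAngle g)))⁻¹
      * (√(Real.cos (polygonAngle g)) * x.1 - (x.2.re * Real.cos ((j + 1 / 2) * polygonAngle g)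
        + x.2.im * Real.sin ((j + 1 / 2) * polygonAngle g))) := by
  simp only [lorentz_apply, intRoot, unitVec, Prod.smul_mk, neg_smul, Prod.fst_neg, Prod.snd_neg,
    Complex.neg_re, Complex.neg_im, Complex.real_smul, Complex.re_ofReal_mul, Complex.im_ofReal_mul,
    smul_eq_mul]
  ring

/-- The normalization of `intRoot` is chosen for this formula: indices that differ by 0, 1 and 2
give 1, 0 (a right angle) and -(1 + 2 cos θ). -/
theorem lorentz_intRoot_intRoot [Fact (2 ≤ g)] (i j : ℤ) :
    lorentz (intRoot g i) (intRoot g j)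
      = (Real.cos ((i - j : ℤ) * polygonAngle g) - Real.cos (polygonAngle g))
        / (1 - Real.cos (polygonAngle g)) := by
  have h1 : 0 < 1 - Real.cos (polygonAngle g) := by linarith [cos_polygonAngle_lt_one (g := g)]
  have h2 : ((i - j : ℤ) * polygonAngle g : ℝ)
      = (i + 1 / 2) * polygonAngle g - (j + 1 / 2) * polygonAngle g := by
    push_cast
    ring
  rw [h2, Real.cos_sub, lorentz_intRoot]
  simp only [intRoot, unitVec, Prod.smul_mk, neg_smul, Prod.fst_neg, Prod.snd_neg,
    Complex.neg_re, Complex.neg_im, Complex.real_smul, Complex.re_ofReal_mul, Complex.im_ofReal_mul,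
    smul_eq_mul]
  have h3 := Real.sq_sqrt (cos_polygonAngle_pos (g := g)).le
  have h4 := Real.sq_sqrt h1.le
  have h5 : √(1 - Real.cos (polygonAngle g)) ≠ 0 := (Real.sqrt_pos.2 h1).ne'
  generalize √(1 - Real.cos (polygonAngle g)) = d at h4 h5 ⊢
  rw [← h4]
  field_simp
  rw [h3]
  ring

theorem intRoot_add_period [Fact (2 ≤ g)] (j k : ℤ) :
    intRoot g (j + k * (4 * g : ℕ)) = intRoot g j := by
  have h : (((j + k * (4 * g : ℕ) : ℤ) : ℝ) + 1 / 2) * polygonAngle g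
      = (j + 1 / 2) * polygonAngle g + k * (2 * Real.pi) := by
    rw [← mul_polygonAngle (g := g)]
    push_cast
    ring
  simp only [intRoot, unitVec, h, Real.cos_add_int_mul_two_pi, Real.sin_add_int_mul_two_pi]

instance [Fact (2 ≤ g)] : NeZero (4 * g) := ⟨by have : 2 ≤ g := Fact.out; omega⟩

/-- The roots of the right-angled `4g`-gon, indexed modulo `4g`. -/
def root (i : ZMod (4 * g)) : ℝ × ℂ := intRoot g i.val

theorem root_intCast [Fact (2 ≤ g)] (j : ℤ) : root (j : ZMod (4 * g)) = intRoot g j := by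
  have h : ((j : ZMod (4 * g)).val : ℤ) = j + (-(j / (4 * g : ℕ))) * (4 * g : ℕ) := by
    rw [ZMod.val_intCast, Int.emod_def]
    ring
  rw [root, h, intRoot_add_period]

theorem exists_intCast_eq (i : ZMod (4 * g)) : ∃ j : ℤ, (j : ZMod (4 * g)) = i :=
  ZMod.intCast_surjective i

/-- The sides `i` and `j` of the right-angled polygon are adjacent. -/
def Adj (i j : ZMod (4 * g)) : Prop := i = j + 1 ∨ j = i + 1

theorem Adj.symm {i j : ZMod (4 * g)} (h : Adj i j) : Adj j i := Or.symm h

theorem root_self [Fact (2 ≤ g)] (i : ZMod (4 * g)) : lorentz (root i) (root i) = 1 := by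
  obtain ⟨i, rfl⟩ := exists_intCast_eq i
  have h1 : 1 - Real.cos (polygonAngle g) ≠ 0 := by linarith [cos_polygonAngle_lt_one (g := g)]
  rw [root_intCast, lorentz_intRoot_intRoot, sub_self, Int.cast_zero, zero_mul, Real.cos_zero,
    div_self h1]

theorem lorentz_root_of_adj [Fact (2 ≤ g)] {i j : ZMod (4 * g)} (h : Adj i j) :
    lorentz (root i) (root j) = 0 := by
  wlog h' : i = j + 1 generalizing i j
  · rw [lorentz_comm]
    exact this h.symm (h.resolve_left h')
  subst h'
  obtain ⟨j, rfl⟩ := exists_intCast_eq j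
  have h1 : ((j : ZMod (4 * g)) + 1) = ((j + 1 : ℤ) : ZMod (4 * g)) := by push_cast; rfl
  rw [h1, root_intCast, root_intCast, lorentz_intRoot_intRoot]
  simp

/-- An integer multiple of the polygon angle that is not a multiple of `2π` has cosine at most
`cos (m * polygonAngle)` if the multiples below `m` are excluded. -/
theorem cos_int_mul_polygonAngle_le [Fact (2 ≤ g)] {k : ℤ} {m : ℕ}
    (h : ∀ r : ℤ, -m < r → r < m → (k : ZMod (4 * g)) ≠ r) :
    Real.cos (k * polygonAngle g) ≤ Real.cos (m * polygonAngle g) := by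
  set r := k % (4 * g : ℕ) with hr
  have hg : 0 < (4 * g : ℕ) := Nat.pos_of_ne_zero (NeZero.ne _)
  have hr0 : 0 ≤ r := Int.emod_nonneg _ (by exact_mod_cast hg.ne')
  have hr1 : r < (4 * g : ℕ) := Int.emod_lt_of_pos _ (by exact_mod_cast hg)
  have hk : (k : ZMod (4 * g)) = r := by rw [hr, ZMod.intCast_mod]
  have hk' : (k : ZMod (4 * g)) = (r - (4 * g : ℕ) : ℤ) := by
    rw [hk]
    push_cast
    have := ZMod.natCast_self (4 * g)
    push_cast at this
    rw [this, sub_zero]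
  have hkr : k = r + (k / (4 * g : ℕ)) * (4 * g : ℕ) := by
    rw [hr, mul_comm (k / _)]; exact (Int.emod_add_mul_ediv k _).symm
  have hcos : Real.cos (k * polygonAngle g) = Real.cos (r * polygonAngle g) := by
    have : (k : ℝ) * polygonAngle g
        = r * polygonAngle g + (k / (4 * g : ℕ) : ℤ) * (2 * Real.pi) := by
      rw [← mul_polygonAngle (g := g)]
      conv_lhs => rw [hkr]
      push_cast
      ring
    rw [this, Real.cos_add_int_mul_two_pi]
  have h1 : (m : ℤ) ≤ r := by
    by_contra! h'
    exact h r (by omega) h' hk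
  have h2 : r ≤ (4 * g : ℕ) - m := by
    by_contra! h'
    exact h (r - (4 * g : ℕ)) (by omega) (by omega) hk'
  have h3 : (m : ℝ) ≤ r := by exact_mod_cast h1
  have h4 : (r : ℝ) ≤ 4 * g - m := by exact_mod_cast h2
  have hpos := (polygonAngle_pos (g := g)).le
  rw [hcos]
  refine cos_le_cos_of_mem_Icc (by positivity) (by gcongr) ?_
  rw [← mul_polygonAngle (g := g), ← sub_mul]
  gcongr

/-- Nonadjacent sides differ by at least two steps, and two steps give equality. The side between
them is then their common perpendicular, so 1 + 2 cos θ is the hyperbolic cosine of the side length.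
-/
theorem lorentz_root_of_not_adj [Fact (2 ≤ g)] {i j : ZMod (4 * g)} (hij : i ≠ j)
    (h : ¬ Adj i j) :
    lorentz (root i) (root j) ≤ -(1 + 2 * Real.cos (polygonAngle g)) := by
  obtain ⟨i, rfl⟩ := exists_intCast_eq i
  obtain ⟨j, rfl⟩ := exists_intCast_eq j
  have h1 : 0 < 1 - Real.cos (polygonAngle g) := by linarith [cos_polygonAngle_lt_one (g := g)]
  rw [root_intCast, root_intCast, lorentz_intRoot_intRoot, div_le_iff₀ h1]
  have h2 : Real.cos ((i - j : ℤ) * polygonAngle g) ≤ Real.cos ((2 : ℕ) * polygonAngle g) := by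
    refine cos_int_mul_polygonAngle_le fun r hr hr' hk => ?_
    rw [Int.cast_sub, sub_eq_iff_eq_add'] at hk
    obtain rfl | rfl | rfl : r = -1 ∨ r = 0 ∨ r = 1 := by push_cast at hr hr'; omega
    · exact h (Or.inr (by rw [hk]; push_cast; ring))
    · exact hij (by rw [hk]; push_cast; ring)
    · exact h (Or.inl (by rw [hk]; push_cast; ring))
  rw [Nat.cast_ofNat, Real.cos_two_mul] at h2
  linarith

/-! ### The reflection group of the right-angled `4g`-gon -/

open Classical in
/-- The Coxeter matrix of the right-angled `4g`-gon. -/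
def polygonMatrix (g : ℕ) : CoxeterMatrix (ZMod (4 * g)) where
  M := fun i j => if i = j then 1 else if Adj i j then 2 else 0
  isSymm := by
    refine Matrix.IsSymm.ext fun i j => ?_
    simp only [eq_comm (a := j), show Adj j i ↔ Adj i j from ⟨Adj.symm, Adj.symm⟩]
  diagonal := by simp
  off_diagonal := by
    intro i j h
    simp only [h, if_false]
    split_ifs <;> decide

open Classical in
theorem polygonMatrix_apply (i j : ZMod (4 * g)) :
    polygonMatrix g i j = if i = j then 1 else if Adj i j then 2 else 0 := rfl

/-- The abstract reflection group of the right-angled `4g`-gon. -/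
abbrev PolygonGroup (g : ℕ) : Type := (polygonMatrix g).Group

/-- The Coxeter system of the right-angled `4g`-gon. -/
abbrev coxeterSystem (g : ℕ) : CoxeterSystem (polygonMatrix g) (PolygonGroup g) :=
  (polygonMatrix g).toCoxeterSystem

/-- The generators. -/
abbrev gen (i : ZMod (4 * g)) : PolygonGroup g := (coxeterSystem g).simple i

/-- The word length. -/
abbrev len (w : PolygonGroup g) : ℕ := (coxeterSystem g).length w

/-- The entry 0 of the Coxeter matrix imposes no relation, so involutivity and commutation of
neighbours are all that has to be checked. Each homomorphism out of the reflection group below is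
obtained in this way. -/
theorem isLiftable_of_commute {G : Type*} [Monoid G] {f : ZMod (4 * g) → G}
    (h1 : ∀ i, f i * f i = 1) (h2 : ∀ i j, Adj i j → f i * f j = f j * f i) :
    (polygonMatrix g).IsLiftable f := by
  intro i j
  rw [polygonMatrix_apply]
  split_ifs with h h'
  · subst h
    rw [pow_one, h1]
  · rw [pow_two]
    nth_rewrite 1 [h2 i j h']
    rw [mul_assoc, ← mul_assoc (f i), h1, one_mul, h1]
  · rw [pow_zero]

theorem gen_mul_gen_self (i : ZMod (4 * g)) : gen i * gen i = 1 :=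
  (coxeterSystem g).simple_mul_simple_self i

theorem gen_mul_gen_mul (i : ZMod (4 * g)) (w : PolygonGroup g) : gen i * (gen i * w) = w :=
  (coxeterSystem g).simple_mul_simple_cancel_left i

theorem mul_gen_mul_gen (i : ZMod (4 * g)) (w : PolygonGroup g) : w * gen i * gen i = w :=
  (coxeterSystem g).simple_mul_simple_cancel_right i

theorem gen_inv (i : ZMod (4 * g)) : (gen i)⁻¹ = gen i := (coxeterSystem g).inv_simple i

theorem gen_commute {i j : ZMod (4 * g)} (h : Adj i j) : gen i * gen j = gen j * gen i := by
  have h0 : i ≠ j ∨ i = j := ne_or_eq i j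
  rcases h0 with h0 | rfl
  · have h1 := (coxeterSystem g).simple_mul_simple_pow i j
    have h2 : polygonMatrix g i j = 2 := by
      rw [polygonMatrix_apply, if_neg h0, if_pos h]
    rw [h2, pow_two] at h1
    have h3 := eq_inv_of_mul_eq_one_left h1
    rwa [mul_inv_rev, gen_inv, gen_inv] at h3
  · rfl

theorem len_gen_mul (w : PolygonGroup g) (i : ZMod (4 * g)) :
    len (gen i * w) = len w + 1 ∨ len (gen i * w) + 1 = len w :=
  (coxeterSystem g).length_simple_mul w i

theorem len_mul_gen (w : PolygonGroup g) (i : ZMod (4 * g)) :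
    len (w * gen i) = len w + 1 ∨ len (w * gen i) + 1 = len w :=
  (coxeterSystem g).length_mul_simple w i

theorem len_inv (w : PolygonGroup g) : len w⁻¹ = len w := (coxeterSystem g).length_inv w

theorem exists_len_gen_mul_lt {w : PolygonGroup g} (hw : w ≠ 1) : ∃ i, len (gen i * w) < len w :=
  (coxeterSystem g).exists_leftDescent_of_ne_one hw

/-! ### The representation on the Lorentz space and its chambers -/

section rep

variable [Fact (2 ≤ g)]

/-- The action of the reflection group on the Lorentz space. -/
def rep (g : ℕ) [Fact (2 ≤ g)] : PolygonGroup g →* Module.End ℝ (ℝ × ℂ) :=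
  (coxeterSystem g).lift ⟨fun i => lorentzReflection (root i), isLiftable_of_commute
    (fun i => lorentzReflection_mul_self (root_self i))
    (fun _ _ h => lorentzReflection_commute (lorentz_root_of_adj h))⟩

theorem rep_gen (i : ZMod (4 * g)) : rep g (gen i) = lorentzReflection (root i) :=
  (coxeterSystem g).lift_apply_simple _ i

theorem rep_gen_apply (i : ZMod (4 * g)) (x : ℝ × ℂ) :
    rep g (gen i) x = x - (2 * lorentz (root i) x) • root i := by
  rw [rep_gen, lorentzReflection_apply]

theorem rep_mul_apply (v w : PolygonGroup g) (x : ℝ × ℂ) : rep g (v * w) x = rep g v (rep g w x) := by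
  rw [map_mul, Module.End.mul_apply]

theorem rep_one_apply (x : ℝ × ℂ) : rep g 1 x = x := by
  rw [map_one, Module.End.one_apply]

theorem rep_inv_rep (w : PolygonGroup g) (x : ℝ × ℂ) : rep g w⁻¹ (rep g w x) = x := by
  rw [← rep_mul_apply, inv_mul_cancel, rep_one_apply]

theorem lorentz_rep_left (w : PolygonGroup g) (x y : ℝ × ℂ) :
    lorentz (rep g w x) y = lorentz x (rep g w⁻¹ y) := by
  induction w using (coxeterSystem g).simple_induction_left generalizing x y with
  | one => simp
  | mul_simple_left w i ih =>
    rw [rep_mul_apply, rep_gen, lorentz_lorentzReflection, ih, mul_inv_rev, rep_mul_apply, gen_inv,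
      rep_gen]

theorem lorentz_rep_right (w : PolygonGroup g) (x y : ℝ × ℂ) :
    lorentz x (rep g w y) = lorentz (rep g w⁻¹ x) y := by
  rw [lorentz_rep_left, inv_inv]

theorem lorentz_rep_rep (w : PolygonGroup g) (x y : ℝ × ℂ) :
    lorentz (rep g w x) (rep g w y) = lorentz x y := by
  rw [lorentz_rep_left, rep_inv_rep]

theorem lorentz_gen_left (i : ZMod (4 * g)) (x y : ℝ × ℂ) :
    lorentz (rep g (gen i) x) y = lorentz x y - 2 * lorentz x (root i) * lorentz (root i) y := by
  rw [rep_gen_apply, map_sub, map_smul, LinearMap.sub_apply, LinearMap.smul_apply, smul_eq_mul,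
    lorentz_comm (root i) x]

theorem lorentz_gen_left_root_self (i : ZMod (4 * g)) (x : ℝ × ℂ) :
    lorentz (rep g (gen i) x) (root i) = -lorentz x (root i) := by
  rw [lorentz_gen_left, root_self]
  ring

theorem rep_gen_root_self (i : ZMod (4 * g)) : rep g (gen i) (root i) = -root i := by
  rw [rep_gen_apply, root_self]
  module

theorem rep_gen_of_orthogonal {i : ZMod (4 * g)} {x : ℝ × ℂ} (h : lorentz (root i) x = 0) :
    rep g (gen i) x = x := by
  rw [rep_gen_apply, h, mul_zero, zero_smul, sub_zero]

/-- The open fundamental chamber. -/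
def IsInterior (x : ℝ × ℂ) : Prop := ∀ i : ZMod (4 * g), 0 < lorentz x (root i)

theorem one_lt_coshSide : 1 < 1 + 2 * Real.cos (polygonAngle g) := by
  linarith [cos_polygonAngle_pos (g := g)]

/-- A chamber lies on the side of a wall of the fundamental chamber determined by the word length. -/
theorem lorentz_pos_aux {x : ℝ × ℂ} (hx : IsInterior (g := g) x) (w : PolygonGroup g) :
    (∀ i, len w < len (gen i * w) → 0 < lorentz (rep g w x) (root i)) ∧
    (∀ i j, i ≠ j → ¬ Adj i j → len w < len (gen j * w) →
      0 < lorentz (rep g w x) (root i) + lorentz (rep g w x) (root j)) := by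
  -- The second claim strengthens the induction. If w = s_j w' with i and j nonadjacent, then i may
  -- be a descent of w', and only the sum of the products with root i and root j is known to be
  -- positive. This suffices because ⟨root j, root i⟩ < -1.
  obtain ⟨n, hn⟩ : ∃ n, len w = n := ⟨_, rfl⟩
  induction n using Nat.strong_induction_on generalizing w with
  | _ n ih =>
  have first : ∀ i, len w < len (gen i * w) → 0 < lorentz (rep g w x) (root i) := by
    intro i hi
    by_cases hw : w = 1
    · subst hw
      rw [rep_one_apply]
      exact hx i
    obtain ⟨j, hj⟩ := exists_len_gen_mul_lt hw
    have hij : i ≠ j := by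
      rintro rfl
      omega
    set w' := gen j * w with hw'
    have hww' : w = gen j * w' := (gen_mul_gen_mul j w).symm
    have hjw' : len w' < len (gen j * w') := by rwa [← hww']
    have hlen := len_gen_mul w' j
    have ih' := ih (len w') (by omega) w' rfl
    have hj0 := ih'.1 j hjw'
    have hval : lorentz (rep g w x) (root i) = lorentz (rep g w' x) (root i)
        - 2 * lorentz (rep g w' x) (root j) * lorentz (root j) (root i) := by
      rw [hww', rep_mul_apply, lorentz_gen_left]
    by_cases hadj : Adj i j
    · rw [hval, lorentz_root_of_adj hadj.symm, mul_zero, sub_zero]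
      refine ih'.1 i ?_
      -- If i were a descent of w', then s_i w = s_j (s_i w') would be no longer than w'.
      by_contra! h
      have h1 := len_gen_mul w' i
      have h2 : gen i * w = gen j * (gen i * w') := by
        rw [hww', ← mul_assoc, gen_commute hadj, mul_assoc]
      have h3 := len_gen_mul (gen i * w') j
      rw [← h2] at h3
      rw [← hww'] at hlen
      omega
    · have h1 := ih'.2 i j hij hadj hjw'
      have h2 := lorentz_root_of_not_adj hij hadj
      rw [lorentz_comm] at h2
      have h3 := one_lt_coshSide (g := g)
      rw [hval]
      nlinarith
  refine ⟨first, fun i j hij hadj hj => ?_⟩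
  have hj0 := first j hj
  -- If i is not a descent of w, both terms are positive. Otherwise reflect in i: the loss of the
  -- term at i is outweighed by the gain -2⟨root i, root j⟩ > 2 at j.
  rcases len_gen_mul w i with hi | hi
  · have := first i (by omega)
    linarith
  · set w' := gen i * w with hw'
    have hww' : w = gen i * w' := (gen_mul_gen_mul i w).symm
    have hiw' : len w' < len (gen i * w') := by rw [← hww']; omega
    have ih' := ih (len w') (by omega) w' rfl
    have h1 := ih'.1 i hiw'
    have h2 := ih'.2 j i hij.symm (fun h => hadj h.symm) hiw'
    have h3 := lorentz_root_of_not_adj hij hadj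
    have h4 := one_lt_coshSide (g := g)
    rw [hww', rep_mul_apply, lorentz_gen_left, lorentz_gen_left, root_self]
    nlinarith

theorem lorentz_rep_pos {x : ℝ × ℂ} (hx : IsInterior (g := g) x) {w : PolygonGroup g}
    {i : ZMod (4 * g)} (h : len w < len (gen i * w)) : 0 < lorentz (rep g w x) (root i) :=
  (lorentz_pos_aux hx w).1 i h

theorem lorentz_rep_neg {x : ℝ × ℂ} (hx : IsInterior (g := g) x) {w : PolygonGroup g}
    {i : ZMod (4 * g)} (h : len (gen i * w) < len w) : lorentz (rep g w x) (root i) < 0 := by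
  have h1 := lorentz_rep_pos hx (w := gen i * w) (i := i) (by rwa [gen_mul_gen_mul])
  rw [rep_mul_apply, lorentz_gen_left_root_self] at h1
  linarith

/-- The base point of the fundamental chamber. -/
def basePoint : ℝ × ℂ := (1, 0)

theorem isInterior_basePoint : IsInterior (g := g) basePoint := by
  intro i
  have h1 : 0 < 1 - Real.cos (polygonAngle g) := by linarith [cos_polygonAngle_lt_one (g := g)]
  have h2 := cos_polygonAngle_pos (g := g)
  rw [root, lorentz_intRoot]
  simp only [basePoint, Complex.zero_re, Complex.zero_im, zero_mul, add_zero, sub_zero, mul_one]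
  positivity

/-- The closed fundamental chamber. -/
def IsClosedChamber (x : ℝ × ℂ) : Prop := ∀ i : ZMod (4 * g), 0 ≤ lorentz x (root i)

/-- A boundary point is the limit of the interior points x + ε `basePoint`. The statement is needed
at the vertices of the polygon. -/
theorem lorentz_rep_nonneg {x : ℝ × ℂ} (hx : IsClosedChamber (g := g) x) {w : PolygonGroup g}
    {i : ZMod (4 * g)} (h : len w < len (gen i * w)) : 0 ≤ lorentz (rep g w x) (root i) := by
  have h1 : ∀ ε : ℝ, 0 < ε →
      0 < lorentz (rep g w x) (root i) + ε * lorentz (rep g w basePoint) (root i) := by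
    intro ε hε
    have hint : IsInterior (g := g) (x + ε • basePoint) := by
      intro j
      rw [map_add, map_smul, LinearMap.add_apply, LinearMap.smul_apply, smul_eq_mul]
      have := mul_pos hε (isInterior_basePoint (g := g) j)
      linarith [hx j]
    have := lorentz_rep_pos hint h
    rwa [map_add, map_smul, map_add, map_smul, LinearMap.add_apply, LinearMap.smul_apply,
      smul_eq_mul] at this
  have h2 := lorentz_rep_pos isInterior_basePoint h
  by_contra! h3
  have h4 := h1 (-lorentz (rep g w x) (root i) / lorentz (rep g w basePoint) (root i))
    (div_pos (by linarith) h2)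
  rw [div_mul_cancel₀ _ h2.ne'] at h4
  linarith

theorem lorentz_rep_nonpos {x : ℝ × ℂ} (hx : IsClosedChamber (g := g) x) {w : PolygonGroup g}
    {i : ZMod (4 * g)} (h : len (gen i * w) < len w) : lorentz (rep g w x) (root i) ≤ 0 := by
  have h1 := lorentz_rep_nonneg hx (w := gen i * w) (i := i) (by rwa [gen_mul_gen_mul])
  rw [rep_mul_apply, lorentz_gen_left_root_self] at h1
  linarith

/-- A nontrivial element has a left descent and so moves the base point across that wall. -/
theorem rep_injective : Function.Injective (rep g) := by
  refine (injective_iff_map_eq_one _).2 fun w hw => ?_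
  by_contra hne
  obtain ⟨i, hi⟩ := exists_len_gen_mul_lt hne
  have h1 := lorentz_rep_neg isInterior_basePoint hi
  rw [hw, Module.End.one_apply] at h1
  exact lt_asymm h1 (isInterior_basePoint i)

/-- The conjugate of s_j by w is the reflection in the line of w (root j), and a reflection
determines its normal only up to sign. Faithfulness carries the identity back to the group. -/
theorem mul_gen_eq_of_rep_root {w : PolygonGroup g} {i j : ZMod (4 * g)}
    (h : rep g w (root j) = root i ∨ rep g w (root j) = -root i) : gen i * w = w * gen j := by
  apply rep_injective
  refine LinearMap.ext fun x => ?_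
  rw [rep_mul_apply, rep_mul_apply, rep_gen_apply, rep_gen_apply, map_sub, map_smul]
  have h1 : lorentz (root j) x = lorentz (rep g w (root j)) (rep g w x) :=
    (lorentz_rep_rep w _ _).symm
  rcases h with h | h
  · rw [h1, h]
  · rw [h1, h, map_neg, LinearMap.neg_apply]
    module

end rep

/-! ### The action of `SU(1, 1)` on the Lorentz space -/

/-- The action of the matrix `[[a, b], [conj b, conj a]]` on `ℝ × ℂ`: the point
`(1 + |z|², 2 z)` is mapped to a multiple of `(1 + |w|², 2 w)` with
`w = (a z + b) / (conj b z + conj a)`. -/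
def mobius (a b : ℂ) : Module.End ℝ (ℝ × ℂ) where
  toFun x := ((Complex.normSq a + Complex.normSq b) * x.1 + 2 * (a * conj b * x.2).re,
    2 * a * b * x.1 + a ^ 2 * x.2 + b ^ 2 * conj x.2)
  map_add' x y := by
    ext1
    · simp only [Prod.fst_add, Prod.snd_add, mul_add, Complex.add_re]
      ring
    · simp only [Prod.fst_add, Prod.snd_add, Complex.ofReal_add, map_add]
      ring
  map_smul' r x := by
    ext1
    · simp only [Prod.smul_fst, Prod.smul_snd, smul_eq_mul, Complex.real_smul, RingHom.id_apply]
      rw [show a * conj b * (r * x.2) = r * (a * conj b * x.2) by ring, Complex.re_ofReal_mul]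
      ring
    · simp only [Prod.smul_fst, Prod.smul_snd, smul_eq_mul, Complex.real_smul, RingHom.id_apply,
        map_mul, Complex.conj_ofReal, Complex.ofReal_mul]
      ring

theorem mobius_apply (a b : ℂ) (x : ℝ × ℂ) : mobius a b x =
    ((Complex.normSq a + Complex.normSq b) * x.1 + 2 * (a * conj b * x.2).re,
      2 * a * b * x.1 + a ^ 2 * x.2 + b ^ 2 * conj x.2) := rfl

/-- Complex conjugation on `ℝ × ℂ`. -/
def conjMap : Module.End ℝ (ℝ × ℂ) where
  toFun x := (x.1, conj x.2)
  map_add' x y := by simp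
  map_smul' r x := by simp

theorem conjMap_apply (x : ℝ × ℂ) : conjMap x = (x.1, conj x.2) := rfl

theorem conjMap_mul_self : conjMap * conjMap = 1 := by
  refine LinearMap.ext fun x => ?_
  simp [Module.End.mul_apply, conjMap_apply]

theorem mobius_mul (a b a' b' : ℂ) :
    mobius a b * mobius a' b' = mobius (a * a' + b * conj b') (a * b' + b * conj a') := by
  refine LinearMap.ext fun x => ?_
  rw [Module.End.mul_apply, mobius_apply, mobius_apply, mobius_apply]
  ext1
  · simp only [Complex.normSq_apply, Complex.add_re, Complex.add_im, Complex.mul_re, Complex.mul_im,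
      Complex.conj_re, Complex.conj_im, map_add, map_mul, pow_two, Complex.ofReal_re,
      Complex.ofReal_im, Complex.re_ofNat, Complex.im_ofNat]
    ring
  · apply Complex.ext <;>
    · simp only [Complex.normSq_apply, Complex.add_re, Complex.add_im, Complex.mul_re,
        Complex.mul_im, Complex.conj_re, Complex.conj_im, pow_two,
        Complex.ofReal_re, Complex.ofReal_im, Complex.re_ofNat, Complex.im_ofNat]
      ring

theorem conjMap_mul_mobius (a b : ℂ) :
    conjMap * mobius a b = mobius (conj a) (conj b) * conjMap := by
  refine LinearMap.ext fun x => ?_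
  simp only [Module.End.mul_apply, conjMap_apply, mobius_apply, Complex.normSq_conj]
  ext1
  · simp only [Complex.mul_re, Complex.mul_im, Complex.conj_re, Complex.conj_im]
    ring
  · simp only [map_add, map_mul, map_pow, Complex.conj_ofReal, map_ofNat]

theorem normSq_sub_normSq_mul (a b a' b' : ℂ) :
    Complex.normSq (a * a' + b * conj b') - Complex.normSq (a * b' + b * conj a')
      = (Complex.normSq a - Complex.normSq b) * (Complex.normSq a' - Complex.normSq b') := by
  simp only [Complex.normSq_apply, Complex.add_re, Complex.add_im, Complex.mul_re, Complex.mul_im,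
      Complex.conj_re, Complex.conj_im]
  ring

theorem lorentzReflection_eq_mobius_mul_conjMap {a : ℝ × ℂ} (ha : lorentz a a = 1) :
    lorentzReflection a = mobius (Complex.I * a.2) (-Complex.I * a.1) * conjMap := by
  obtain ⟨p, u⟩ := a
  rw [lorentz_apply] at ha
  simp only at ha
  refine LinearMap.ext fun x => ?_
  rw [Module.End.mul_apply, conjMap_apply, mobius_apply, lorentzReflection_apply, lorentz_apply]
  ext1
  · simp [Complex.normSq_apply]
    linear_combination -x.1 * ha
  · apply Complex.ext
    · simp [pow_two]
      linear_combination -x.2.re * ha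
    · simp [pow_two]
      linear_combination -x.2.im * ha

/-- The rotation by `π` about the origin. -/
def halfTurn : Module.End ℝ (ℝ × ℂ) := mobius Complex.I 0

theorem halfTurn_apply (x : ℝ × ℂ) : halfTurn x = (x.1, -x.2) := by
  rw [halfTurn, mobius_apply]
  simp

theorem halfTurn_mul_self : halfTurn * halfTurn = 1 := by
  refine LinearMap.ext fun x => ?_
  rw [Module.End.mul_apply, halfTurn_apply, halfTurn_apply, neg_neg, Module.End.one_apply]

theorem lorentz_halfTurn_halfTurn (x y : ℝ × ℂ) :
    lorentz (halfTurn x) (halfTurn y) = lorentz x y := by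
  simp [halfTurn_apply, lorentz_apply]

/-- A vector fixed by `mobius a b`: its axis or its fixed point. -/
def mobiusAxis (a b : ℂ) : ℝ × ℂ := (a.im, Complex.I * b)

/-- This converts the displacement of a line into a trace bound: a line x with ⟨x, f x⟩ ≥ 2K² - 1
forces |Re a| ≥ K. The correction term vanishes exactly when x is orthogonal to the fixed vector. -/
theorem lorentz_mobius_self {a b : ℂ} (hab : Complex.normSq a - Complex.normSq b = 1) {x : ℝ × ℂ}
    (hx : lorentz x x = 1) :
    lorentz x (mobius a b x) = 2 * a.re ^ 2 - 1 - 2 * lorentz x (mobiusAxis a b) ^ 2 := by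
  obtain ⟨p, u⟩ := x
  simp only [lorentz_apply, mobius_apply, mobiusAxis, Complex.normSq_apply, Complex.add_re,
    Complex.add_im, Complex.mul_re, Complex.mul_im, Complex.conj_re, Complex.conj_im, pow_two,
    Complex.ofReal_re, Complex.ofReal_im, Complex.re_ofNat, Complex.im_ofNat, Complex.I_re,
    Complex.I_im] at *
  linear_combination (a.re * a.re - a.im * a.im + b.re * b.re + b.im * b.im) * hx
    - hab

theorem mobius_mobiusAxis {a b : ℂ} (hab : Complex.normSq a - Complex.normSq b = 1) :
    mobius a b (mobiusAxis a b) = mobiusAxis a b := by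
  simp only [mobius_apply, mobiusAxis, Complex.normSq_apply] at *
  ext1
  · simp [Complex.mul_re]
    linear_combination a.im * hab
  · apply Complex.ext
    · simp [pow_two]
      linear_combination -b.im * hab
    · simp [pow_two]
      linear_combination b.re * hab

theorem lorentz_mobiusAxis {a b : ℂ} (hab : Complex.normSq a - Complex.normSq b = 1) :
    lorentz (mobiusAxis a b) (mobiusAxis a b) = a.re ^ 2 - 1 := by
  simp [lorentz_apply, mobiusAxis, Complex.normSq_apply] at *
  linear_combination -hab

theorem trace_eq_of_basis (f : Module.End ℝ (ℝ × ℂ)) :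
    LinearMap.trace ℝ (ℝ × ℂ) f = (f (1, 0)).1 + (f (0, 1)).2.re + (f (0, Complex.I)).2.im := by
  rw [LinearMap.trace_eq_matrix_trace ℝ
    ((Module.Basis.singleton Unit ℝ).prod Complex.basisOneI), Matrix.trace]
  simp [LinearMap.toMatrix_apply, Fin.sum_univ_two, Module.Basis.prod_repr_inl,
    Module.Basis.prod_repr_inr, add_assoc]

/-- Conjugation changes the coefficients, but this invariant recovers (Re a)². -/
theorem trace_mobius {a b : ℂ} (hab : Complex.normSq a - Complex.normSq b = 1) :
    LinearMap.trace ℝ (ℝ × ℂ) (mobius a b) = 4 * a.re ^ 2 - 1 := by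
  rw [trace_eq_of_basis]
  simp [mobius_apply, pow_two, Complex.normSq_apply] at *
  linear_combination -hab

theorem trace_conj_eq {f h h' : Module.End ℝ (ℝ × ℂ)} (hh : h' * h = 1) :
    LinearMap.trace ℝ (ℝ × ℂ) (h * f * h') = LinearMap.trace ℝ (ℝ × ℂ) f := by
  rw [LinearMap.trace_mul_comm, ← mul_assoc, hh, one_mul]

/-! ### Orientation and time direction in the reflection group -/

section rep

variable [Fact (2 ≤ g)]

/-- Each reflection is a Möbius map after one complex conjugation. The conjugations can be collected
on the right, where they cancel in pairs, so that only the parity of the length matters. -/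
theorem exists_rep_eq_mobius (w : PolygonGroup g) :
    ∃ a b : ℂ, Complex.normSq a - Complex.normSq b = 1 ∧
      rep g w = mobius a b * conjMap ^ len w := by
  induction w using (coxeterSystem g).simple_induction_left with
  | one =>
    refine ⟨1, 0, by simp, ?_⟩
    refine LinearMap.ext fun x => ?_
    simp [mobius_apply, CoxeterSystem.length_one]
  | mul_simple_left w i ih =>
    obtain ⟨a, b, hab, hw⟩ := ih
    have hr := lorentzReflection_eq_mobius_mul_conjMap (root_self i)
    have hdet : Complex.normSq (Complex.I * (root i).2) - Complex.normSq (-Complex.I * (root i).1)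
        = 1 := by
      have := root_self i
      rw [lorentz_apply] at this
      simp [Complex.normSq_apply]
      linarith
    generalize Complex.I * (root i).2 = c at hr hdet
    generalize -Complex.I * ((root i).1 : ℂ) = d at hr hdet
    refine ⟨c * conj a + d * conj (conj b), c * conj b + d * conj (conj a), ?_, ?_⟩
    · rw [normSq_sub_normSq_mul, hdet, Complex.normSq_conj, Complex.normSq_conj, hab, one_mul]
    · rw [map_mul, rep_gen, hr, hw, mul_assoc, ← mul_assoc conjMap, conjMap_mul_mobius, mul_assoc,
        ← pow_succ', ← mul_assoc, mobius_mul]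
      congr 1
      rcases len_gen_mul w i with h | h
      · exact congrArg _ h.symm
      · rw [← h, pow_succ, pow_succ, mul_assoc, conjMap_mul_self, mul_one]

theorem isFuture_rep_basePoint (w : PolygonGroup g) : IsFuture (rep g w basePoint) := by
  refine ⟨?_, ?_⟩
  · obtain ⟨a, b, hab, hw⟩ := exists_rep_eq_mobius w
    have h : ∀ k : ℕ, (conjMap ^ k) basePoint = basePoint := by
      intro k
      induction k with
      | zero => simp
      | succ k ih => rw [pow_succ, Module.End.mul_apply]; simpa [conjMap_apply, basePoint] using ih
    rw [hw, Module.End.mul_apply, h]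
    simp only [mobius_apply, basePoint, mul_one, mul_zero, Complex.zero_re, add_zero]
    have := Complex.normSq_nonneg b
    linarith
  · rw [lorentz_rep_rep]
    simp [lorentz_apply, basePoint]

theorem isFuture_basePoint : IsFuture basePoint := by
  simp [IsFuture, lorentz_apply, basePoint]

end rep

/-! ### Relative position of two walls -/

/-- Two normal vectors of the same line. -/
def SameLine (x y : ℝ × ℂ) : Prop := x = y ∨ x = -y

theorem SameLine.refl (x : ℝ × ℂ) : SameLine x x := Or.inl rfl

theorem SameLine.trans {x y z : ℝ × ℂ} (h : SameLine x y) (h' : SameLine y z) : SameLine x z := by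
  rcases h with rfl | rfl <;> rcases h' with rfl | rfl <;> simp [SameLine]

theorem SameLine.map {x y : ℝ × ℂ} (h : SameLine x y) (f : Module.End ℝ (ℝ × ℂ)) :
    SameLine (f x) (f y) := by
  rcases h with rfl | rfl <;> simp [SameLine]

theorem SameLine.abs_lorentz_eq {x y x' y' : ℝ × ℂ} (h : SameLine x x') (h' : SameLine y y') :
    |lorentz x y| = |lorentz x' y'| := by
  rcases h with rfl | rfl <;> rcases h' with rfl | rfl <;> simp

section rep

variable [Fact (2 ≤ g)]

theorem sameLine_rep_gen_root_self (i : ZMod (4 * g)) :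
    SameLine (rep g (gen i) (root i)) (root i) := Or.inr (rep_gen_root_self i)

theorem lorentz_rep_mul_gen_basePoint (w : PolygonGroup g) (t : ZMod (4 * g)) :
    lorentz (rep g (w * gen t) basePoint) (rep g w (root t)) < 0 := by
  rw [rep_mul_apply, lorentz_rep_rep, lorentz_gen_left_root_self]
  exact neg_neg_of_pos (isInterior_basePoint t)

theorem lorentz_basePoint_rep_root_pos {w : PolygonGroup g} {t : ZMod (4 * g)}
    (h : len w < len (w * gen t)) : 0 < lorentz basePoint (rep g w (root t)) := by
  rw [lorentz_rep_right]
  refine lorentz_rep_pos isInterior_basePoint ?_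
  rwa [← len_inv w, ← len_inv (w * gen t), mul_inv_rev, gen_inv] at h

/-- Two walls are either both walls of a common chamber or their distance is at least twice the side
length of the polygon. -/
theorem exists_common_chamber_or_le_abs_lorentz (w : PolygonGroup g) (s t : ZMod (4 * g)) :
    (∃ v, SameLine (rep g v (root s)) (root s) ∧ SameLine (rep g w (root t)) (rep g v (root t))) ∨
      2 * (1 + 2 * Real.cos (polygonAngle g)) ^ 2 - 1 ≤ |lorentz (root s) (rep g w (root t))| := by
  set K := 1 + 2 * Real.cos (polygonAngle g) with hK
  have hK1 : 1 < K := one_lt_coshSide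
  obtain ⟨n, hn⟩ : ∃ n, len w = n := ⟨_, rfl⟩
  induction n using Nat.strong_induction_on generalizing w s t with
  | _ n ih =>
  by_cases hw : w = 1
  · subst hw
    exact Or.inl ⟨1, by simp [SameLine], by simp [SameLine]⟩
  rcases len_mul_gen w t with ht | ht
  swap
  · -- `t` is a right descent
    have hwt : SameLine (rep g w (root t)) (rep g (w * gen t) (root t)) := by
      rw [rep_mul_apply, rep_gen_root_self, map_neg]
      exact Or.inr (neg_neg _).symm
    rcases ih (len (w * gen t)) (by omega) (w * gen t) s t rfl with ⟨v, hv, hv'⟩ | h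
    · exact Or.inl ⟨v, hv, hwt.trans hv'⟩
    · exact Or.inr (h.trans_eq ((SameLine.refl _).abs_lorentz_eq hwt).symm)
  obtain ⟨u, hu⟩ := exists_len_gen_mul_lt hw
  -- A reflection in s itself or in a neighbour of s preserves the line of s. Applying it to both
  -- walls shortens w.
  by_cases hus : u = s ∨ Adj u s
  · have hs : SameLine (rep g (gen u) (root s)) (root s) := by
      rcases hus with rfl | h
      · exact sameLine_rep_gen_root_self u
      · exact Or.inl (rep_gen_of_orthogonal (lorentz_root_of_adj h))
    rcases ih (len (gen u * w)) (by omega) (gen u * w) s t rfl with ⟨v, hv, hv'⟩ | h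
    · refine Or.inl ⟨gen u * v, ?_, ?_⟩
      · rw [rep_mul_apply]
        exact (hv.map _).trans hs
      · have := hv'.map (rep g (gen u))
        rwa [← rep_mul_apply, gen_mul_gen_mul, ← rep_mul_apply] at this
    · refine Or.inr (h.trans_eq ?_)
      rw [rep_mul_apply, lorentz_rep_right, gen_inv]
      exact hs.abs_lorentz_eq (SameLine.refl _)
  · push Not at hus
    have hsu := lorentz_root_of_not_adj (Ne.symm hus.1) (fun h => hus.2 h.symm)
    -- The line u separates the line s from the wall w (root t): the chambers w and w t lie beyond
    -- u, on the two sides of that wall. Since s and u are nonadjacent, a distance of one side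
    -- length between u and the wall adds up to two.
    have chain : K ≤ |lorentz (root u) (rep g w (root t))| →
        2 * K ^ 2 - 1 ≤ |lorentz (root s) (rep g w (root t))| := by
      intro h
      have hu' : len (gen u * (w * gen t)) < len (w * gen t) := by
        rw [← mul_assoc]
        rcases len_mul_gen (gen u * w) t with h | h <;> omega
      refine le_abs_lorentz_of_separated hK1.le (root_self s) (root_self u)
        (by rw [lorentz_rep_rep, root_self]) hsu h isFuture_basePoint
        (isFuture_rep_basePoint w) (isFuture_rep_basePoint (w * gen t))
        (isInterior_basePoint s) (isInterior_basePoint u)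
        (lorentz_rep_neg isInterior_basePoint hu) ?_
        (lorentz_rep_neg isInterior_basePoint hu') (lorentz_rep_mul_gen_basePoint w t)
      rw [lorentz_rep_rep]
      exact isInterior_basePoint t
    have huw : |lorentz (root u) (rep g w (root t))|
        = |lorentz (root u) (rep g (gen u * w) (root t))| := by
      rw [rep_mul_apply, lorentz_rep_right (gen u), gen_inv, rep_gen_root_self]
      simp
    -- The reflection in u preserves the line u, so the pair (u, u w) measures u against the
    -- original wall with a shorter word. If both bound a common chamber, they are positioned like
    -- the sides u and t of the polygon.
    rcases ih (len (gen u * w)) (by omega) (gen u * w) u t rfl with ⟨v, hv, hv'⟩ | h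
    · have hval : |lorentz (root u) (rep g w (root t))| = |lorentz (root u) (root t)| := by
        rw [huw, ← lorentz_rep_rep v (root u) (root t)]
        exact SameLine.abs_lorentz_eq (hv.imp Eq.symm fun h => by rw [h, neg_neg]) hv'
      -- If u = t, the wall is the line u itself, which together with s bounds the fundamental
      -- chamber.
      by_cases hut : u = t
      · subst hut
        refine Or.inl ⟨1, by simp [SameLine], ?_⟩
        have := (hv'.trans hv).map (rep g (gen u))
        rw [← rep_mul_apply, gen_mul_gen_mul] at this
        simpa using this.trans (sameLine_rep_gen_root_self u)
      · by_cases hadj : Adj u t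
        · rw [lorentz_root_of_adj hadj, abs_zero, abs_eq_zero] at hval
          -- A wall perpendicular to u is preserved by the reflection in u, so w may be replaced by
          -- the shorter u w.
          have hfix : rep g (gen u * w) (root t) = rep g w (root t) := by
            rw [rep_mul_apply, rep_gen_of_orthogonal hval]
          rw [← hfix]
          exact ih (len (gen u * w)) (by omega) (gen u * w) s t rfl
        · refine Or.inr (chain ?_)
          rw [hval]
          exact le_abs.2 (Or.inr (by linarith [lorentz_root_of_not_adj hut hadj]))
    · refine Or.inr (chain ?_)
      rw [huw]
      nlinarith

/-! ### Edges of the polygon and the exchange property -/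

theorem cos_add_half_mul_polygonAngle_le (k : ℤ) :
    Real.cos ((k + 1 / 2) * polygonAngle g) ≤ Real.cos (polygonAngle g / 2) := by
  set r := k % (4 * g : ℕ) with hr
  have hg : 0 < (4 * g : ℕ) := Nat.pos_of_ne_zero (NeZero.ne _)
  have hr0 : 0 ≤ r := Int.emod_nonneg _ (by exact_mod_cast hg.ne')
  have hr1 : r < (4 * g : ℕ) := Int.emod_lt_of_pos _ (by exact_mod_cast hg)
  have hkr : k = r + (k / (4 * g : ℕ)) * (4 * g : ℕ) := by
    rw [hr, mul_comm (k / _)]; exact (Int.emod_add_mul_ediv k _).symm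
  have h1 : ((k : ℝ) + 1 / 2) * polygonAngle g
      = (r + 1 / 2) * polygonAngle g + (k / (4 * g : ℕ) : ℤ) * (2 * Real.pi) := by
    rw [← mul_polygonAngle (g := g)]
    conv_lhs => rw [hkr]
    push_cast
    ring
  have hpos := polygonAngle_pos (g := g)
  have h2 : (0 : ℝ) ≤ r := by exact_mod_cast hr0
  have h3 : (r : ℝ) + 1 ≤ 4 * g := by exact_mod_cast hr1
  rw [h1, Real.cos_add_int_mul_two_pi]
  refine cos_le_cos_of_mem_Icc (by positivity) (by nlinarith) ?_
  rw [← mul_polygonAngle (g := g)]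
  nlinarith

theorem cos_half_polygonAngle_pos : 0 < Real.cos (polygonAngle g / 2) :=
  Real.cos_pos_of_mem_Ioo ⟨by linarith [polygonAngle_pos (g := g), Real.pi_pos],
    by linarith [polygonAngle_le (g := g), Real.pi_pos]⟩

theorem sin_half_polygonAngle_pos : 0 < Real.sin (polygonAngle g / 2) :=
  Real.sin_pos_of_pos_of_lt_pi (by linarith [polygonAngle_pos (g := g)])
    (by linarith [polygonAngle_le (g := g), Real.pi_pos])

/-- The vertex of the right-angled polygon in direction `j * polygonAngle g`. -/
def intVertex (g : ℕ) (j : ℤ) : ℝ × ℂ :=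
  (1, (√(Real.cos (polygonAngle g)) / Real.cos (polygonAngle g / 2) : ℝ)
    * unitVec (j * polygonAngle g))

theorem lorentz_intVertex_intRoot (j i : ℤ) :
    lorentz (intVertex g j) (intRoot g i) = (√(1 - Real.cos (polygonAngle g)))⁻¹
      * √(Real.cos (polygonAngle g)) / Real.cos (polygonAngle g / 2)
      * (Real.cos (polygonAngle g / 2) - Real.cos (((i - j : ℤ) + 1 / 2) * polygonAngle g)) := by
  have h2 : ((i - j : ℤ) + 1 / 2) * polygonAngle g
      = (i + 1 / 2) * polygonAngle g - j * polygonAngle g := by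
    push_cast
    ring
  have h3 := (cos_half_polygonAngle_pos (g := g)).ne'
  rw [h2, Real.cos_sub, lorentz_intRoot]
  simp only [intVertex, unitVec, Complex.re_ofReal_mul, Complex.im_ofReal_mul]
  field_simp

theorem lorentz_intVertex_root_nonneg (j : ℤ) : IsClosedChamber (g := g) (intVertex g j) := by
  intro i
  rw [root, lorentz_intVertex_intRoot]
  refine mul_nonneg (div_nonneg (by positivity) cos_half_polygonAngle_pos.le)
    (sub_nonneg.2 (cos_add_half_mul_polygonAngle_le _))

theorem lorentz_intVertex_intRoot_self (j : ℤ) : lorentz (intVertex g j) (intRoot g j) = 0 := by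
  rw [lorentz_intVertex_intRoot, sub_self, Int.cast_zero, zero_add,
    show (1 / 2 : ℝ) * polygonAngle g = polygonAngle g / 2 by ring, sub_self, mul_zero]

theorem lorentz_intVertex_add_one_intRoot (j : ℤ) :
    lorentz (intVertex g (j + 1)) (intRoot g j) = 0 := by
  rw [lorentz_intVertex_intRoot, ← Real.cos_neg (polygonAngle g / 2)]
  rw [show ((j - (j + 1) : ℤ) + 1 / 2 : ℝ) * polygonAngle g = -(polygonAngle g / 2) by
    push_cast; ring, sub_self, mul_zero]

/-- The line through two consecutive vertices. -/
theorem sameLine_intRoot {β : ℝ × ℂ} {j : ℤ} (hβ : lorentz β β = 1)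
    (h0 : lorentz (intVertex g j) β = 0) (h1 : lorentz (intVertex g (j + 1)) β = 0) :
    SameLine β (intRoot g j) := by
  have hc := cos_polygonAngle_pos (g := g)
  have hc1 := cos_polygonAngle_lt_one (g := g)
  have hch := cos_half_polygonAngle_pos (g := g)
  have hsh := sin_half_polygonAngle_pos (g := g)
  set φ := ((j : ℝ) + 1 / 2) * polygonAngle g with hφ
  have e0 : (j : ℝ) * polygonAngle g = φ - polygonAngle g / 2 := by rw [hφ]; ring
  have e1 : ((j + 1 : ℤ) : ℝ) * polygonAngle g = φ + polygonAngle g / 2 := by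
    rw [hφ]; push_cast; ring
  simp only [lorentz_apply, intVertex, unitVec, Complex.re_ofReal_mul, Complex.im_ofReal_mul, e0,
    e1, Real.cos_sub, Real.sin_sub, Real.cos_add, Real.sin_add, one_mul] at h0 h1
  set κ := √(Real.cos (polygonAngle g)) / Real.cos (polygonAngle g / 2) with hκ
  have hκ0 : 0 < κ := div_pos (Real.sqrt_pos.2 hc) hch
  -- The difference of the two vertex equations kills the component of β across the direction φ of
  -- the side; their sum relates the component along φ to the time coordinate.
  have hY : -β.2.re * Real.sin φ + β.2.im * Real.cos φ = 0 := by
    have : κ * Real.sin (polygonAngle g / 2)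
        * (-β.2.re * Real.sin φ + β.2.im * Real.cos φ) = 0 := by
      linear_combination (h1 - h0) / 2
    exact (mul_eq_zero.1 this).resolve_left (by positivity)
  set X := β.2.re * Real.cos φ + β.2.im * Real.sin φ with hX
  have hb : β.1 = √(Real.cos (polygonAngle g)) * X := by
    have : κ * Real.cos (polygonAngle g / 2) = √(Real.cos (polygonAngle g)) := by
      rw [hκ, div_mul_cancel₀ _ hch.ne']
    rw [← this, hX]
    linear_combination -(h0 + h1) / 2
  have hre : β.2.re = X * Real.cos φ := by
    rw [hX]
    linear_combination -β.2.re * Real.sin_sq_add_cos_sq φ - Real.sin φ * hY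
  have him : β.2.im = X * Real.sin φ := by
    rw [hX]
    linear_combination -β.2.im * Real.sin_sq_add_cos_sq φ + Real.cos φ * hY
  have hs := Real.sq_sqrt hc.le
  have hd := Real.sq_sqrt (sub_nonneg.2 hc1.le)
  have hd0 : √(1 - Real.cos (polygonAngle g)) ≠ 0 := (Real.sqrt_pos.2 (by linarith)).ne'
  have hX2 : (X * √(1 - Real.cos (polygonAngle g))) ^ 2 = 1 := by
    rw [lorentz_apply, hre, him, hb] at hβ
    rw [mul_pow, hd]
    linear_combination hβ - X ^ 2 * Real.sin_sq_add_cos_sq φ + X ^ 2 * hs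
  have hval : ∀ ε : ℝ, X = ε * (√(1 - Real.cos (polygonAngle g)))⁻¹ →
      β = ε • -intRoot g j := by
    intro ε hε
    ext1
    · simp only [intRoot, Prod.smul_mk, neg_smul, neg_neg, smul_eq_mul]
      rw [hb, hε]
      ring
    · apply Complex.ext
      · simp only [intRoot, Prod.smul_mk, neg_smul, neg_neg, Complex.real_smul,
          Complex.re_ofReal_mul, unitVec]
        rw [hre, hε]
        ring
      · simp only [intRoot, Prod.smul_mk, neg_smul, neg_neg, Complex.real_smul,
          Complex.im_ofReal_mul, unitVec]
        rw [him, hε]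
        ring
  rcases sq_eq_one_iff.1 hX2 with h | h
  · right
    simpa using hval 1 (by rw [one_mul, eq_inv_of_mul_eq_one_left h])
  · left
    simpa using hval (-1) (by field_simp; linarith)

/-- The exchange property: if `t` is a right descent of `w` but not of `s * w` then
`s * w = w * t`. -/
theorem gen_mul_eq_mul_gen {w : PolygonGroup g} {s t : ZMod (4 * g)}
    (ht : len (w * gen t) < len w) (hst : len (gen s * w) < len (gen s * w * gen t)) :
    gen s * w = w * gen t := by
  apply mul_gen_eq_of_rep_root
  -- Points of the closed edge s lie on the nonpositive side of the line w (root t), because t is a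
  -- right descent of w. They also lie on the nonnegative side, because t is not a right descent of
  -- s w and s fixes them. Hence that line contains both ends of the edge.
  have key : ∀ x, IsClosedChamber (g := g) x → lorentz x (root s) = 0 →
      lorentz x (rep g w (root t)) = 0 := by
    intro x hx hxs
    refine le_antisymm ?_ ?_
    · rw [lorentz_rep_right]
      refine lorentz_rep_nonpos hx ?_
      rwa [← len_inv w, ← len_inv (w * gen t), mul_inv_rev, gen_inv] at ht
    · have h1 : lorentz x (rep g w (root t)) = lorentz x (rep g (gen s * w) (root t)) := by
        rw [rep_mul_apply, lorentz_rep_right (gen s), gen_inv,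
          rep_gen_of_orthogonal (by rwa [lorentz_comm])]
      rw [h1, lorentz_rep_right]
      refine lorentz_rep_nonneg hx ?_
      rwa [← len_inv (gen s * w), ← len_inv (gen s * w * gen t), mul_inv_rev _ (gen t),
        gen_inv] at hst
  obtain ⟨s, rfl⟩ := exists_intCast_eq s
  rw [root_intCast] at key ⊢
  exact sameLine_intRoot (by rw [lorentz_rep_rep, root_self])
    (key _ (lorentz_intVertex_root_nonneg s) (lorentz_intVertex_intRoot_self s))
    (key _ (lorentz_intVertex_root_nonneg (s + 1)) (lorentz_intVertex_add_one_intRoot s))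

end rep

/-! ### Parities and the rotation of the polygon by `π` -/

/-- The parity of the index of a side. -/
def parity : ZMod (4 * g) →+* ZMod 2 :=
  ZMod.castHom (Dvd.intro (2 * g) (by ring)) (ZMod 2)

/-- The parities of the numbers of reflections in even sides and in odd sides. -/
def typeParity : PolygonGroup g →* Multiplicative (ZMod 2 × ZMod 2) :=
  (coxeterSystem g).lift ⟨fun i => Multiplicative.ofAdd (1 + parity i, parity i),
    isLiftable_of_commute (fun i => by
      rw [← ofAdd_add, Prod.mk_add_mk, CharTwo.add_self_eq_zero, CharTwo.add_self_eq_zero]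
      rfl) (fun _ _ _ => mul_comm _ _)⟩

theorem typeParity_gen (i : ZMod (4 * g)) :
    typeParity (gen i) = Multiplicative.ofAdd (1 + parity i, parity i) :=
  (coxeterSystem g).lift_apply_simple _ i

open Classical in
/-- The parity of the number of reflections in the side `s`. -/
def sideParity (s : ZMod (4 * g)) : PolygonGroup g →* Multiplicative (ZMod 2) :=
  (coxeterSystem g).lift ⟨fun i => Multiplicative.ofAdd (if i = s then 1 else 0),
    isLiftable_of_commute (fun i => by rw [← ofAdd_add, CharTwo.add_self_eq_zero]; rfl)
      (fun _ _ _ => mul_comm _ _)⟩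

open Classical in
theorem sideParity_gen (s i : ZMod (4 * g)) :
    sideParity s (gen i) = Multiplicative.ofAdd (if i = s then 1 else 0) :=
  (coxeterSystem g).lift_apply_simple _ i

theorem toAdd_typeParity_add (w : PolygonGroup g) :
    (typeParity w).toAdd.1 + (typeParity w).toAdd.2 = (len w : ZMod 2) := by
  induction w using (coxeterSystem g).simple_induction_left with
  | one => simp
  | mul_simple_left w i ih =>
    have h1 : (len (gen i * w) : ZMod 2) = len w + 1 := by
      rcases len_gen_mul w i with h | h
      · rw [h]; push_cast; rfl
      · rw [← h]; push_cast; rw [add_assoc, CharTwo.add_self_eq_zero, add_zero]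
    rw [h1, map_mul, typeParity_gen, ← ih, toAdd_mul, toAdd_ofAdd, Prod.fst_add, Prod.snd_add]
    linear_combination CharTwo.add_self_eq_zero (parity i)

theorem even_len_of_typeParity {w : PolygonGroup g} {n : ZMod 2}
    (h : typeParity w = Multiplicative.ofAdd (n, n)) : Even (len w) := by
  have h1 := toAdd_typeParity_add w
  rw [h, toAdd_ofAdd, CharTwo.add_self_eq_zero] at h1
  exact (ZMod.natCast_eq_zero_iff_even).1 h1.symm

theorem parity_eq_of_adj {i j : ZMod (4 * g)} (h : Adj i j) : parity i = parity j + 1 := by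
  rcases h with rfl | rfl
  · rw [map_add, map_one]
  · rw [map_add, map_one, add_assoc, CharTwo.add_self_eq_zero, add_zero]

/-- The opposite side. -/
def opp (i : ZMod (4 * g)) : ZMod (4 * g) := i + (2 * g : ℕ)

theorem opp_add_one (i : ZMod (4 * g)) : opp (i + 1) = opp i + 1 := add_right_comm _ _ _

theorem parity_opp (i : ZMod (4 * g)) : parity (opp i) = parity i := by
  rw [opp, map_add, map_natCast, Nat.cast_mul, show ((2 : ℕ) : ZMod 2) = 0 from rfl, zero_mul,
    add_zero]

theorem Adj.opp {i j : ZMod (4 * g)} (h : Adj i j) : Adj (opp i) (opp j) :=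
  h.imp (fun h => by rw [h, opp_add_one]) (fun h => by rw [h, opp_add_one])

/-- The automorphism of the reflection group induced by the rotation of the polygon by `π`. -/
def oppHom (g : ℕ) : PolygonGroup g →* PolygonGroup g :=
  (coxeterSystem g).lift ⟨fun i => gen (opp i), isLiftable_of_commute
    (fun _ => gen_mul_gen_self _) (fun _ _ h => gen_commute h.opp)⟩

theorem oppHom_gen (i : ZMod (4 * g)) : oppHom g (gen i) = gen (opp i) :=
  (coxeterSystem g).lift_apply_simple _ i

theorem typeParity_oppHom (w : PolygonGroup g) : typeParity (oppHom g w) = typeParity w := by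
  have : typeParity.comp (oppHom g) = typeParity := by
    refine (coxeterSystem g).ext_simple fun i => ?_
    change typeParity (oppHom g (gen i)) = typeParity (gen i)
    rw [oppHom_gen, typeParity_gen, typeParity_gen, parity_opp]
  exact DFunLike.congr_fun this w

section rep

variable [Fact (2 ≤ g)]

theorem halfTurn_root (i : ZMod (4 * g)) : halfTurn (root i) = root (opp i) := by
  obtain ⟨i, rfl⟩ := exists_intCast_eq i
  have h1 : opp (i : ZMod (4 * g)) = ((i + 2 * g : ℤ) : ZMod (4 * g)) := by
    rw [opp]; push_cast; rfl
  have h2 : ((i + 2 * g : ℤ) + 1 / 2 : ℝ) * polygonAngle g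
      = (i + 1 / 2) * polygonAngle g + Real.pi := by
    have := mul_polygonAngle (g := g)
    push_cast
    linarith
  rw [h1, root_intCast, root_intCast, halfTurn_apply, intRoot, intRoot]
  ext1
  · simp
  · simp only [unitVec, h2, Real.cos_add_pi, Real.sin_add_pi, Prod.smul_mk]
    rw [← smul_neg]
    rfl

theorem opp_ne (i : ZMod (4 * g)) : opp i ≠ i := by
  intro h
  have hg : 2 ≤ g := Fact.out
  rw [opp, add_eq_left, ZMod.natCast_eq_zero_iff] at h
  have := Nat.le_of_dvd (by omega) h
  omega

omit [Fact (2 ≤ g)] in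
theorem not_adj_opp (i : ZMod (4 * g)) : ¬ Adj i (opp i) := by
  intro h
  have h1 := parity_eq_of_adj h
  rw [parity_opp] at h1
  exact one_ne_zero (add_eq_left.1 h1.symm)

/-- The half turn normalizes the reflection group and acts on it by `oppHom`. This is why conjugacy
classes in the coset of the half turn become twisted ones. -/
theorem halfTurn_mul_rep (w : PolygonGroup g) :
    halfTurn * rep g w = rep g (oppHom g w) * halfTurn := by
  induction w using (coxeterSystem g).simple_induction_left with
  | one => simp
  | mul_simple_left w i ih =>
    have h1 : halfTurn * rep g (gen i) = rep g (gen (opp i)) * halfTurn := by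
      refine LinearMap.ext fun x => ?_
      rw [Module.End.mul_apply, Module.End.mul_apply, rep_gen_apply, rep_gen_apply, map_sub,
        map_smul, halfTurn_root, ← halfTurn_root i, lorentz_halfTurn_halfTurn]
    rw [map_mul, ← mul_assoc, h1, mul_assoc, ih, map_mul, oppHom_gen, map_mul, mul_assoc]

/-! ### Walls that are translated away -/

/-- In a twisted conjugacy class, an element of minimal length either commutes with its left descents
or moves the corresponding wall away. -/
theorem exists_twisted_conj (T : PolygonGroup g →* PolygonGroup g)
    (σ : ZMod (4 * g) → ZMod (4 * g)) (hT : ∀ i, T (gen i) = gen (σ i)) (w : PolygonGroup g) :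
    ∃ v w₀, w₀ = v * w * (T v)⁻¹ ∧ ∀ s, len (gen s * w₀) < len w₀ →
      len w₀ < len (w₀ * gen (σ s)) ∨ gen s * w₀ = w₀ * gen (σ s) := by
  obtain ⟨v, -, hv⟩ := WellFounded.has_min (measure fun v => len (v * w * (T v)⁻¹)).wf
    (Set.univ : Set (PolygonGroup g)) ⟨1, trivial⟩
  refine ⟨v, _, rfl, fun s hs => ?_⟩
  have h1 := hv (gen s * v) trivial
  simp only [WellFoundedRelation.rel, InvImage, not_lt, map_mul, hT, mul_inv_rev,
    gen_inv] at h1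
  have h2 : gen s * v * w * ((T v)⁻¹ * gen (σ s)) = gen s * (v * w * (T v)⁻¹) * gen (σ s) := by
    simp only [mul_assoc]
  -- Replacing v by s v replaces the element by its product with s on the left and σ s on the right.
  -- If σ s is a right descent, minimality of the length leaves only the case of the exchange
  -- property.
  rcases len_mul_gen (v * w * (T v)⁻¹) (σ s) with h | h
  · left
    omega
  · right
    refine gen_mul_eq_mul_gen (by omega) ?_
    rw [h2] at h1
    omega

/-- The base point is on the positive side of both lines and the chamber w t on the negative side of
both. This decides the sign once the absolute value of the product is known to be large. -/
theorem neg_one_lt_lorentz_root_rep {w : PolygonGroup g} {s t : ZMod (4 * g)}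
    (hs : len (gen s * w) < len w) (ht : len w < len (w * gen t)) :
    -1 < lorentz (root s) (rep g w (root t)) := by
  have hs' : len (gen s * (w * gen t)) < len (w * gen t) := by
    rw [← mul_assoc]
    rcases len_mul_gen (gen s * w) t with h | h <;> omega
  exact neg_one_lt_lorentz (root_self s) (by rw [lorentz_rep_rep, root_self])
    isFuture_basePoint (isFuture_rep_basePoint (w * gen t)) (isInterior_basePoint s)
    (lorentz_basePoint_rep_root_pos ht) (lorentz_rep_neg isInterior_basePoint hs')
    (lorentz_rep_mul_gen_basePoint w t)

/-- The sign + would put the chamber of w on the positive side of s, against the left descent; the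
sign - would put the base point on the wrong side of w (root s). -/
theorem not_sameLine_rep_root {w : PolygonGroup g} {s : ZMod (4 * g)}
    (hs : len (gen s * w) < len w) (ht : len w < len (w * gen s)) :
    ¬ SameLine (rep g w (root s)) (root s) := by
  rintro (h | h)
  · have h1 := lorentz_rep_neg isInterior_basePoint hs
    rw [← h, lorentz_rep_rep] at h1
    exact lt_asymm h1 (isInterior_basePoint s)
  · have h1 := lorentz_basePoint_rep_root_pos ht
    rw [h, map_neg] at h1
    linarith [isInterior_basePoint s]

/-- The chamber of w lies beyond both lines, whereas the half-planes beyond two nonadjacent sides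
are disjoint. -/
theorem not_both_descent {w : PolygonGroup g} {s t : ZMod (4 * g)} (hst : s ≠ t)
    (hs : len (gen s * w) < len w) (ht : len (gen t * w) < len w) : Adj s t := by
  by_contra h
  have h1 := lorentz_root_of_not_adj hst h
  have h2 := neg_one_lt_lorentz (root_self s) (root_self t) isFuture_basePoint
    (isFuture_rep_basePoint w) (isInterior_basePoint s) (isInterior_basePoint t)
    (lorentz_rep_neg isInterior_basePoint hs) (lorentz_rep_neg isInterior_basePoint ht)
  linarith [one_lt_coshSide (g := g)]

/-- An element that commutes with all its left descents is a product of at most two adjacent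
generators; the type parity excludes these. -/
theorem exists_descent_not_commute {w : PolygonGroup g} (hw : w ≠ 1) (hχ : typeParity w = 1) :
    ∃ s, len (gen s * w) < len w ∧ gen s * w ≠ w * gen s := by
  by_contra! hcomm
  obtain ⟨s, hs⟩ := exists_len_gen_mul_lt hw
  have hsw : gen s * w = w * gen s := hcomm s hs
  obtain ⟨w₁, hw₁⟩ : ∃ x, x = gen s * w := ⟨_, rfl⟩
  have hls := len_gen_mul w s
  rw [← hw₁] at hls hs
  by_cases h1 : w₁ = 1
  · have : w = gen s := by rw [← gen_mul_gen_mul s w, ← hw₁, h1, mul_one]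
    rw [this, typeParity_gen, ofAdd_eq_one, Prod.mk_eq_zero] at hχ
    rw [hχ.2, add_zero] at hχ
    exact one_ne_zero hχ.1
  obtain ⟨t, ht⟩ := exists_len_gen_mul_lt h1
  have hlt := len_gen_mul w₁ t
  have hts : s ≠ t := by
    rintro rfl
    rw [show gen s * w₁ = w by rw [hw₁, gen_mul_gen_mul]] at ht
    omega
  have hw1s : w = w₁ * gen s := by rw [hw₁, hsw, mul_gen_mul_gen]
  -- As s commutes with w, also w = w₁ s, and so a left descent of w₁ is one of w. The same argument
  -- applies below to a third descent u.
  have htw : len (gen t * w) < len w := by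
    have h3 : gen t * w = gen t * w₁ * gen s := by rw [mul_assoc, ← hw1s]
    rw [h3]
    rcases len_mul_gen (gen t * w₁) s with h | h <;> omega
  have hadj := not_both_descent hts (hw₁ ▸ hs) htw
  have htcomm := hcomm t htw
  obtain ⟨w₂, hw₂⟩ : ∃ x, x = gen t * w₁ := ⟨_, rfl⟩
  rw [← hw₂] at ht hlt
  have hww₂ : w = gen s * (gen t * w₂) := by rw [hw₂, gen_mul_gen_mul, hw₁, gen_mul_gen_mul]
  by_cases h2 : w₂ = 1
  · rw [h2, mul_one] at hww₂
    rw [hww₂, map_mul, typeParity_gen, typeParity_gen, ← ofAdd_add, ofAdd_eq_one, Prod.mk_add_mk,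
      Prod.mk_eq_zero, parity_eq_of_adj hadj, add_right_comm,
      add_right_comm (parity t), CharTwo.add_self_eq_zero (parity t), zero_add] at hχ
    exact one_ne_zero hχ.2
  obtain ⟨u, hu⟩ := exists_len_gen_mul_lt h2
  have hut : t ≠ u := by
    rintro rfl
    rw [show gen t * w₂ = w₁ by rw [hw₂, gen_mul_gen_mul]] at hu
    omega
  have hus : s ≠ u := by
    rintro rfl
    have h3 : gen s * w₂ = gen t * w := by
      rw [hw₂, hw₁, ← mul_assoc, gen_commute hadj, mul_assoc, gen_mul_gen_mul]
    have h4 := len_gen_mul w t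
    rw [h3] at hu
    omega
  have huw : len (gen u * w) < len w := by
    have h3 : w₂ = w * gen s * gen t := by
      rw [← hsw, mul_assoc, ← htcomm, ← mul_assoc, gen_commute hadj, mul_assoc, hw₂, hw₁]
    have h4 : gen u * w = gen u * w₂ * gen t * gen s := by
      rw [mul_assoc (gen u), mul_assoc (gen u), h3, mul_gen_mul_gen, mul_gen_mul_gen]
    rw [h4]
    have h5 := len_mul_gen (gen u * w₂ * gen t) s
    have h6 := len_mul_gen (gen u * w₂) t
    omega
  -- Three pairwise adjacent sides are impossible, because adjacent indices have different parity.
  have hadj1 := parity_eq_of_adj (not_both_descent hus (hw₁ ▸ hs) huw)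
  have hadj2 := parity_eq_of_adj (not_both_descent hut htw huw)
  rw [parity_eq_of_adj hadj, hadj2] at hadj1
  exact one_ne_zero (add_eq_left.1 hadj1)

end rep

section rep

variable [Fact (2 ≤ g)]

/-! ### Lower bounds for traces -/

/-- A point on the line of the side `t` that is not in the interior of the side is at least as far
from the center as a vertex. -/
theorem le_mul_sq_of_outside_side {q : ℝ × ℂ} {i t : ZMod (4 * g)} (hit : i ≠ t)
    (hq : lorentz q q = -1) (hq0 : 0 < q.1) (ht : lorentz q (root t) = 0)
    (hi : lorentz q (root i) ≤ 0) :
    1 + Real.cos (polygonAngle g) ≤ (1 - Real.cos (polygonAngle g)) * q.1 ^ 2 := by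
  obtain ⟨i, rfl⟩ := exists_intCast_eq i
  obtain ⟨t, rfl⟩ := exists_intCast_eq t
  set δ := ((i - t : ℤ) : ℝ) * polygonAngle g with hδ
  have hδcos : Real.cos δ ≤ Real.cos (polygonAngle g) := by
    have := cos_int_mul_polygonAngle_le (g := g) (k := i - t) (m := 1) fun r hr hr' hk => by
      obtain rfl : r = 0 := by push_cast at hr hr'; omega
      rw [Int.cast_sub, Int.cast_zero, sub_eq_zero] at hk
      exact hit hk
    rwa [Nat.cast_one, one_mul] at this
  have hφ : ((i : ℝ) + 1 / 2) * polygonAngle g = (t + 1 / 2) * polygonAngle g + δ := by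
    rw [hδ]; push_cast; ring
  rw [root_intCast, lorentz_intRoot] at ht hi
  rw [hφ] at hi
  generalize ((t : ℝ) + 1 / 2) * polygonAngle g = φ at ht hi
  have hc := cos_polygonAngle_pos (g := g)
  have hc1 := cos_polygonAngle_lt_one (g := g)
  have hd0 : 0 < (√(1 - Real.cos (polygonAngle g)))⁻¹ :=
    inv_pos.2 (Real.sqrt_pos.2 (by linarith))
  have hX := (mul_eq_zero.1 ht).resolve_left hd0.ne'
  have hi' := nonpos_of_mul_nonpos_right hi hd0
  rw [Real.cos_add, Real.sin_add] at hi'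
  -- X and Y are the components of q along and across the direction φ of side t, whose line is X =
  -- √(cos θ) q₁.
  set X := q.2.re * Real.cos φ + q.2.im * Real.sin φ with hXdef
  set Y := -q.2.re * Real.sin φ + q.2.im * Real.cos φ with hYdef
  have hsq : X ^ 2 + Y ^ 2 = q.2.re ^ 2 + q.2.im ^ 2 := by
    rw [hXdef, hYdef]
    linear_combination (q.2.re ^ 2 + q.2.im ^ 2) * Real.sin_sq_add_cos_sq φ
  have hXq : X = √(Real.cos (polygonAngle g)) * q.1 := by linarith
  have hX0 : 0 < X := by rw [hXq]; exact mul_pos (Real.sqrt_pos.2 hc) hq0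
  have hX2 : X ^ 2 = Real.cos (polygonAngle g) * q.1 ^ 2 := by
    rw [hXq, mul_pow, Real.sq_sqrt hc.le]
  -- The condition at i, rewritten in X and Y. Squaring it and cancelling 1 - cos δ bounds Y² from
  -- below; the bound is weakest at cos δ = cos θ, which is the case of a vertex.
  have h1 : (1 - Real.cos δ) * X ≤ Y * Real.sin δ := by
    rw [hXq] at hXdef ⊢
    have h2 : Y * Real.sin δ = q.2.re * (Real.cos φ * Real.cos δ - Real.sin φ * Real.sin δ)
        + q.2.im * (Real.sin φ * Real.cos δ + Real.cos φ * Real.sin δ)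
        - (q.2.re * Real.cos φ + q.2.im * Real.sin φ) * Real.cos δ := by
      rw [hYdef]; ring
    rw [h2, ← hXdef]
    linarith
  have hd : 0 < 1 - Real.cos δ := by linarith
  have h2 : ((1 - Real.cos δ) * X) ^ 2 ≤ (Y * Real.sin δ) ^ 2 := by gcongr
  have h3 : (1 - Real.cos δ) * ((1 - Real.cos δ) * X ^ 2)
      ≤ (1 - Real.cos δ) * ((1 + Real.cos δ) * Y ^ 2) := by
    have h4 := Real.sin_sq_add_cos_sq δ
    calc (1 - Real.cos δ) * ((1 - Real.cos δ) * X ^ 2) = ((1 - Real.cos δ) * X) ^ 2 := by ring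
      _ ≤ (Y * Real.sin δ) ^ 2 := h2
      _ = _ := by linear_combination Y ^ 2 * h4
  have h4 := le_of_mul_le_mul_left h3 hd
  have h5 : (1 - Real.cos (polygonAngle g)) * X ^ 2 ≤ (1 + Real.cos (polygonAngle g)) * Y ^ 2 := by
    have h6 : (1 - Real.cos (polygonAngle g)) * X ^ 2 ≤ (1 - Real.cos δ) * X ^ 2 := by gcongr
    have h7 : (1 + Real.cos δ) * Y ^ 2 ≤ (1 + Real.cos (polygonAngle g)) * Y ^ 2 := by gcongr
    linarith
  rw [lorentz_apply] at hq
  have h6 : q.1 ^ 2 = 1 + X ^ 2 + Y ^ 2 := by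
    rw [add_assoc, hsq]; linarith
  have h7 : (1 + Real.cos (polygonAngle g)) * q.1 ^ 2
      = (1 + Real.cos (polygonAngle g)) + (1 + Real.cos (polygonAngle g)) * X ^ 2
        + (1 + Real.cos (polygonAngle g)) * Y ^ 2 := by
    rw [h6]; ring
  nlinarith

/-- A rotation by `π` in the group that maps a side line of the polygon to itself has its center
outside the open side. -/
theorem le_mul_im_sq_of_rep_root_eq_neg {w : PolygonGroup g} {t : ZMod (4 * g)} {a b : ℂ}
    (hab : Complex.normSq a - Complex.normSq b = 1) (hw : rep g w = mobius a b)
    (heven : Even (len w)) (ht : rep g w (root t) = -root t) :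
    1 + Real.cos (polygonAngle g) ≤ (1 - Real.cos (polygonAngle g)) * a.im ^ 2 := by
  have hfix : rep g w (mobiusAxis a b) = mobiusAxis a b := by rw [hw, mobius_mobiusAxis hab]
  have horth : lorentz (root t) (mobiusAxis a b) = 0 := by
    have h1 := lorentz_rep_rep w (root t) (mobiusAxis a b)
    rw [hfix, ht, map_neg, LinearMap.neg_apply] at h1
    linarith
  have hre : a.re ^ 2 = 0 := by
    have h1 := lorentz_mobius_self hab (root_self t)
    rw [← hw, ht, map_neg, root_self, horth] at h1
    linarith
  have hnorm : lorentz (mobiusAxis a b) (mobiusAxis a b) = -1 := by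
    rw [lorentz_mobiusAxis hab, hre]; norm_num
  have him : a.im ≠ 0 := by
    intro h0
    rw [lorentz_apply] at hnorm
    simp only [mobiusAxis, h0] at hnorm
    nlinarith [sq_nonneg (Complex.I * b).re, sq_nonneg (Complex.I * b).im]
  -- The fixed vector is timelike of norm -1; q is the future directed one of the two signs, so |Im
  -- a| is the hyperbolic cosine of the distance of the centre of rotation from the origin.
  obtain ⟨q, hq0, hq1, hqfix, hqorth, hqnorm⟩ : ∃ q : ℝ × ℂ, 0 < q.1 ∧ q.1 ^ 2 = a.im ^ 2 ∧
      rep g w q = q ∧ lorentz q (root t) = 0 ∧ lorentz q q = -1 := by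
    rcases lt_or_gt_of_ne him with h | h
    · refine ⟨-mobiusAxis a b, by simpa [mobiusAxis] using h, by simp [mobiusAxis], ?_, ?_, ?_⟩
      · rw [map_neg, hfix]
      · rw [lorentz_comm, map_neg, horth, neg_zero]
      · rw [map_neg, map_neg, LinearMap.neg_apply, neg_neg, hnorm]
    · exact ⟨mobiusAxis a b, by simpa [mobiusAxis] using h, by simp [mobiusAxis], hfix,
        by rw [lorentz_comm, horth], hnorm⟩
  rw [← hq1]
  by_cases hall : ∃ i, i ≠ t ∧ lorentz q (root i) ≤ 0
  · obtain ⟨i, hit, hi⟩ := hall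
    exact le_mul_sq_of_outside_side hit hqnorm hq0 hqorth hi
  exfalso
  push Not at hall
  have hclosed : IsClosedChamber (g := g) q := fun i => by
    by_cases h : i = t
    · rw [h, hqorth]
    · exact (hall i h).le
  -- Now q lies in the open side t, so an element fixing q has no left descent other than t. Hence w
  -- would be 1 or the reflection in t; the first does not reverse root t and the second has odd
  -- length.
  have hdesc : ∀ v : PolygonGroup g, rep g v q = q → ∀ u, len (gen u * v) < len v → u = t := by
    intro v hv u hu
    by_contra hut
    have h1 := lorentz_rep_nonpos hclosed hu
    rw [hv] at h1
    exact absurd (hall u hut) (not_lt.2 h1)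
  have hw1 : w ≠ 1 := by
    rintro rfl
    rw [rep_one_apply] at ht
    have h1 := congrArg (lorentz (root t)) ht
    rw [map_neg, root_self] at h1
    norm_num at h1
  obtain ⟨u, hu⟩ := exists_len_gen_mul_lt hw1
  obtain rfl := hdesc w hqfix u hu
  have hw2 : gen u * w ≠ 1 := by
    intro h
    have : w = gen u := by rw [← gen_mul_gen_mul u w, h, mul_one]
    have hl : len (gen u) = 1 := (coxeterSystem g).length_simple u
    rw [this, hl] at heven
    exact Nat.not_even_one heven
  obtain ⟨u', hu'⟩ := exists_len_gen_mul_lt hw2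
  have hfix2 : rep g (gen u * w) q = q := by
    rw [rep_mul_apply, hqfix, rep_gen_of_orthogonal (by rw [lorentz_comm, hqorth])]
  rw [hdesc _ hfix2 u' hu', gen_mul_gen_mul] at hu'
  omega

theorem le_abs_of_sq {K x : ℝ} (hK : 0 ≤ K) (h : K ^ 2 ≤ x ^ 2) : K ≤ |x| := by
  rwa [← sq_le_sq₀ hK (abs_nonneg x), sq_abs]

theorem le_abs_re_of_lorentz {a b : ℂ} (hab : Complex.normSq a - Complex.normSq b = 1)
    {x : ℝ × ℂ} (hx : lorentz x x = 1)
    (h : 2 * (1 + 2 * Real.cos (polygonAngle g)) ^ 2 - 1 ≤ lorentz x (mobius a b x)) :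
    1 + 2 * Real.cos (polygonAngle g) ≤ |a.re| := by
  rw [lorentz_mobius_self hab hx] at h
  exact le_abs_of_sq (by linarith [cos_polygonAngle_pos (g := g)]) (by nlinarith)

theorem le_lorentz_of_le_abs {s t : ZMod (4 * g)} {w : PolygonGroup g}
    (h : 2 * (1 + 2 * Real.cos (polygonAngle g)) ^ 2 - 1 ≤ |lorentz (root s) (rep g w (root t))|)
    (h' : -1 < lorentz (root s) (rep g w (root t))) :
    2 * (1 + 2 * Real.cos (polygonAngle g)) ^ 2 - 1 ≤ lorentz (root s) (rep g w (root t)) := by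
  have hK := one_lt_coshSide (g := g)
  rcases le_abs.1 h with h | h
  · exact h
  · nlinarith

/-- The trace bound for the elements of the reflection group. -/
theorem le_abs_re_of_rep_eq {w : PolygonGroup g} (hw : w ≠ 1) (hχ : typeParity w = 1) {a b : ℂ}
    (hab : Complex.normSq a - Complex.normSq b = 1) (hL : rep g w = mobius a b) :
    1 + 2 * Real.cos (polygonAngle g) ≤ |a.re| := by
  obtain ⟨v, w₀, hw₀, h⟩ := exists_twisted_conj (MonoidHom.id (PolygonGroup g)) id
    (fun _ => rfl) w
  simp only [MonoidHom.id_apply, id_eq] at hw₀ h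
  have hw₀1 : w₀ ≠ 1 := by
    rintro rfl
    apply hw
    have := congrArg (fun x => v⁻¹ * x * v) hw₀
    simpa [mul_assoc] using this.symm
  have hχ₀ : typeParity w₀ = 1 := by
    rw [hw₀, map_mul, map_mul, hχ, mul_one, ← map_mul, mul_inv_cancel, map_one]
  obtain ⟨s, hs, hne⟩ := exists_descent_not_commute hw₀1 hχ₀
  have ht := (h s hs).resolve_right hne
  -- Conjugation is moved from the element to the wall, so that the coefficient a itself is bounded.
  have hval : lorentz (root s) (rep g w₀ (root s))
      = lorentz (rep g v⁻¹ (root s)) (mobius a b (rep g v⁻¹ (root s))) := by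
    rw [hw₀, rep_mul_apply, rep_mul_apply, hL, lorentz_rep_right v]
  refine le_abs_re_of_lorentz hab (x := rep g v⁻¹ (root s)) (by rw [lorentz_rep_rep, root_self]) ?_
  rw [← hval]
  refine le_lorentz_of_le_abs ?_ (neg_one_lt_lorentz_root_rep hs ht)
  rcases exists_common_chamber_or_le_abs_lorentz w₀ s s with ⟨u, hu, hu'⟩ | h
  · exact absurd (hu'.trans hu) (not_sameLine_rep_root hs ht)
  · exact h

/-- The trace bound for the products of elements of the reflection group with the rotation by `π` of
the polygon. -/
theorem le_abs_re_of_rep_mul_halfTurn_eq {w : PolygonGroup g}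
    (hχ : typeParity w = Multiplicative.ofAdd (1, 1)) {a b : ℂ}
    (hab : Complex.normSq a - Complex.normSq b = 1) (hL : rep g w * halfTurn = mobius a b) :
    1 + 2 * Real.cos (polygonAngle g) ≤ |a.re| := by
  obtain ⟨v, w₀, hw₀, h⟩ := exists_twisted_conj (oppHom g) opp oppHom_gen w
  have hconj : ∀ v : PolygonGroup g, rep g (v * w * (oppHom g v)⁻¹) * halfTurn
      = rep g v * mobius a b * rep g v⁻¹ := by
    intro v
    rw [← map_inv, map_mul, mul_assoc, ← halfTurn_mul_rep, map_mul, ← hL]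
    simp only [mul_assoc]
  have hχconj : ∀ v : PolygonGroup g, typeParity (v * w * (oppHom g v)⁻¹)
      = Multiplicative.ofAdd (1, 1) := by
    intro v
    rw [map_mul, map_mul, hχ, map_inv, typeParity_oppHom, mul_right_comm, mul_inv_cancel, one_mul]
  have hχ₀ : typeParity w₀ = Multiplicative.ofAdd (1, 1) := by rw [hw₀, hχconj]
  have hw₀1 : w₀ ≠ 1 := by
    rintro rfl
    rw [map_one] at hχ₀
    have := congrArg (fun x => x.toAdd.1) hχ₀
    exact zero_ne_one this
  obtain ⟨s, hs⟩ := exists_len_gen_mul_lt hw₀1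
  -- A twisted commutation would make the parity of the number of letters s equal to that of its
  -- complement, because `opp s` is a different letter.
  have hne : gen s * w₀ ≠ w₀ * gen (opp s) := by
    intro h0
    have h1 := congrArg (sideParity s) h0
    rw [map_mul, map_mul, mul_comm, mul_right_inj, sideParity_gen, sideParity_gen, if_pos rfl,
      if_neg (opp_ne s)] at h1
    exact one_ne_zero (Multiplicative.ofAdd.injective h1)
  have ht := (h s hs).resolve_right hne
  have hpos := neg_one_lt_lorentz_root_rep hs ht
  have hval : lorentz (root s) (rep g w₀ (root (opp s)))
      = lorentz (rep g v⁻¹ (root s)) (mobius a b (rep g v⁻¹ (root s))) := by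
    rw [← halfTurn_root, ← Module.End.mul_apply, hw₀, hconj, Module.End.mul_apply,
      Module.End.mul_apply, lorentz_rep_right v]
  rcases exists_common_chamber_or_le_abs_lorentz w₀ s (opp s) with ⟨u, hu, hu'⟩ | h
  · -- both walls bound the chamber of `u`
    -- The sides s and `opp s` of the chamber u have product below -1, whereas the wall and its
    -- image have product above -1. So exactly one of the two sign choices is negative.
    have hprod : rep g (u⁻¹ * w₀) (root (opp s)) = -root (opp s) ∧
        rep g u (root s) = root s ∨ rep g (u⁻¹ * w₀) (root (opp s)) = root (opp s) ∧
        rep g u (root s) = -root s := by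
      have hlt := lorentz_root_of_not_adj (opp_ne s).symm (not_adj_opp s)
      have hK := one_lt_coshSide (g := g)
      have h1 : lorentz (rep g u (root s)) (rep g u (root (opp s)))
        = lorentz (root s) (root (opp s)) := lorentz_rep_rep _ _ _
      rcases hu with hu | hu <;> rcases hu' with hu' | hu' <;> rw [hu] at h1 <;>
        rw [hu'] at hpos
      · linarith
      · left
        rw [rep_mul_apply, hu', map_neg, rep_inv_rep]
        exact ⟨rfl, hu⟩
      · right
        rw [rep_mul_apply, hu', rep_inv_rep]
        exact ⟨rfl, hu⟩
      · rw [map_neg, LinearMap.neg_apply] at h1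
        rw [map_neg] at hpos
        linarith
    -- A further twisted conjugation by u⁻¹ moves the common chamber to the fundamental one. There
    -- w' reverses the line of `opp s`, so it is a half turn with centre on that line.
    set w' := u⁻¹ * v * w * (oppHom g (u⁻¹ * v))⁻¹ with hw'
    have hw'₀ : w' = u⁻¹ * w₀ * oppHom g u := by
      rw [hw', hw₀, map_mul, map_inv, mul_inv_rev, inv_inv]
      simp only [mul_assoc]
    have hopp : rep g (oppHom g u) (root (opp s)) = halfTurn (rep g u (root s)) := by
      rw [← halfTurn_root, ← Module.End.mul_apply, ← halfTurn_mul_rep, Module.End.mul_apply]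
    have hroot : rep g w' (root (opp s)) = -root (opp s) := by
      rw [hw'₀, rep_mul_apply, hopp]
      rcases hprod with ⟨h1, h2⟩ | ⟨h1, h2⟩
      · rw [h2, halfTurn_root, h1]
      · rw [h2, map_neg, halfTurn_root, map_neg, h1]
    have heven : Even (len w') := even_len_of_typeParity (hχconj _)
    obtain ⟨a', b', hab', hmob⟩ := exists_rep_eq_mobius w'
    obtain ⟨k, hk⟩ := heven
    rw [hk, ← two_mul, pow_mul, pow_two, conjMap_mul_self, one_pow, mul_one] at hmob
    have him := le_mul_im_sq_of_rep_root_eq_neg hab' hmob ⟨k, hk⟩ hroot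
    have htr : LinearMap.trace ℝ (ℝ × ℂ) (rep g w' * halfTurn)
        = LinearMap.trace ℝ (ℝ × ℂ) (mobius a b) := by
      rw [hw', hconj]
      exact trace_conj_eq (by rw [← map_mul, inv_mul_cancel, map_one])
    have hdet : Complex.normSq (a' * Complex.I + b' * conj 0)
        - Complex.normSq (a' * 0 + b' * conj Complex.I) = 1 := by
      rw [normSq_sub_normSq_mul, hab']
      simp
    -- Composition with the half turn multiplies a' by i, so equality of traces gives (Re a)² = (Im
    -- a')².
    rw [hmob, halfTurn, mobius_mul, trace_mobius hab, trace_mobius hdet] at htr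
    simp only [Complex.mul_re, Complex.I_re, Complex.I_im, map_zero, mul_zero, add_zero, mul_one,
      zero_sub] at htr
    have hc := cos_polygonAngle_pos (g := g)
    have hc1 := cos_polygonAngle_lt_one (g := g)
    have hc2 := one_le_two_mul_cos_sq (g := g)
    refine le_abs_of_sq (by linarith) ?_
    have h1 : a.re ^ 2 = a'.im ^ 2 := by linarith
    rw [h1]
    -- With c = cos θ, the difference 1 + c - (1 - c)(1 + 2c)² equals 2c(2c² - 1), which is
    -- nonnegative as θ ≤ π/4.
    have h2 : (1 - Real.cos (polygonAngle g)) * (1 + 2 * Real.cos (polygonAngle g)) ^ 2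
        ≤ (1 - Real.cos (polygonAngle g)) * a'.im ^ 2 := by
      refine le_trans ?_ him
      nlinarith [mul_nonneg hc.le (sub_nonneg.2 hc2)]
    exact le_of_mul_le_mul_left h2 (by linarith)
  · refine le_abs_re_of_lorentz hab (x := rep g v⁻¹ (root s))
      (by rw [lorentz_rep_rep, root_self]) ?_
    rw [← hval]
    exact le_lorentz_of_le_abs h hpos

end rep

/-! ### Linear fractional transformations of the disk -/

/-- `f` is the transformation `z ↦ (a z + b) / (conj b z + conj a)`. -/
def HasMatrix (f : 𝔻 ≃ᵢ 𝔻) (a b : ℂ) : Prop :=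
  Complex.normSq a - Complex.normSq b = 1 ∧
    ∀ z : 𝔻, (f z : ℂ) = (a * z + b) / (conj b * z + conj a)

theorem OrientationPreserving.exists_hasMatrix {f : 𝔻 ≃ᵢ 𝔻} (hf : OrientationPreserving f) :
    ∃ a b : ℂ, HasMatrix f a b := by
  obtain ⟨a, b, hab, h⟩ := hf
  exact ⟨a, b, by rwa [Complex.normSq_eq_norm_sq, Complex.normSq_eq_norm_sq], h⟩

theorem HasMatrix.orientationPreserving {f : 𝔻 ≃ᵢ 𝔻} {a b : ℂ} (hf : HasMatrix f a b) :
    OrientationPreserving f :=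
  ⟨a, b, by rw [← Complex.normSq_eq_norm_sq, ← Complex.normSq_eq_norm_sq]; exact hf.1, hf.2⟩

theorem normSq_denom_sub_normSq_num {a b : ℂ} (hab : Complex.normSq a - Complex.normSq b = 1)
    (z : ℂ) : Complex.normSq (conj b * z + conj a) - Complex.normSq (a * z + b)
      = 1 - Complex.normSq z := by
  simp only [Complex.normSq_apply, Complex.add_re, Complex.add_im, Complex.mul_re, Complex.mul_im,
      Complex.conj_re, Complex.conj_im] at *
  linear_combination (1 - z.re * z.re - z.im * z.im) * hab

theorem denom_ne_zero {a b : ℂ} (hab : Complex.normSq a - Complex.normSq b = 1) (z : 𝔻) :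
    conj b * (z : ℂ) + conj a ≠ 0 := by
  intro h
  have h1 := normSq_denom_sub_normSq_num hab z
  rw [h, map_zero] at h1
  linarith [z.normSq_lt_one, Complex.normSq_nonneg (a * z + b)]

theorem one_sub_normSq_div {a b : ℂ} (hab : Complex.normSq a - Complex.normSq b = 1) (z : 𝔻) :
    1 - Complex.normSq ((a * z + b) / (conj b * z + conj a))
      = (1 - Complex.normSq (z : ℂ)) / Complex.normSq (conj b * z + conj a) := by
  have h := Complex.normSq_pos.2 (denom_ne_zero hab z)
  rw [Complex.normSq_div, eq_div_iff h.ne', sub_mul, div_mul_cancel₀ _ h.ne',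
    ← normSq_denom_sub_normSq_num hab, one_mul]

theorem div_sub_div_eq {a b : ℂ} (hab : Complex.normSq a - Complex.normSq b = 1) (z w : 𝔻) :
    (a * z + b) / (conj b * z + conj a) - (a * w + b) / (conj b * w + conj a)
      = ((z : ℂ) - w) / ((conj b * z + conj a) * (conj b * w + conj a)) := by
  have h : a * conj a - b * conj b = 1 := by
    rw [Complex.mul_conj, Complex.mul_conj, ← Complex.ofReal_sub, hab, Complex.ofReal_one]
  rw [div_sub_div _ _ (denom_ne_zero hab z) (denom_ne_zero hab w)]
  congr 1
  linear_combination ((z : ℂ) - w) * h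

/-- The transformation `z ↦ (a z + b) / (conj b z + conj a)` of the disk. -/
def mobiusFun (a b : ℂ) (hab : Complex.normSq a - Complex.normSq b = 1) (z : 𝔻) : 𝔻 :=
  Complex.UnitDisc.mk ((a * z + b) / (conj b * z + conj a)) (by
    have h := one_sub_normSq_div hab z
    have h1 : 0 < (1 - Complex.normSq (z : ℂ)) / Complex.normSq (conj b * z + conj a) :=
      div_pos (by linarith [z.normSq_lt_one]) (Complex.normSq_pos.2 (denom_ne_zero hab z))
    rw [← h, Complex.normSq_eq_norm_sq] at h1
    exact (sq_lt_one_iff₀ (norm_nonneg _)).1 (by linarith))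

theorem coe_mobiusFun (a b : ℂ) (hab : Complex.normSq a - Complex.normSq b = 1) (z : 𝔻) :
    (mobiusFun a b hab z : ℂ) = (a * z + b) / (conj b * z + conj a) := rfl

theorem mobius_div_div {a b a' b' : ℂ} (hab : Complex.normSq a - Complex.normSq b = 1)
    (hab' : Complex.normSq a' - Complex.normSq b' = 1) (z : 𝔻) :
    (a * (mobiusFun a' b' hab' z) + b) / (conj b * (mobiusFun a' b' hab' z) + conj a)
      = ((a * a' + b * conj b') * z + (a * b' + b * conj a')) /
        (conj (a * b' + b * conj a') * z + conj (a * a' + b * conj b')) := by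
  have h1 := denom_ne_zero hab (mobiusFun a' b' hab' z)
  have h2 := denom_ne_zero hab' z
  have h3 := denom_ne_zero (a := a * a' + b * conj b') (b := a * b' + b * conj a')
    (by rw [normSq_sub_normSq_mul, hab, hab', one_mul]) z
  have h4 : (mobiusFun a' b' hab' z : ℂ) * (conj b' * z + conj a') = a' * z + b' := by
    rw [coe_mobiusFun, div_mul_cancel₀ _ h2]
  rw [div_eq_div_iff h1 h3]
  refine mul_right_cancel₀ h2 ?_
  simp only [map_add, map_mul, Complex.conj_conj]
  generalize (mobiusFun a' b' hab' z : ℂ) = m at *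
  linear_combination (a * ((conj a * conj a' + conj b * b') + (conj a * conj b' + conj b * a') * z)
    - conj b * ((a * a' + b * conj b') * z + (a * b' + b * conj a'))) * h4

theorem HasMatrix.mul {f f' : 𝔻 ≃ᵢ 𝔻} {a b a' b' : ℂ} (hf : HasMatrix f a b)
    (hf' : HasMatrix f' a' b') :
    HasMatrix (f * f') (a * a' + b * conj b') (a * b' + b * conj a') := by
  refine ⟨by rw [normSq_sub_normSq_mul, hf.1, hf'.1, one_mul], fun z => ?_⟩
  have h : f' z = mobiusFun a' b' hf'.1 z := Complex.UnitDisc.coe_injective (hf'.2 z)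
  rw [IsometryEquiv.mul_apply, hf.2, h, mobius_div_div hf.1 hf'.1]

theorem hasMatrix_one : HasMatrix 1 1 0 := ⟨by simp, fun z => by simp⟩

theorem normSq_conj_sub_normSq_neg {a b : ℂ} (hab : Complex.normSq a - Complex.normSq b = 1) :
    Complex.normSq (conj a) - Complex.normSq (-b) = 1 := by
  rwa [Complex.normSq_conj, Complex.normSq_neg]

theorem mobiusFun_neg_mobiusFun {a b : ℂ} (hab : Complex.normSq a - Complex.normSq b = 1) (z : 𝔻) :
    mobiusFun (conj a) (-b) (normSq_conj_sub_normSq_neg hab) (mobiusFun a b hab z) = z := by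
  have h : conj a * a - b * conj b = 1 := by
    rw [mul_comm, Complex.mul_conj, Complex.mul_conj, ← Complex.ofReal_sub, hab, Complex.ofReal_one]
  refine Complex.UnitDisc.coe_injective ?_
  rw [coe_mobiusFun, mobius_div_div (normSq_conj_sub_normSq_neg hab) hab]
  rw [show conj a * a + -b * conj b = 1 by linear_combination h,
    show conj a * b + -b * conj a = 0 by ring]
  simp

theorem mobiusFun_mobiusFun_neg {a b : ℂ} (hab : Complex.normSq a - Complex.normSq b = 1) (z : 𝔻) :
    mobiusFun a b hab (mobiusFun (conj a) (-b) (normSq_conj_sub_normSq_neg hab) z) = z := by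
  have h := mobiusFun_neg_mobiusFun (normSq_conj_sub_normSq_neg hab) z
  simpa only [Complex.conj_conj, neg_neg] using h

theorem dist_eq (z w : 𝔻) : dist z w =
    2 * Real.arsinh (‖(z : ℂ) - w‖ / √((1 - ‖(z : ℂ)‖ ^ 2) * (1 - ‖(w : ℂ)‖ ^ 2))) := rfl

theorem isometry_mobiusFun {a b : ℂ} (hab : Complex.normSq a - Complex.normSq b = 1) :
    Isometry (mobiusFun a b hab) := by
  refine Isometry.of_dist_eq fun z w => ?_
  have hz := norm_pos_iff.2 (denom_ne_zero hab z)
  have hw := norm_pos_iff.2 (denom_ne_zero hab w)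
  have h1 := one_sub_normSq_div hab z
  have h2 := one_sub_normSq_div hab w
  simp only [Complex.normSq_eq_norm_sq] at h1 h2
  rw [dist_eq, dist_eq, coe_mobiusFun, coe_mobiusFun, h1, h2, div_sub_div_eq hab, norm_div, norm_mul,
    div_mul_div_comm, ← mul_pow, Real.sqrt_div' _ (by positivity), Real.sqrt_sq (by positivity),
    div_div_div_cancel_right₀ (by positivity)]

/-- The transformation `z ↦ (a z + b) / (conj b z + conj a)` as an isometry of the disk. -/
def mobiusIsometry (a b : ℂ) (hab : Complex.normSq a - Complex.normSq b = 1) : 𝔻 ≃ᵢ 𝔻 where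
  toFun := mobiusFun a b hab
  invFun := mobiusFun (conj a) (-b) (normSq_conj_sub_normSq_neg hab)
  left_inv := mobiusFun_neg_mobiusFun hab
  right_inv := mobiusFun_mobiusFun_neg hab
  isometry_toFun := isometry_mobiusFun hab

theorem hasMatrix_mobiusIsometry (a b : ℂ) (hab : Complex.normSq a - Complex.normSq b = 1) :
    HasMatrix (mobiusIsometry a b hab) a b := ⟨hab, fun _ => rfl⟩

theorem HasMatrix.eq_mobiusIsometry {f : 𝔻 ≃ᵢ 𝔻} {a b : ℂ} (hf : HasMatrix f a b) :
    f = mobiusIsometry a b hf.1 :=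
  IsometryEquiv.ext fun z => Complex.UnitDisc.coe_injective (hf.2 z)

theorem HasMatrix.inv {f : 𝔻 ≃ᵢ 𝔻} {a b : ℂ} (hf : HasMatrix f a b) :
    HasMatrix f⁻¹ (conj a) (-b) := by
  refine ⟨normSq_conj_sub_normSq_neg hf.1, fun z => ?_⟩
  rw [hf.eq_mobiusIsometry]
  rfl

/-- The coefficients are determined up to a common sign by the action on the Lorentz space, and the
sign cancels in the fraction. -/
theorem HasMatrix.eq_one {f : 𝔻 ≃ᵢ 𝔻} {a b : ℂ} (hf : HasMatrix f a b) (h : mobius a b = 1) :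
    f = 1 := by
  have h0 := congrArg Prod.fst (LinearMap.congr_fun h (1, 0))
  simp only [mobius_apply, Module.End.one_apply, mul_zero, Complex.zero_re, mul_one, add_zero] at h0
  have hb : b = 0 := by
    have := Complex.normSq_nonneg b
    exact Complex.normSq_eq_zero.1 (by linarith [hf.1])
  subst hb
  have h1 := congrArg Prod.snd (LinearMap.congr_fun h (0, 1))
  simp only [mobius_apply, Module.End.one_apply, mul_one, mul_zero, Complex.ofReal_zero, zero_mul,
    zero_add, add_zero, ne_eq, OfNat.ofNat_ne_zero, not_false_eq_true, zero_pow] at h1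
  rcases sq_eq_one_iff.1 h1 with rfl | rfl <;>
  · refine IsometryEquiv.ext fun z => Complex.UnitDisc.coe_injective ?_
    rw [hf.2]
    simp

/-- Divided by (1 - |z|²)², this is sinh² of half the displacement of z. The second square is the
squared product of the hyperboloid vector (1 + |z|², 2z) with `mobiusAxis a b`, so it vanishes on
the axis of a translation. -/
theorem normSq_displacement {a b : ℂ} (hab : Complex.normSq a - Complex.normSq b = 1) (z : ℂ) :
    Complex.normSq (z * (conj b * z + conj a) - (a * z + b))
      = (a.re ^ 2 - 1) * (1 - Complex.normSq z) ^ 2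
        + (a.im * (1 + Complex.normSq z) - 2 * (conj b * z).im) ^ 2 := by
  simp only [Complex.normSq_apply, Complex.add_re, Complex.add_im, Complex.sub_re, Complex.sub_im,
    Complex.mul_re, Complex.mul_im, Complex.conj_re, Complex.conj_im] at *
  linear_combination -(1 - z.re * z.re - z.im * z.im) ^ 2 * hab

theorem HasMatrix.le_dist {f : 𝔻 ≃ᵢ 𝔻} {a b : ℂ} (hf : HasMatrix f a b) {K : ℝ} (hK : 1 ≤ K)
    (hKa : K ≤ |a.re|) (z : 𝔻) : 2 * Real.arcosh K ≤ dist z (f z) := by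
  have hs : 0 < 1 - ‖(z : ℂ)‖ ^ 2 := by linarith [z.sq_norm_lt_one]
  have hD := norm_pos_iff.2 (denom_ne_zero hf.1 z)
  have h1 := one_sub_normSq_div hf.1 z
  have h2 := normSq_displacement hf.1 z
  simp only [Complex.normSq_eq_norm_sq] at h1 h2
  have h3 : (z : ℂ) - f z = (z * (conj b * z + conj a) - (a * z + b)) / (conj b * z + conj a) := by
    rw [hf.2, sub_div, mul_div_cancel_right₀ _ (denom_ne_zero hf.1 z)]
  have h4 : ‖(z : ℂ) - f z‖ / √((1 - ‖(z : ℂ)‖ ^ 2) * (1 - ‖(f z : ℂ)‖ ^ 2))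
      = ‖z * (conj b * z + conj a) - (a * z + b)‖ / (1 - ‖(z : ℂ)‖ ^ 2) := by
    rw [h3, hf.2, h1, ← mul_div_assoc, ← pow_two, ← div_pow, Real.sqrt_sq (by positivity), norm_div,
      div_div_div_cancel_right₀ hD.ne']
  rw [dist_eq, h4, ← Real.arsinh_sinh (Real.arcosh K), Real.sinh_arcosh hK]
  gcongr
  rw [le_div_iff₀ hs]
  refine abs_le_of_sq_le_sq' ?_ (norm_nonneg _) |>.2
  rw [h2, mul_pow, Real.sq_sqrt (by nlinarith)]
  have h5 : K ^ 2 ≤ a.re ^ 2 := by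
    rw [← sq_abs a.re]
    gcongr
  nlinarith [sq_nonneg (1 - ‖(z : ℂ)‖ ^ 2), sq_nonneg (a.im * (1 + ‖(z : ℂ)‖ ^ 2) - 2 * (conj b * z).im)]

/-! ### Lifting to the reflection group -/

theorem typeParity_oppHom_iterate (n : ℕ) (w : PolygonGroup g) :
    typeParity ((oppHom g)^[n] w) = typeParity w := by
  induction n generalizing w with
  | zero => rfl
  | succ n ih => rw [Function.iterate_succ, Function.comp, ih, typeParity_oppHom]

section lift

variable [Fact (2 ≤ g)]

/-- `f` is represented by an element of the reflection group, composed with the `n`-th power of the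
rotation by `π`. -/
def IsRepresented (g : ℕ) [Fact (2 ≤ g)] (f : 𝔻 ≃ᵢ 𝔻) (w : PolygonGroup g) (n : ℕ) : Prop :=
  typeParity w = Multiplicative.ofAdd ((n : ZMod 2), (n : ZMod 2)) ∧
    ∃ a b : ℂ, HasMatrix f a b ∧ mobius a b = rep g w * halfTurn ^ n

theorem halfTurn_pow_mul_rep (n : ℕ) (w : PolygonGroup g) :
    halfTurn ^ n * rep g w = rep g ((oppHom g)^[n] w) * halfTurn ^ n := by
  induction n generalizing w with
  | zero => simp
  | succ n ih =>
    rw [pow_succ, mul_assoc, halfTurn_mul_rep, ← mul_assoc, ih, mul_assoc, Function.iterate_succ,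
      Function.comp]

theorem isRepresented_one : IsRepresented g 1 1 0 :=
  ⟨by rw [map_one, Nat.cast_zero]; rfl, 1, 0, hasMatrix_one, by
    rw [map_one, pow_zero, mul_one]
    refine LinearMap.ext fun x => ?_
    simp [mobius_apply]⟩

theorem IsRepresented.mul {f f' : 𝔻 ≃ᵢ 𝔻} {w w' : PolygonGroup g} {n n' : ℕ}
    (hf : IsRepresented g f w n) (hf' : IsRepresented g f' w' n') :
    IsRepresented g (f * f') (w * (oppHom g)^[n] w') (n + n') := by
  obtain ⟨hw, a, b, hab, h⟩ := hf
  obtain ⟨hw', a', b', hab', h'⟩ := hf'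
  refine ⟨?_, _, _, hab.mul hab', ?_⟩
  · rw [map_mul, typeParity_oppHom_iterate, hw, hw', ← ofAdd_add, Prod.mk_add_mk, Nat.cast_add]
  · rw [← mobius_mul, h, h', map_mul, pow_add, mul_assoc, ← mul_assoc (halfTurn ^ n),
      halfTurn_pow_mul_rep, mul_assoc, mul_assoc]

theorem IsRepresented.inv {f : 𝔻 ≃ᵢ 𝔻} {w : PolygonGroup g} {n : ℕ}
    (hf : IsRepresented g f w n) : IsRepresented g f⁻¹ ((oppHom g)^[n] w⁻¹) n := by
  obtain ⟨hw, a, b, hab, h⟩ := hf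
  refine ⟨?_, _, _, hab.inv, ?_⟩
  · rw [typeParity_oppHom_iterate, map_inv, hw, ← ofAdd_neg, Prod.neg_mk, CharTwo.neg_eq]
  · have hinv : mobius (conj a) (-b) * mobius a b = 1 := by
      rw [mobius_mul]
      have h0 : conj a * a + -b * conj b = 1 := by
        rw [neg_mul, mul_comm, Complex.mul_conj, Complex.mul_conj, ← sub_eq_add_neg,
          ← Complex.ofReal_sub, hab.1, Complex.ofReal_one]
      rw [h0, show conj a * b + -b * conj a = 0 by ring]
      refine LinearMap.ext fun x => ?_
      simp [mobius_apply]
    have hsq : halfTurn ^ n * halfTurn ^ n = 1 := by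
      rw [← (Commute.refl halfTurn).mul_pow, halfTurn_mul_self, one_pow]
    have hr : mobius a b * (rep g ((oppHom g)^[n] w⁻¹) * halfTurn ^ n) = 1 := by
      rw [h, ← halfTurn_pow_mul_rep, mul_assoc, ← mul_assoc (halfTurn ^ n), hsq, one_mul, ← map_mul,
        mul_inv_cancel, map_one]
    calc mobius (conj a) (-b)
        = mobius (conj a) (-b) * (mobius a b * (rep g ((oppHom g)^[n] w⁻¹) * halfTurn ^ n)) := by
          rw [hr, mul_one]
      _ = _ := by rw [← mul_assoc, hinv, one_mul]

/-- The half turn is an involution, so the parity of n selects one of the two trace bounds. -/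
theorem IsRepresented.exists_hasMatrix {f : 𝔻 ≃ᵢ 𝔻} {w : PolygonGroup g} {n : ℕ}
    (hf : IsRepresented g f w n) (h1 : f ≠ 1) :
    ∃ a b : ℂ, HasMatrix f a b ∧ 1 + 2 * Real.cos (polygonAngle g) ≤ |a.re| := by
  obtain ⟨hw, a, b, hab, h⟩ := hf
  refine ⟨a, b, hab, ?_⟩
  have hsq : halfTurn ^ 2 = 1 := by rw [pow_two, halfTurn_mul_self]
  rcases Nat.even_or_odd' n with ⟨k, rfl | rfl⟩
  · rw [pow_mul, hsq, one_pow, mul_one] at h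
    refine le_abs_re_of_rep_eq (w := w) ?_ ?_ hab.1 h.symm
    · rintro rfl
      exact h1 (hab.eq_one (by rw [h, map_one]))
    · rw [hw, (ZMod.natCast_eq_zero_iff_even).2 (even_two_mul k)]
      rfl
  · rw [pow_succ, pow_mul, hsq, one_pow, one_mul] at h
    refine le_abs_re_of_rep_mul_halfTurn_eq ?_ hab.1 h.symm
    rw [hw, (ZMod.natCast_eq_one_iff_odd).2 (odd_two_mul_add_one k)]

end lift

/-! ### The angles of regular polygons -/

theorem unitVec_eq_exp (φ : ℝ) : unitVec φ = Complex.exp (φ * Complex.I) := by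
  apply Complex.ext
  · rw [Complex.exp_ofReal_mul_I_re, unitVec]
  · rw [Complex.exp_ofReal_mul_I_im, unitVec]

theorem unitVec_add (φ ψ : ℝ) : unitVec (φ + ψ) = unitVec φ * unitVec ψ := by
  rw [unitVec_eq_exp, unitVec_eq_exp, unitVec_eq_exp, ← Complex.exp_add, Complex.ofReal_add, add_mul]

theorem conj_unitVec (φ : ℝ) : conj (unitVec φ) = unitVec (-φ) := by
  apply Complex.ext <;> simp [unitVec]

theorem unitVec_zero : unitVec 0 = 1 := by
  apply Complex.ext <;> simp [unitVec]

theorem unitVec_pi : unitVec Real.pi = -1 := by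
  apply Complex.ext <;> simp [unitVec]

theorem unitVec_mul_conj (φ : ℝ) : unitVec φ * conj (unitVec φ) = 1 := by
  rw [conj_unitVec, ← unitVec_add, add_neg_cancel, unitVec_zero]

theorem normSq_unitVec (φ : ℝ) : Complex.normSq (unitVec φ) = 1 := by
  rw [← Complex.ofReal_inj, ← Complex.mul_conj, unitVec_mul_conj, Complex.ofReal_one]

/-- The vertices of the regular `4g`-gon of Euclidean radius `r`. -/
def IsVertexList (g : ℕ) (r : ℝ) (v : ℤ → 𝔻) : Prop :=
  ∀ j : ℤ, (v j : ℂ) = r * unitVec ((j - 1 / 2) * polygonAngle g)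

theorem isRegularPolygon_iff [Fact (2 ≤ g)] {v : ℤ → 𝔻} :
    IsRegularPolygon (4 * g) v ↔ ∃ r : ℝ, 0 < r ∧ IsVertexList g r v := by
  refine exists_congr fun r => and_congr_right fun _ => forall_congr' fun j => ?_
  have hg : (g : ℂ) ≠ 0 := Nat.cast_ne_zero.2 (by have := Fact.out (p := 2 ≤ g); omega)
  rw [unitVec_eq_exp, polygonAngle]
  congr! 3
  push_cast
  field_simp
  ring

theorem IsVertexList.sq_lt_one {r : ℝ} {v : ℤ → 𝔻} (hv : IsVertexList g r v) : r ^ 2 < 1 := by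
  have h := (v 0).normSq_lt_one
  rw [hv, map_mul, normSq_unitVec, mul_one, Complex.normSq_ofReal, ← pow_two] at h
  exact h

/-- The denominator is made real so that only a positive scalar is left over, which does not affect
angles. -/
theorem direction_eq {r φ ψ : ℝ} {p q : 𝔻} (hr : r ^ 2 < 1) (hp : (p : ℂ) = r * unitVec φ)
    (hq : (q : ℂ) = r * unitVec (φ + ψ)) :
    direction p q = (r / Complex.normSq (1 - (r : ℂ) ^ 2 * unitVec ψ)) •
      (unitVec φ * ((unitVec ψ - 1) * conj (1 - (r : ℂ) ^ 2 * unitVec ψ))) := by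
  have h1 : 1 - (r : ℂ) ^ 2 * unitVec ψ ≠ 0 := by
    intro h
    have h2 := congrArg Complex.normSq (sub_eq_zero.1 h)
    rw [map_mul, normSq_unitVec, map_pow, Complex.normSq_ofReal, map_one, mul_one] at h2
    nlinarith
  have h2 : 1 - conj (p : ℂ) * q = 1 - (r : ℂ) ^ 2 * unitVec ψ := by
    rw [hp, hq, unitVec_add, map_mul, Complex.conj_ofReal]
    linear_combination -(r : ℂ) ^ 2 * unitVec ψ * unitVec_mul_conj φ
  rw [direction, h2, Complex.real_smul, Complex.ofReal_div, ← Complex.mul_conj, hp, hq, unitVec_add]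
  have h3 := (map_ne_zero (starRingEnd ℂ)).2 h1
  generalize conj (1 - (r : ℂ) ^ 2 * unitVec ψ) = D' at *
  generalize 1 - (r : ℂ) ^ 2 * unitVec ψ = D at *
  field_simp

/-- The cosine of the angle between conj z and z is Re(z²)/|z|², and the unit factor ω is a
rotation. -/
theorem angle_conj_self (ω z : ℂ) (hω : Complex.normSq ω = 1) :
    InnerProductGeometry.angle (ω * conj z) (ω * z)
      = Real.arccos ((z.re ^ 2 - z.im ^ 2) / (z.re ^ 2 + z.im ^ 2)) := by
  have h1 : ‖ω‖ = 1 := by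
    rw [Complex.normSq_eq_norm_sq] at hω
    exact (pow_eq_one_iff_of_nonneg (norm_nonneg ω) two_ne_zero).1 hω
  have h2 : conj ω * ω = 1 := by rw [← Complex.normSq_eq_conj_mul_self, hω, Complex.ofReal_one]
  rw [InnerProductGeometry.angle, Complex.inner, norm_mul, norm_mul, Complex.norm_conj, h1, one_mul,
    ← pow_two, ← Complex.normSq_eq_norm_sq, Complex.normSq_apply, map_mul, Complex.conj_conj]
  congr 2
  · rw [show ω * z * (conj ω * z) = z * z by linear_combination z * z * h2, Complex.mul_re]
    ring
  · ring

/-- The interior angle of a regular polygon in terms of its Euclidean radius. -/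
theorem IsVertexList.interiorAngle_eq [Fact (2 ≤ g)] {r : ℝ} {v : ℤ → 𝔻} (hr : 0 < r)
    (hv : IsVertexList g r v) (j : ℤ) :
    interiorAngle v j = Real.arccos
      (((1 - Real.cos (polygonAngle g)) * (1 + r ^ 2) ^ 2
          - (1 + Real.cos (polygonAngle g)) * (1 - r ^ 2) ^ 2) /
        ((1 - Real.cos (polygonAngle g)) * (1 + r ^ 2) ^ 2
          + (1 + Real.cos (polygonAngle g)) * (1 - r ^ 2) ^ 2)) := by
  set θ := polygonAngle g with hθ
  have hc : Real.cos θ < 1 := cos_polygonAngle_lt_one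
  have hr1 := hv.sq_lt_one
  have h1 := direction_eq (φ := (j - 1 / 2) * θ) (ψ := θ) (q := v (j + 1)) hr1 (hv j)
    (by rw [hv]; congr 2; push_cast; ring)
  have h2 := direction_eq (φ := (j - 1 / 2) * θ) (ψ := -θ) (q := v (j - 1)) hr1 (hv j)
    (by rw [hv]; congr 2; push_cast; ring)
  have h3 : 1 - (r : ℂ) ^ 2 * unitVec (-θ) = conj (1 - (r : ℂ) ^ 2 * unitVec θ) := by
    rw [← conj_unitVec]
    simp
  have h4 : unitVec (-θ) - 1 = conj (unitVec θ - 1) := by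
    rw [← conj_unitVec, map_sub, map_one]
  rw [h3, h4, Complex.normSq_conj, ← map_mul] at h2
  have hD : 0 < Complex.normSq (1 - (r : ℂ) ^ 2 * unitVec θ) := by
    refine Complex.normSq_pos.2 fun h => ?_
    have h2 := congrArg Complex.normSq (sub_eq_zero.1 h)
    rw [map_mul, normSq_unitVec, map_pow, Complex.normSq_ofReal, map_one, mul_one] at h2
    nlinarith
  have hk := div_pos hr hD
  rw [interiorAngle, hypAngle, h1, h2, InnerProductGeometry.angle_smul_left_of_pos _ _ hk,
    InnerProductGeometry.angle_smul_right_of_pos _ _ hk, angle_conj_self _ _ (normSq_unitVec _)]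
  have h5 := Real.sin_sq_add_cos_sq θ
  have hre : ((unitVec θ - 1) * conj (1 - (r : ℂ) ^ 2 * unitVec θ)).re
      = -((1 - Real.cos θ) * (1 + r ^ 2)) := by
    rw [← Complex.ofReal_pow]
    generalize r ^ 2 = ρ
    simp [unitVec, Complex.mul_re]
    linear_combination -ρ * h5
  have him : ((unitVec θ - 1) * conj (1 - (r : ℂ) ^ 2 * unitVec θ)).im
      = Real.sin θ * (1 - r ^ 2) := by
    rw [← Complex.ofReal_pow]
    generalize r ^ 2 = ρ
    simp [unitVec, Complex.mul_im]
    ring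
  rw [hre, him]
  have h6 : Real.sin θ ^ 2 = (1 - Real.cos θ) * (1 + Real.cos θ) := by linear_combination h5
  have h7 : 1 - Real.cos θ ≠ 0 := by linarith
  rw [mul_pow, h6, show (-((1 - Real.cos θ) * (1 + r ^ 2))) ^ 2
      = (1 - Real.cos θ) * ((1 - Real.cos θ) * (1 + r ^ 2) ^ 2) by ring, mul_assoc, ← mul_sub,
    ← mul_add, mul_div_mul_left _ _ h7]

theorem sum_interiorAngle_eq_iff [Fact (2 ≤ g)] {r : ℝ} {v : ℤ → 𝔻} (hr : 0 < r)
    (hv : IsVertexList g r v) :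
    ∑ j ∈ Finset.range (4 * g), interiorAngle v j = 2 * Real.pi ↔
      r ^ 2 = Real.cos (polygonAngle g) := by
  have hc1 : Real.cos (polygonAngle g) < 1 := cos_polygonAngle_lt_one
  have hc0 : 0 < Real.cos (polygonAngle g) := cos_polygonAngle_pos
  have hr1 := hv.sq_lt_one
  have hg : (0 : ℝ) < 4 * g := by
    have : 0 < g := by have := Fact.out (p := 2 ≤ g); omega
    positivity
  rw [Finset.sum_congr rfl (fun (j : ℕ) _ => hv.interiorAngle_eq hr j), Finset.sum_const, Finset.card_range,
    nsmul_eq_mul, ← mul_polygonAngle (g := g), Nat.cast_mul, Nat.cast_ofNat, mul_right_inj' hg.ne']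
  set θ := polygonAngle g with hθ
  set c := Real.cos θ with hcdef
  have hP : 0 < (1 - c) * (1 + r ^ 2) ^ 2 := mul_pos (by linarith) (by positivity)
  have hQ : 0 < (1 + c) * (1 - r ^ 2) ^ 2 := mul_pos (by linarith) (pow_pos (by linarith) 2)
  have hθ0 : 0 ≤ θ := polygonAngle_pos.le
  have hθπ : θ ≤ Real.pi := (polygonAngle_le (g := g)).trans (by linarith [Real.pi_pos])
  constructor
  · intro h
    have h1 := congrArg Real.cos h
    rw [Real.cos_arccos, ← hcdef, div_eq_iff (by positivity)] at h1
    · have h2 : ((1 - c) * (1 + r ^ 2)) ^ 2 = ((1 + c) * (1 - r ^ 2)) ^ 2 := by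
        linear_combination h1
      have h3 : (1 - c) * (1 + r ^ 2) = (1 + c) * (1 - r ^ 2) :=
        (pow_left_inj₀ (mul_nonneg (by linarith) (by positivity))
          (mul_nonneg (by linarith) (by linarith)) two_ne_zero).1 h2
      linarith
    · rw [le_div_iff₀ (by positivity)]
      linarith
    · rw [div_le_iff₀ (by positivity)]
      linarith
  · intro h
    rw [h] at hP hQ ⊢
    rw [← Real.arccos_cos hθ0 hθπ, ← hcdef]
    congr 1
    rw [div_eq_iff (by positivity)]
    ring

theorem isBolzaPolygon_iff [Fact (2 ≤ g)] {v : ℤ → 𝔻} :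
    IsBolzaPolygon g v ↔ IsVertexList g √(Real.cos (polygonAngle g)) v := by
  have hc0 : 0 < Real.cos (polygonAngle g) := cos_polygonAngle_pos
  rw [IsBolzaPolygon, isRegularPolygon_iff]
  constructor
  · rintro ⟨⟨r, hr, hv⟩, h⟩
    rw [sum_interiorAngle_eq_iff hr hv] at h
    rwa [← h, Real.sqrt_sq hr.le]
  · intro hv
    have hr := Real.sqrt_pos.2 hc0
    exact ⟨⟨_, hr, hv⟩, (sum_interiorAngle_eq_iff hr hv).2 (Real.sq_sqrt hc0.le)⟩

theorem exists_isBolzaPolygon (g : ℕ) [Fact (2 ≤ g)] : ∃ v, IsBolzaPolygon g v := by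
  refine ⟨fun j => Complex.UnitDisc.mk
    (√(Real.cos (polygonAngle g)) * unitVec ((j - 1 / 2) * polygonAngle g)) ?_,
    isBolzaPolygon_iff.2 fun j => rfl⟩
  refine (sq_lt_one_iff₀ (norm_nonneg _)).1 ?_
  rw [← Complex.normSq_eq_norm_sq, map_mul, normSq_unitVec, mul_one, Complex.normSq_ofReal,
    Real.mul_self_sqrt cos_polygonAngle_pos.le]
  exact cos_polygonAngle_lt_one

/-! ### The side pairings -/

theorem sq_cos_half_polygonAngle :
    2 * Real.cos (polygonAngle g / 2) ^ 2 = 1 + Real.cos (polygonAngle g) := by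
  rw [Real.cos_sq, mul_div_cancel₀ _ two_ne_zero]
  ring

theorem unitVec_half_add : unitVec (polygonAngle g / 2) + conj (unitVec (polygonAngle g / 2))
    = (2 * Real.cos (polygonAngle g / 2) : ℝ) := Complex.add_conj _

theorem unitVec_half_sub : unitVec (polygonAngle g / 2) - conj (unitVec (polygonAngle g / 2))
    = (2 * Real.sin (polygonAngle g / 2) : ℝ) * Complex.I := Complex.sub_conj _

theorem IsVertexList.apply_eq {r : ℝ} {v : ℤ → 𝔻} (hv : IsVertexList g r v) (j : ℤ) :
    (v j : ℂ) = r * (unitVec (j * polygonAngle g) * conj (unitVec (polygonAngle g / 2))) := by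
  rw [hv, conj_unitVec, ← unitVec_add]
  congr 2
  ring

theorem IsVertexList.apply_add_one {r : ℝ} {v : ℤ → 𝔻} (hv : IsVertexList g r v) (j : ℤ) :
    (v (j + 1) : ℂ) = r * (unitVec (j * polygonAngle g) * unitVec (polygonAngle g / 2)) := by
  rw [hv, ← unitVec_add]
  congr 2
  push_cast
  ring

theorem sq_sin_half_polygonAngle :
    2 * Real.sin (polygonAngle g / 2) ^ 2 = 1 - Real.cos (polygonAngle g) := by
  linear_combination 2 * Real.sin_sq_add_cos_sq (polygonAngle g / 2)
    - sq_cos_half_polygonAngle (g := g)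

/-- The hyperbolic cosine of the distance from the center to a side. -/
def pairingCosh (g : ℕ) : ℝ := Real.cos (polygonAngle g / 2) / Real.sin (polygonAngle g / 2)

/-- The hyperbolic sine of the distance from the center to a side. -/
def pairingSinh (g : ℕ) : ℝ := √(Real.cos (polygonAngle g)) / Real.sin (polygonAngle g / 2)

theorem pairingSinh_mul_one_add_cos :
    pairingSinh g * (1 + Real.cos (polygonAngle g))
      = 2 * √(Real.cos (polygonAngle g)) * pairingCosh g * Real.cos (polygonAngle g / 2) := by
  rw [← sq_cos_half_polygonAngle, pairingSinh, pairingCosh]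
  ring

/-- Both vertices of a side are covered: exchanging h and h' exchanges them. -/
theorem pairing_vertex {C S σ ω ω' h h' y c : ℂ} (hω : ω * ω' = 1) (hh : h * h' = 1)
    (hadd : h + h' = 2 * y) (hc : σ * σ = c) (hS : S * (1 + c) = 2 * σ * C * y) :
    C * -(σ * (ω * h')) + S * ω = σ * (ω * h) * (S * ω' * -(σ * (ω * h')) + C) := by
  linear_combination ω * hS - σ * C * ω * hadd + S * σ ^ 2 * ω * h * h' * hω + S * σ ^ 2 * ω * hh
    + S * ω * hc

section sidePairing

variable [Fact (2 ≤ g)]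

theorem pairingCosh_mul_sin :
    pairingCosh g * Real.sin (polygonAngle g / 2) = Real.cos (polygonAngle g / 2) :=
  div_mul_cancel₀ _ sin_half_polygonAngle_pos.ne'

theorem pairingSinh_mul_sin :
    pairingSinh g * Real.sin (polygonAngle g / 2) = √(Real.cos (polygonAngle g)) :=
  div_mul_cancel₀ _ sin_half_polygonAngle_pos.ne'

theorem sq_pairingCosh_sub_sq_pairingSinh : pairingCosh g ^ 2 - pairingSinh g ^ 2 = 1 := by
  have hx := sin_half_polygonAngle_pos (g := g)
  rw [pairingCosh, pairingSinh, div_pow, div_pow, Real.sq_sqrt cos_polygonAngle_pos.le, ← sub_div,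
    div_eq_one_iff_eq (by positivity)]
  linear_combination sq_cos_half_polygonAngle (g := g)
    - Real.sin_sq_add_cos_sq (polygonAngle g / 2)

theorem normSq_pairing (φ : ℝ) : Complex.normSq (pairingCosh g)
    - Complex.normSq (pairingSinh g * unitVec φ) = 1 := by
  rw [map_mul, normSq_unitVec, mul_one, Complex.normSq_ofReal, Complex.normSq_ofReal, ← pow_two,
    ← pow_two, sq_pairingCosh_sub_sq_pairingSinh]

/-- The transformation that maps the side `j + 2g` of the polygon to the side `j`. -/
def sidePairing (g : ℕ) [Fact (2 ≤ g)] (j : ℤ) : 𝔻 ≃ᵢ 𝔻 :=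
  mobiusIsometry (pairingCosh g) (pairingSinh g * unitVec (j * polygonAngle g)) (normSq_pairing _)

theorem IsVertexList.apply_add_two_mul {r : ℝ} {v : ℤ → 𝔻} (hv : IsVertexList g r v) (j : ℤ) :
    (v (j + 2 * g) : ℂ) = -v j := by
  rw [hv, hv, ← mul_neg, ← mul_neg_one (unitVec _), ← unitVec_pi, ← unitVec_add]
  congr 2
  push_cast
  linear_combination mul_polygonAngle (g := g) / 2

theorem isSidePairing_sidePairing {v : ℤ → 𝔻} (hv : IsBolzaPolygon g v) (j : ℤ) :
    IsSidePairing g v j (sidePairing g j) := by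
  rw [isBolzaPolygon_iff] at hv
  have hM := hasMatrix_mobiusIsometry (pairingCosh g)
    (pairingSinh g * unitVec (j * polygonAngle g)) (normSq_pairing _)
  have hω := unitVec_mul_conj (j * polygonAngle g)
  have hh := unitVec_mul_conj (polygonAngle g / 2)
  have hadd := unitVec_half_add (g := g)
  have hS := congrArg (Complex.ofReal) (pairingSinh_mul_one_add_cos (g := g))
  have hc := congrArg (Complex.ofReal) (Real.mul_self_sqrt (cos_polygonAngle_pos (g := g)).le)
  push_cast at hS hc hadd
  refine ⟨hM.orientationPreserving, ?_, ?_⟩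
  · refine Complex.UnitDisc.coe_injective ((hM.2 _).trans ?_)
    rw [div_eq_iff (denom_ne_zero hM.1 _), hv.apply_add_two_mul, hv.apply_eq, hv.apply_add_one,
      map_mul, Complex.conj_ofReal, Complex.conj_ofReal]
    exact pairing_vertex hω hh hadd hc hS
  · refine Complex.UnitDisc.coe_injective ((hM.2 _).trans ?_)
    rw [div_eq_iff (denom_ne_zero hM.1 _), show j + 2 * (g : ℤ) + 1 = j + 1 + 2 * g by ring,
      hv.apply_add_two_mul, hv.apply_eq j, hv.apply_add_one,
      map_mul, Complex.conj_ofReal, Complex.conj_ofReal]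
    exact pairing_vertex hω ((mul_comm _ _).trans hh) ((add_comm _ _).trans hadd) hc hS

theorem sidePairing_mem (j : ℤ) : sidePairing g j ∈ bolzaGroup g :=
  let ⟨v, hv⟩ := exists_isBolzaPolygon g
  Subgroup.subset_closure ⟨v, hv, j, isSidePairing_sidePairing hv j⟩

/-- The generators are specified only by their effect on two vertices, so their matrices have to be
recovered from it. A real common factor of the coefficients is harmless, because it cancels in the
fraction. -/
theorem IsSidePairing.eq_sidePairing {v : ℤ → 𝔻} (hv : IsBolzaPolygon g v) {j : ℤ} {f : 𝔻 ≃ᵢ 𝔻}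
    (hf : IsSidePairing g v j f) : f = sidePairing g j := by
  rw [isBolzaPolygon_iff] at hv
  obtain ⟨hf, h1, h2⟩ := hf
  obtain ⟨a, b, hab⟩ := hf.exists_hasMatrix
  have hω := unitVec_mul_conj (j * polygonAngle g)
  have hh := unitVec_mul_conj (polygonAngle g / 2)
  have hadd := unitVec_half_add (g := g)
  have hsub := unitVec_half_sub (g := g)
  have hc := congrArg (Complex.ofReal) (Real.mul_self_sqrt (cos_polygonAngle_pos (g := g)).le)
  have hσ : (√(Real.cos (polygonAngle g)) : ℂ) ≠ 0 :=
    Complex.ofReal_ne_zero.2 (Real.sqrt_pos.2 cos_polygonAngle_pos).ne'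
  have hx : (Real.sin (polygonAngle g / 2) : ℂ) ≠ 0 :=
    Complex.ofReal_ne_zero.2 sin_half_polygonAngle_pos.ne'
  have hC : pairingCosh g ≠ 0 := (div_pos cos_half_polygonAngle_pos sin_half_polygonAngle_pos).ne'
  have hS := pairingSinh_mul_one_add_cos (g := g)
  have hCS := sq_pairingCosh_sub_sq_pairingSinh (g := g)
  have hdet := hab.1
  have e1 := congrArg (fun z : 𝔻 => (z : ℂ)) h1
  have e2 := congrArg (fun z : 𝔻 => (z : ℂ)) h2
  simp only [hab.2] at e1 e2
  rw [div_eq_iff (denom_ne_zero hab.1 _), hv.apply_add_two_mul, hv.apply_eq, hv.apply_add_one] at e1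
  rw [div_eq_iff (denom_ne_zero hab.1 _), show j + 2 * (g : ℤ) + 1 = j + 1 + 2 * g by ring,
      hv.apply_add_two_mul, hv.apply_eq j, hv.apply_add_one] at e2
  suffices hs : ∃ ε : ℝ, ε ≠ 0 ∧ a = ε * pairingCosh g ∧
      b = ε * (pairingSinh g * unitVec (j * polygonAngle g)) by
    obtain ⟨ε, hε, rfl, rfl⟩ := hs
    refine IsometryEquiv.ext fun z => Complex.UnitDisc.coe_injective ?_
    rw [hab.2, sidePairing, (hasMatrix_mobiusIsometry _ _ _).2, map_mul, map_mul (starRingEnd ℂ) (ε : ℂ),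
      Complex.conj_ofReal, mul_assoc, mul_assoc, ← mul_add, ← mul_add, mul_div_mul_left]
    exact Complex.ofReal_ne_zero.2 hε
  have hω1 := normSq_unitVec (j * polygonAngle g)
  generalize hωdef : unitVec (j * polygonAngle g) = ω at *
  -- Removing the direction ω of the side reduces to a side with its midpoint on the real axis,
  -- where a and β turn out to be real.
  obtain ⟨β, rfl⟩ : ∃ β, b = ω * β := ⟨conj ω * b, by linear_combination -b * hω⟩
  rw [map_mul] at e1 e2
  rw [map_mul, hω1, one_mul] at hdet
  have hω0 : ω ≠ 0 := left_ne_zero_of_mul (hω.trans_ne one_ne_zero)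
  have hc0 := cos_polygonAngle_pos (g := g)
  have hc1 := cos_polygonAngle_lt_one (g := g)
  generalize unitVec (polygonAngle g / 2) = h at *
  generalize √(Real.cos (polygonAngle g)) = σ at *
  generalize Real.cos (polygonAngle g) = c at *
  push_cast at hc
  have e3 : β + c * conj β = σ * (a * conj h + conj a * h) := by
    refine mul_left_cancel₀ hω0 ?_
    linear_combination e1 - σ ^ 2 * ω * conj β * h * conj h * hω - σ ^ 2 * ω * conj β * hh
      - ω * conj β * hc
  have e4 : β + c * conj β = σ * (a * h + conj a * conj h) := by
    refine mul_left_cancel₀ hω0 ?_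
    linear_combination e2 - σ ^ 2 * ω * conj β * h * conj h * hω - σ ^ 2 * ω * conj β * hh
      - ω * conj β * hc
  have hsub0 : h - conj h ≠ 0 := by
    rw [hsub, Complex.ofReal_mul, Complex.ofReal_ofNat]
    exact mul_ne_zero (mul_ne_zero two_ne_zero hx) Complex.I_ne_zero
  have ha : conj a = a := by
    -- The difference of the two vertex equations shows that a is real.
    have h0 : (σ * (h - conj h)) * (conj a - a) = 0 := by linear_combination e4 - e3
    exact sub_eq_zero.1 ((mul_eq_zero.1 h0).resolve_left (mul_ne_zero hσ hsub0))
  obtain ⟨a, rfl⟩ := Complex.conj_eq_iff_real.1 ha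
  rw [Complex.conj_ofReal, ← mul_add, add_comm (conj h), hadd] at e3
  have hre := congrArg Complex.re e3
  have him := congrArg Complex.im e3
  rw [← Complex.ofReal_mul, ← Complex.ofReal_mul] at hre him
  simp only [Complex.add_re, Complex.add_im, Complex.re_ofReal_mul, Complex.im_ofReal_mul,
    Complex.conj_re, Complex.conj_im, Complex.ofReal_re, Complex.ofReal_im] at hre him
  have hβ : β.im = 0 := by
    have h0 : (1 - c) * β.im = 0 := by linear_combination him
    exact (mul_eq_zero.1 h0).resolve_left (by linarith)
  rw [Complex.normSq_apply, Complex.normSq_apply, hβ, Complex.ofReal_re, Complex.ofReal_im] at hdet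
  have hβC : β.re * pairingCosh g = a * pairingSinh g := by
    refine mul_left_cancel₀ (by linarith : 1 + c ≠ 0) ?_
    linear_combination pairingCosh g * hre - a * hS
  have ha2 : a ^ 2 = pairingCosh g ^ 2 := by
    linear_combination pairingCosh g ^ 2 * hdet + (β.re * pairingCosh g + a * pairingSinh g) * hβC
      - a ^ 2 * hCS
  have ha0 : a ≠ 0 := by
    rintro rfl
    exact pow_ne_zero 2 hC (by rw [← ha2]; ring)
  refine ⟨a / pairingCosh g, div_ne_zero ha0 hC, ?_, ?_⟩
  · rw [← Complex.ofReal_mul, div_mul_cancel₀ _ hC]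
  · have h0 : β = (a / pairingCosh g * pairingSinh g : ℝ) := by
      apply Complex.ext
      · rw [Complex.ofReal_re, div_mul_eq_mul_div, ← hβC, mul_div_cancel_right₀ _ hC]
      · rw [Complex.ofReal_im, hβ]
    rw [h0]
    push_cast
    ring

/-- The sides j - 1 and j of the right-angled polygon meet perpendicularly at the midpoint of the
side j of D_g. Their reflections compose to the half turn there, and together with the half turn
about the origin they give the translation by twice the distance between the two centres. -/
theorem isRepresented_sidePairing (j : ℤ) :
    IsRepresented g (sidePairing g j) (gen ((j - 1 : ℤ) : ZMod (4 * g)) * gen (j : ZMod (4 * g))) 1 := by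
  refine ⟨?_, _, _, hasMatrix_mobiusIsometry _ _ _, ?_⟩
  · rw [map_mul, typeParity_gen, typeParity_gen, ← ofAdd_add, Prod.mk_add_mk, map_intCast,
      map_intCast, Nat.cast_one]
    push_cast
    congr 2
    · linear_combination CharTwo.add_self_eq_zero (j : ZMod 2)
    · linear_combination CharTwo.add_self_eq_zero ((j : ZMod 2) - 1)
  · rw [pow_one, map_mul, rep_gen, rep_gen,
      lorentzReflection_eq_mobius_mul_conjMap (root_self _),
      lorentzReflection_eq_mobius_mul_conjMap (root_self _), root_intCast, root_intCast, mul_assoc,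
      mul_assoc, ← mul_assoc conjMap, ← mul_assoc conjMap, conjMap_mul_mobius, mul_assoc (mobius _ _),
      conjMap_mul_self, mul_one, halfTurn, mobius_mul, mobius_mul]
    have h1 : unitVec (((j - 1 : ℤ) + 1 / 2) * polygonAngle g)
      = unitVec (j * polygonAngle g) * conj (unitVec (polygonAngle g / 2)) := by
      rw [conj_unitVec, ← unitVec_add]
      congr 1
      push_cast
      ring
    have h2 : unitVec ((j + 1 / 2) * polygonAngle g)
      = unitVec (j * polygonAngle g) * unitVec (polygonAngle g / 2) := by
      rw [← unitVec_add]
      congr 1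
      ring
    have hd : (((√(1 - Real.cos (polygonAngle g)))⁻¹ ^ 2
        * (2 * Real.sin (polygonAngle g / 2) ^ 2) : ℝ) : ℂ) = 1 := by
      rw [sq_sin_half_polygonAngle, inv_pow, Real.sq_sqrt, inv_mul_cancel₀, Complex.ofReal_one] <;>
      linarith [cos_polygonAngle_lt_one (g := g)]
    have hc := congrArg (Complex.ofReal) (Real.mul_self_sqrt (cos_polygonAngle_pos (g := g)).le)
    have hω := unitVec_mul_conj (j * polygonAngle g)
    have hh := unitVec_mul_conj (polygonAngle g / 2)
    have hadd := unitVec_half_add (g := g)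
    have hsub := unitVec_half_sub (g := g)
    have hC := congrArg (Complex.ofReal) (pairingCosh_mul_sin (g := g))
    have hS := congrArg (Complex.ofReal) (pairingSinh_mul_sin (g := g))
    have hcx := congrArg (Complex.ofReal) (sq_sin_half_polygonAngle (g := g))
    simp only [Complex.ofReal_mul, Complex.ofReal_pow, Complex.ofReal_sub, Complex.ofReal_one,
      Complex.ofReal_ofNat] at hc hC hS hd hadd hsub hcx
    simp only [intRoot, Prod.smul_fst, Prod.smul_snd, h1, h2, Complex.real_smul, smul_eq_mul,
      Complex.ofReal_mul, Complex.ofReal_neg, Complex.conj_ofReal, map_mul, map_neg, Complex.conj_I,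
      Complex.conj_conj, map_zero, mul_zero, zero_add, add_zero]
    generalize unitVec (j * polygonAngle g) = ω at *
    generalize unitVec (polygonAngle g / 2) = h at *
    generalize (((√(1 - Real.cos (polygonAngle g)))⁻¹ : ℝ) : ℂ) = d at *
    generalize (√(Real.cos (polygonAngle g)) : ℂ) = σ at *
    generalize (Real.cos (polygonAngle g) : ℂ) = c at *
    generalize (Real.sin (polygonAngle g / 2) : ℂ) = x at *
    generalize (Real.cos (polygonAngle g / 2) : ℂ) = y at *
    have hI := Complex.I_mul_I
    have hsq : conj h ^ 2 - c = -2 * Complex.I * x * y := by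
      linear_combination hh - conj h * hsub - hcx - x * Complex.I * (hadd - hsub) + 2 * x ^ 2 * hI
    congr 1
    · linear_combination -pairingCosh g * hd + 2 * d ^ 2 * x * hC
        + Complex.I ^ 3 * d ^ 2 * (conj h ^ 2 * hω + hsq - hc)
        - 2 * d ^ 2 * x * y * (Complex.I ^ 2 - 1) * hI
    · linear_combination -Complex.I ^ 3 * d ^ 2 * σ * ω * hsub
        - 2 * d ^ 2 * x * σ * ω * (Complex.I ^ 2 - 1) * hI
        + ω * (-pairingSinh g * hd + 2 * d ^ 2 * x * hS)

theorem exists_isRepresented {f : 𝔻 ≃ᵢ 𝔻} (hf : f ∈ bolzaGroup g) :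
    ∃ w n, IsRepresented g f w n := by
  induction hf using Subgroup.closure_induction with
  | mem f hf =>
    obtain ⟨v, hv, j, hf⟩ := hf
    exact ⟨_, _, hf.eq_sidePairing hv ▸ isRepresented_sidePairing j⟩
  | one => exact ⟨_, _, isRepresented_one⟩
  | mul f f' _ _ h h' =>
    obtain ⟨w, n, h⟩ := h
    obtain ⟨w', n', h'⟩ := h'
    exact ⟨_, _, h.mul h'⟩
  | inv f _ h =>
    obtain ⟨w, n, h⟩ := h
    exact ⟨_, _, h.inv⟩

theorem le_dist_of_mem {f : 𝔻 ≃ᵢ 𝔻} (hf : f ∈ bolzaGroup g) (h1 : f ≠ 1) (z : 𝔻) :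
    2 * Real.arcosh (1 + 2 * Real.cos (polygonAngle g)) ≤ dist z (f z) := by
  obtain ⟨w, n, h⟩ := exists_isRepresented hf
  obtain ⟨a, b, hab, h⟩ := h.exists_hasMatrix h1
  exact hab.le_dist (by linarith [cos_polygonAngle_pos (g := g)]) h z

end sidePairing

/-! ### An element with the minimal translation length -/

/-- The geodesic along the imaginary axis, parametrized by arc length. -/
def verticalLine (t : ℝ) : 𝔻 :=
  Complex.UnitDisc.mk (Real.tanh (t / 2) * Complex.I) (by
    rw [norm_mul, Complex.norm_I, mul_one, Complex.norm_real]
    exact Real.abs_tanh_lt_one _)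

theorem coe_verticalLine (t : ℝ) : (verticalLine t : ℂ) = Real.tanh (t / 2) * Complex.I := rfl

theorem one_sub_tanh_sq (t : ℝ) : 1 - Real.tanh t ^ 2 = (Real.cosh t ^ 2)⁻¹ := by
  have h := Real.cosh_pos t
  rw [Real.tanh_eq_sinh_div_cosh, div_pow]
  field_simp
  linear_combination Real.cosh_sq t

theorem isometry_verticalLine : Isometry verticalLine := by
  refine Isometry.of_dist_eq fun s t => ?_
  have hs := Real.cosh_pos (s / 2)
  have ht := Real.cosh_pos (t / 2)
  have h1 : ‖(verticalLine s : ℂ) - verticalLine t‖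
      = |Real.sinh ((s - t) / 2)| * (Real.cosh (s / 2) * Real.cosh (t / 2))⁻¹ := by
    rw [coe_verticalLine, coe_verticalLine, ← sub_mul, norm_mul, Complex.norm_I, mul_one,
      ← Complex.ofReal_sub, Complex.norm_real, Real.norm_eq_abs,
      ← abs_of_pos (a := (Real.cosh (s / 2) * Real.cosh (t / 2))⁻¹) (by positivity), ← abs_mul,
      sub_div, Real.sinh_sub, Real.tanh_eq_sinh_div_cosh, Real.tanh_eq_sinh_div_cosh]
    congr 1
    field_simp
  have h2 : ∀ u : ℝ, 1 - ‖(verticalLine u : ℂ)‖ ^ 2 = (Real.cosh (u / 2) ^ 2)⁻¹ := by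
    intro u
    rw [coe_verticalLine, norm_mul, Complex.norm_I, mul_one, Complex.norm_real, Real.norm_eq_abs,
      sq_abs, one_sub_tanh_sq]
  rw [dist_eq, h1, h2, h2, ← mul_inv, ← mul_pow, ← inv_pow, Real.sqrt_sq (by positivity),
    mul_div_cancel_right₀ _ (by positivity), Real.dist_eq]
  have h3 : |Real.sinh ((s - t) / 2)| = Real.sinh (|s - t| / 2) := by
    rw [Real.abs_sinh, abs_div, abs_two]
  rw [h3, Real.arsinh_sinh, mul_div_cancel₀ _ two_ne_zero]

theorem normSq_translation (ℓ : ℝ) : Complex.normSq (Real.cosh (ℓ / 2))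
    - Complex.normSq (Real.sinh (ℓ / 2) * Complex.I) = 1 := by
  rw [map_mul, Complex.normSq_I, mul_one, Complex.normSq_ofReal, Complex.normSq_ofReal]
  linear_combination Real.cosh_sq (ℓ / 2)

theorem mobiusIsometry_verticalLine (ℓ t : ℝ) :
    mobiusIsometry _ _ (normSq_translation ℓ) (verticalLine t) = verticalLine (t + ℓ) := by
  refine Complex.UnitDisc.coe_injective ?_
  have hM := hasMatrix_mobiusIsometry _ _ (normSq_translation ℓ)
  have ht := Real.cosh_pos (t / 2)
  have htℓ := Real.cosh_pos ((t + ℓ) / 2)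
  rw [hM.2, div_eq_iff (denom_ne_zero hM.1 _), coe_verticalLine, coe_verticalLine,
    Real.tanh_eq_sinh_div_cosh, Real.tanh_eq_sinh_div_cosh]
  rw [add_div, Real.cosh_add] at *
  rw [Real.sinh_add]
  simp only [map_mul, Complex.conj_ofReal, Complex.conj_I]
  have h1 : (Real.cosh (t / 2) : ℂ) ≠ 0 := Complex.ofReal_ne_zero.2 ht.ne'
  have h2 : (Real.cosh (t / 2) * Real.cosh (ℓ / 2) + Real.sinh (t / 2) * Real.sinh (ℓ / 2) : ℂ) ≠ 0
    := by exact_mod_cast htℓ.ne'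
  simp only [Complex.ofReal_div, Complex.ofReal_add, Complex.ofReal_mul]
  clear hM
  generalize (Real.cosh (t / 2) : ℂ) = c₁ at *
  generalize (Real.cosh (ℓ / 2) : ℂ) = c₂ at *
  generalize (Real.sinh (t / 2) : ℂ) = s₁ at *
  generalize (Real.sinh (ℓ / 2) : ℂ) = s₂ at *
  have h3 : s₂ * -Complex.I * (s₁ / c₁ * Complex.I) + c₂ = (c₁ * c₂ + s₁ * s₂) / c₁ := by
    field_simp
    linear_combination -s₁ * s₂ * Complex.I_mul_I
  rw [h3]
  generalize c₁ * c₂ + s₁ * s₂ = D at *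
  field_simp

theorem exists_axis {f : 𝔻 ≃ᵢ 𝔻} {ℓ : ℝ} {k : 𝔻 ≃ᵢ 𝔻}
    (h : f * k = k * mobiusIsometry _ _ (normSq_translation ℓ)) :
    ∃ c : ℝ → 𝔻, Isometry c ∧ ∀ t, f (c t) = c (t + ℓ) := by
  refine ⟨k ∘ verticalLine, k.isometry.comp isometry_verticalLine, fun t => ?_⟩
  rw [Function.comp, Function.comp, ← IsometryEquiv.mul_apply, h, IsometryEquiv.mul_apply,
    mobiusIsometry_verticalLine]

theorem HasMatrix.eq {f f' : 𝔻 ≃ᵢ 𝔻} {a b a' b' : ℂ} (hf : HasMatrix f a b)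
    (hf' : HasMatrix f' a' b') (ha : a = a') (hb : b = b') : f = f' := by
  subst ha hb
  exact IsometryEquiv.ext fun z => Complex.UnitDisc.coe_injective ((hf.2 z).trans (hf'.2 z).symm)

/-- If sinh τ = α/m and cosh τ = β/m, then p = cosh(τ/2) and q = sinh(τ/2); the equations are the
addition formulas. They serve to move the imaginary axis onto the axis of the element below. -/
theorem exists_half_arg {m α β : ℝ} (hm : 0 < m) (hβ : 0 < β) (h : β ^ 2 = m ^ 2 + α ^ 2) :
    ∃ p q : ℝ, p ^ 2 - q ^ 2 = 1 ∧ α * p - β * q = m * q ∧ β * p - α * q = m * p := by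
  have h1 : Real.cosh (Real.arsinh (α / m)) = β / m := by
    refine (pow_left_inj₀ (Real.cosh_pos _).le (div_pos hβ hm).le two_ne_zero).1 ?_
    rw [Real.cosh_sq, Real.sinh_arsinh]
    field_simp
    linarith
  have h2 := Real.sinh_arsinh (α / m)
  rw [← mul_div_cancel₀ (Real.arsinh (α / m)) (two_ne_zero' ℝ), Real.cosh_two_mul,
    eq_div_iff hm.ne'] at h1
  rw [← mul_div_cancel₀ (Real.arsinh (α / m)) (two_ne_zero' ℝ), Real.sinh_two_mul,
    eq_div_iff hm.ne'] at h2
  have h3 := Real.cosh_sq (Real.arsinh (α / m) / 2)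
  generalize Real.cosh (Real.arsinh (α / m) / 2) = p at *
  generalize Real.sinh (Real.arsinh (α / m) / 2) = q at *
  refine ⟨p, q, by linarith, ?_, ?_⟩
  · linear_combination -p * h2 + q * h1 + m * q * h3
  · linear_combination -p * h1 + q * h2 + m * p * h3

/-- The element f_1 f_0⁻¹ is the product of the half turns about two neighbouring vertices of the
right-angled polygon, so it translates along the side joining them by twice its length. -/
theorem exists_mem_axis (g : ℕ) [Fact (2 ≤ g)] :
    ∃ f ∈ bolzaGroup g, ∃ c : ℝ → 𝔻, Isometry c ∧
      ∀ t, f (c t) = c (t + 2 * Real.arcosh (1 + 2 * Real.cos (polygonAngle g))) := by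
  have hc0 := cos_polygonAngle_pos (g := g)
  have hx := sin_half_polygonAngle_pos (g := g)
  have hy := cos_half_polygonAngle_pos (g := g)
  have hc : (√(Real.cos (polygonAngle g))) * √(Real.cos (polygonAngle g))
    = Real.cos (polygonAngle g) := Real.mul_self_sqrt hc0.le
  have hσ := Real.sqrt_pos.2 hc0
  have hC := pairingCosh_mul_sin (g := g)
  have hS := pairingSinh_mul_sin (g := g)
  have hCS := sq_pairingCosh_sub_sq_pairingSinh (g := g)
  have hCpos : 0 < pairingCosh g := div_pos hy hx
  have hcx := sq_sin_half_polygonAngle (g := g)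
  have hcy := sq_cos_half_polygonAngle (g := g)
  have hsub := unitVec_half_sub (g := g)
  have hadd := unitVec_half_add (g := g)
  have hh := unitVec_mul_conj (polygonAngle g / 2)
  have hη := unitVec_mul_conj (polygonAngle g / 4)
  have hη1 := normSq_unitVec (polygonAngle g / 4)
  have hηη : unitVec (polygonAngle g / 2) = unitVec (polygonAngle g / 4) ^ 2 := by
    rw [pow_two, ← unitVec_add]
    congr 1
    ring
  have he : unitVec ((1 : ℤ) * polygonAngle g) = unitVec (polygonAngle g / 2) ^ 2 := by
    rw [pow_two, ← unitVec_add]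
    congr 1
    push_cast
    ring
  have he0 : unitVec ((0 : ℤ) * polygonAngle g) = 1 := by
    rw [Int.cast_zero, zero_mul, unitVec_zero]
  set ℓ := 2 * Real.arcosh (1 + 2 * Real.cos (polygonAngle g)) with hℓ
  have hℓ2 : ℓ / 2 = Real.arcosh (1 + 2 * Real.cos (polygonAngle g)) :=
    mul_div_cancel_left₀ _ two_ne_zero
  have hcosh : Real.cosh (ℓ / 2) = 1 + 2 * Real.cos (polygonAngle g) := by
    rw [hℓ2, Real.cosh_arcosh (by linarith)]
  have hsinh : Real.sinh (ℓ / 2) ^ 2 = 4 * Real.cos (polygonAngle g)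
      * (1 + Real.cos (polygonAngle g)) := by
    rw [Real.sinh_sq, hcosh]
    ring
  have hℓ0 : 0 < ℓ := mul_pos two_pos (Real.arcosh_pos (by linarith))
  have hm : 0 < Real.sinh (ℓ / 2) := Real.sinh_pos_iff.2 (half_pos hℓ0)
  -- Write η for the unit vector at angle θ/4. The element has coefficients K - iα and iβη², of
  -- determinant 1, whence β² = sinh²(ℓ/2) + α². Its axis is the imaginary axis shifted along the
  -- real axis as given by p and q, then rotated by θ/2, which is the map with coefficients pη and
  -- qη.
  obtain ⟨p, q, hpq, h1, h2⟩ := exists_half_arg hm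
    (α := 2 * √(Real.cos (polygonAngle g)) * pairingSinh g * Real.cos (polygonAngle g / 2))
    (β := 2 * √(Real.cos (polygonAngle g)) * pairingCosh g) (by positivity) (by
      rw [hsinh]
      generalize Real.cos (polygonAngle g) = c at *
      generalize √c = σ at *
      generalize Real.cos (polygonAngle g / 2) = y at *
      generalize Real.sin (polygonAngle g / 2) = x at *
      linear_combination 4 * (pairingCosh g ^ 2 - pairingSinh g ^ 2 * y ^ 2) * hc
        + 4 * c * (hCS - pairingSinh g ^ 2 / 2 * (hcx + hcy) + (pairingSinh g * x + σ) * hS + hc))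
  have hk : Complex.normSq (p * unitVec (polygonAngle g / 4))
      - Complex.normSq (q * unitVec (polygonAngle g / 4)) = 1 := by
    rw [map_mul, map_mul, hη1, mul_one, mul_one, Complex.normSq_ofReal, Complex.normSq_ofReal]
    linarith
  have hf := (hasMatrix_mobiusIsometry _ _ (normSq_pairing (g := g) ((1 : ℤ) * polygonAngle g))).mul
    (hasMatrix_mobiusIsometry _ _ (normSq_pairing (g := g) ((0 : ℤ) * polygonAngle g))).inv
  have hI := Complex.I_mul_I
  replace h1 := congrArg Complex.ofReal h1
  replace h2 := congrArg Complex.ofReal h2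
  replace hc := congrArg Complex.ofReal hc
  replace hS := congrArg Complex.ofReal hS
  replace hCS := congrArg Complex.ofReal hCS
  push_cast at h1 h2 hc hS hCS hadd hsub
  have hX : unitVec (polygonAngle g / 2) ^ 2 = 1 - 2 * Complex.sin (polygonAngle g / 2) ^ 2
      + 2 * Complex.sin (polygonAngle g / 2) * Complex.cos (polygonAngle g / 2) * Complex.I := by
    linear_combination unitVec (polygonAngle g / 2) * hsub + hh
      + Complex.sin (polygonAngle g / 2) * Complex.I * (hadd + hsub)
      + 2 * Complex.sin (polygonAngle g / 2) ^ 2 * hI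
  -- `F₁` evaluates the first coefficient of f_1 f_0⁻¹, and `F₂` the second one multiplied by the
  -- conjugate of η.
  have F₁ : (pairingCosh g : ℂ) ^ 2 - pairingSinh g ^ 2 * unitVec (polygonAngle g / 2) ^ 2
      = 1 + 2 * Complex.cos (polygonAngle g) - 2 * √(Real.cos (polygonAngle g)) * pairingSinh g
        * Complex.cos (polygonAngle g / 2) * Complex.I := by
    linear_combination hCS - pairingSinh g ^ 2 * hX
      + 2 * ((pairingSinh g * Complex.sin (polygonAngle g / 2) + √(Real.cos (polygonAngle g))) * hS
        + hc) - 2 * pairingSinh g * Complex.cos (polygonAngle g / 2) * Complex.I * hS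
  have F₂ : (pairingSinh g : ℂ) * pairingCosh g * (unitVec (polygonAngle g / 2) ^ 2 - 1)
      * conj (unitVec (polygonAngle g / 4))
      = 2 * √(Real.cos (polygonAngle g)) * pairingCosh g * Complex.I
        * unitVec (polygonAngle g / 4) := by
    linear_combination pairingSinh g * pairingCosh g * conj (unitVec (polygonAngle g / 4))
        * (unitVec (polygonAngle g / 2) * hsub + hh)
      + pairingSinh g * pairingCosh g * 2 * Complex.sin (polygonAngle g / 2) * Complex.I
        * (conj (unitVec (polygonAngle g / 4)) * hηη + unitVec (polygonAngle g / 4) * hη)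
      + 2 * pairingCosh g * Complex.I * unitVec (polygonAngle g / 4) * hS
  refine ⟨sidePairing g 1 * (sidePairing g 0)⁻¹,
    mul_mem (sidePairing_mem 1) (inv_mem (sidePairing_mem 0)),
    exists_axis (k := mobiusIsometry _ _ hk) ?_⟩
  refine (hf.mul (hasMatrix_mobiusIsometry _ _ hk)).eq
    ((hasMatrix_mobiusIsometry _ _ hk).mul (hasMatrix_mobiusIsometry _ _ (normSq_translation ℓ))) ?_ ?_
  · simp only [map_mul, map_neg, Complex.conj_ofReal, Complex.conj_I, he, he0, map_one, hcosh]
    push_cast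
    linear_combination (p * unitVec (polygonAngle g / 4)) * F₁ + q * F₂
      - Complex.I * unitVec (polygonAngle g / 4) * h1
  · simp only [map_mul, map_neg, Complex.conj_ofReal, he, he0, map_one, hcosh]
    push_cast
    linear_combination (q * unitVec (polygonAngle g / 4)) * F₁ + p * F₂
      + Complex.I * unitVec (polygonAngle g / 4) * h2

end Bolza

end

theorem theorem2 (g : ℕ) (hg : 2 ≤ g) :
    Bolza.IsSystole (Bolza.BolzaSurface g)
        (2 * Real.arcosh (1 + 2 * Real.cos (Real.pi / (2 * g)))) ∧
      IsLeast (Bolza.simpleClosedGeodesicLengths (Bolza.bolzaGroup g))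
        (2 * Real.arcosh (1 + 2 * Real.cos (Real.pi / (2 * g)))) := by
  have : Fact (2 ≤ g) := ⟨hg⟩
  have hc := Bolza.cos_polygonAngle_pos (g := g)
  obtain ⟨f, hf, c, hc', hfc⟩ := Bolza.exists_mem_axis g
  exact Bolza.isSystole_and_isLeast (mul_pos two_pos (Real.arcosh_pos (lt_add_of_pos_right 1 (mul_pos two_pos hc))))
    (fun f hf h1 z => Bolza.le_dist_of_mem hf h1 z) hf hc' hfc
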